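/- **Setting.** Let $V:\mathbb R\to\mathbb R$ be an even Schwartz function with $\int V\le 0$, let $\omega\in\mathbb R$, $\beta\in(0,1)$, and for $N\ge1$ let $$H_N=\sum_{j=1}^N\Big(-\tfrac12\partial_{x_j}^2+\tfrac{\omega^2}{2}x_j^2\Big)+\frac1N\sum_{1\le i<j\le N}N^\beta V\big(N^\beta(x_i-x_j)\big)$$ be the self-adjoint operator on $L^2(\mathbb R^N)$ obtained as the closure from Schwartz functions. Let $\psi_N(t)=e^{-itH_N}\psi_N(0)$, i.e. $i\partial_t\psi_N=H_N\psi_N$, where $\psi_N(0)\in L^2(\mathbb R^N)$ is permutation symmetric and $\|\psi_N(0)\|_{L^2}=1$. For $1\le k\le N$ let $$\gamma_N^{(k)}(t,\mathbf x_k;\mathbf x_k')=\int\psi_N(t,\mathbf x_k,\mathbf x_{N-k})\overline{\psi_N(t,\mathbf x_k',\mathbf x_{N-k})}\,d\mathbf x_{N-k}$$ be the marginal densities and let $$u_N^{(k)}(\tau,\mathbf y_k;\mathbf y_k')=\frac{e^{i\frac{\omega^2\tau}{1+\omega^2\tau^2}\frac{|\mathbf y_k|^2-|\mathbf y_k'|^2}{2}}}{(1+\omega^2\tau^2)^{k/2}}\;\gamma_N^{(k)}\Big(\tfrac{\arctan(\omega\tau)}{\omega},\tfrac{\mathbf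 y_k}{\sqrt{1+\omega^2\tau^2}};\tfrac{\mathbf y_k'}{\sqrt{1+\omega^2\tau^2}}\Big)$$ be their inverse lens transforms, regarded as kernels of operators on $L^2(\mathbb R^k)$; put $u_N^{(k)}=0$ for $k>N$. (For $\omega=0$, $\arctan(\omega\tau)/\omega$ is read as $\tau$ and $\tan(\omega t)/\omega$ as $t$.) Let $L^{(k)}=\prod_{j=1}^k(1-\partial_{y_j}^2)^{1/2}$. Let $T_0>0$ with $|\omega|T_0<\pi/2$, and put $a=\frac{\tan\omega T_0}{\omega}$. Assume the energy condition: there is a constant $C$ such that for every $k\ge1$ there is $N_0(k)$ with $$\sup_{\tau\in[-a,a]}\operatorname{Tr}L^{(k)}u_N^{(k)}(\tau)L^{(k)}\le C^k\qquad\text{for all }N\ge N_0(k).$$ **Topology.** Let $\mathcal K_k$ and $\mathcal L^1_k$ be the spaces of compact and of trace class operators on $L^2(\mathbb R^k)$. For each $k\ge1$ fix a dense sequence $(J_i^{(k)})_{i\ge1}$ in the unit ball of $\mathcal K_k$ and put $$d_k(\gamma,\tilde\gamma)=\sum_{i\ge1}2^{-i}\big|\operatorname{Tr}J_i^{(k)}(\gamma-\tilde\gamma)\big|\quad(\gamma,\tilde\gamma\in\mathcal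 L^1_k).$$ For $T\in[-a,a]$ let $C([0,T],\mathcal L_k^1)$ be the set of $d_k$-continuous functions on $[0,T]$ ($[T,0]$ if $T<0$) with the metric $\hat d_k(\gamma,\tilde\gamma)=\sup_{\tau}d_k(\gamma(\tau),\tilde\gamma(\tau))$, and let $\tau_{prod}$ be the product topology on $\prod_{k\ge1}C([0,T],\mathcal L^1_k)$. **Theorem (Compactness).** For every such $T$, the families $\Gamma_N=\{u_N^{(k)}\}_{k\ge1}$ belong to $\prod_{k\ge1}C([0,T],\mathcal L_k^1)$, and the sequence $(\Gamma_N)_N$ is relatively compact for $\tau_{prod}$. If $\Gamma=\{u^{(k)}\}_{k\ge1}$ is any limit point of the sequence, then for all $k\ge1$ and all $\tau\in[0,T]$ the operator $u^{(k)}(\tau)$ is a nonnegative trace class operator, symmetric under permutations of the particles, with $\operatorname{Tr}u^{(k)}(\tau)\le1$; moreover $$\sup_{\tau\in[0,T]}\operatorname{Tr}L^{(k)}u^{(k)}(\tau)L^{(k)}\le C^k$$ with the constant $C$ of the energy condition. -/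

import Mathlib

open MeasureTheory Filter Topology
open scoped SchwartzMap ComplexConjugate FourierTransform InnerProductSpace

namespace LensBBGKY

noncomputable section

/-! ### Trace class operators on a Hilbert space -/

section Trace

variable {H : Type*} [NormedAddCommGroup H] [InnerProductSpace ℂ H] [CompleteSpace H]

/-- `T` is trace class (equivalently, on a Hilbert space, nuclear): `T = ∑ₙ |fₙ⟩⟨gₙ|` with
`∑ₙ ‖fₙ‖ ‖gₙ‖ < ∞`. -/
def IsTraceClass (T : H →L[ℂ] H) : Prop :=
  ∃ f g : ℕ → H, Summable (fun n => ‖f n‖ * ‖g n‖) ∧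
    ∀ x : H, HasSum (fun n => inner ℂ (g n) x • f n) (T x)

/-- The trace `∑ᵢ ⟨eᵢ, T eᵢ⟩` over a Hilbert basis `(eᵢ)`; for trace class `T` the sum converges
absolutely and does not depend on the basis. -/
def opTrace (T : H →L[ℂ] H) : ℂ :=
  ∑' e : (exists_hilbertBasis ℂ H).choose, inner ℂ (e : H) (T (e : H))

end Trace

/-! ### The spaces -/

/-- The configuration space `ℝᵏ` of `k` particles on the line. -/
abbrev Conf (k : ℕ) := EuclideanSpace ℝ (Fin k)

/-- `L²(ℝᵏ)`. -/
abbrev L2 (k : ℕ) := Lp ℂ 2 (volume : Measure (Conf k))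

/-- The space `𝓛¹_k` of trace class operators on `L²(ℝᵏ)`. -/
structure TraceClassOp (k : ℕ) where
  op : L2 k →L[ℂ] L2 k
  isTraceClass : IsTraceClass op

/-- `(Jᵢ)` is a dense sequence in the unit ball of the space `𝓚_k` of compact operators. -/
def IsDenseInCompactBall {k : ℕ} (J : ℕ → (L2 k →L[ℂ] L2 k)) : Prop :=
  (∀ i, IsCompactOperator (J i) ∧ ‖J i‖ ≤ 1) ∧
    ∀ A : L2 k →L[ℂ] L2 k, IsCompactOperator A → ‖A‖ ≤ 1 → A ∈ closure (Set.range J)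

/-- The metric `d_k(γ, γ') = ∑_{i ≥ 1} 2⁻ⁱ |Tr Jᵢ (γ - γ')|`; the sequence `J` starts at index `0`
here. -/
def weakStarDist {k : ℕ} (J : ℕ → (L2 k →L[ℂ] L2 k)) (γ γ' : TraceClassOp k) : ℝ :=
  ∑' i : ℕ, (1 / 2 : ℝ) ^ (i + 1) * ‖opTrace ((J i).comp (γ.op - γ'.op))‖

/-- The space `C([0,T], 𝓛¹_k)` of `d_k`-continuous functions. The interval is `[T, 0]` if
`T < 0`. -/
structure TraceClassPath {k : ℕ} (J : ℕ → (L2 k →L[ℂ] L2 k)) (T : ℝ) where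
  toFun : Set.uIcc 0 T → TraceClassOp k
  continuous : ∀ τ₀ : Set.uIcc 0 T,
    Tendsto (fun τ => weakStarDist J (toFun τ) (toFun τ₀)) (𝓝 τ₀) (𝓝 0)

/-- The metric `d̂_k(γ, γ') = sup_{τ} d_k(γ(τ), γ'(τ))`. -/
def pathDist {k : ℕ} {J : ℕ → (L2 k →L[ℂ] L2 k)} {T : ℝ} (γ γ' : TraceClassPath J T) : ℝ :=
  ⨆ τ : Set.uIcc 0 T, weakStarDist J (γ.toFun τ) (γ'.toFun τ)

/-- The topology generated by the open balls of the metric `d̂_k`. -/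
instance {k : ℕ} (J : ℕ → (L2 k →L[ℂ] L2 k)) (T : ℝ) : TopologicalSpace (TraceClassPath J T) :=
  TopologicalSpace.generateFrom
    {s | ∃ (γ : TraceClassPath J T) (r : ℝ), s = {γ' | pathDist γ' γ < r}}

/-- The space of all families `(u⁽ᵏ⁾)_{k ≥ 1}` with `u⁽ᵏ⁾ ∈ C([0,T], 𝓛¹_k)`; its topology is the
product topology of the topologies of the metrics `d̂_k`. -/
abbrev HierarchySpace (J : ∀ k : ℕ+, ℕ → (L2 k →L[ℂ] L2 k)) (T : ℝ) :=
  ∀ k : ℕ+, TraceClassPath (J k) T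

/-! ### Permutation symmetry -/

/-- `(x₁, …, x_k) ↦ (x_{σ(1)}, …, x_{σ(k)})`. -/
def permute {k : ℕ} (σ : Equiv.Perm (Fin k)) (x : Conf k) : Conf k :=
  WithLp.toLp 2 (fun i => x (σ i))

/-- `ψ ∈ L²_s(ℝᵏ)`: invariance under permutations of the particles. -/
def IsSymmetricState {k : ℕ} (ψ : L2 k) : Prop :=
  ∀ σ : Equiv.Perm (Fin k), ∀ᵐ x : Conf k, ψ (permute σ x) = ψ x

/-- The operator is invariant under permutations of the particles, on either side: its kernel
satisfies `u(x_σ; x'_π) = u(x; x')` for all permutations `σ` and `π`. -/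
def IsSymmetricOp {k : ℕ} (u : L2 k →L[ℂ] L2 k) : Prop :=
  (∀ f : L2 k, IsSymmetricState (u f)) ∧
    ∀ (σ : Equiv.Perm (Fin k)) (f g : L2 k),
      (∀ᵐ x : Conf k, g x = f (permute σ x)) → u g = u f

/-! ### The `N`-body evolution -/

/-- The function `H_N φ`, where `H_N = ∑ⱼ (-½ ∂ⱼ² + ½ ω² xⱼ²) + N⁻¹ ∑_{i<j} N^β V(N^β (xᵢ - xⱼ))`. -/
def hamiltonian (V : 𝓢(ℝ, ℝ)) (ω β : ℝ) (N : ℕ) (φ : 𝓢(Conf N, ℂ)) (x : Conf N) : ℂ :=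
  -(1 / 2 : ℂ) * Laplacian.laplacian (φ : Conf N → ℂ) x
    + (((∑ j, ω ^ 2 / 2 * (x j) ^ 2)
      + 1 / (N : ℝ) * ∑ i, ∑ j ∈ Finset.Ioi i,
          (N : ℝ) ^ β * V ((N : ℝ) ^ β * (x i - x j)) : ℝ) : ℂ) * φ x

/-- The graph of `H_N` on Schwartz functions, in `L²(ℝᴺ) × L²(ℝᴺ)`. -/
def hamiltonianGraph (V : 𝓢(ℝ, ℝ)) (ω β : ℝ) (N : ℕ) : Set (L2 N × L2 N) :=
  {p | ∃ φ : 𝓢(Conf N, ℂ), (∀ᵐ x : Conf N, p.1 x = φ x) ∧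
    ∀ᵐ x : Conf N, p.2 x = hamiltonian V ω β N φ x}

/-- `U` is the strongly continuous unitary group `t ↦ exp(-i t H_N)`, that is, the solution operator
of `i ∂ₜ ψ = H_N ψ`, where `H_N` is the self-adjoint operator that is the closure of the Hamiltonian
on Schwartz functions: the graph `{(f, h) | d/dt U(t) f = -i h at t = 0}` of the generator is the
closure of the graph of the Hamiltonian. -/
structure IsEvolution (V : 𝓢(ℝ, ℝ)) (ω β : ℝ) (N : ℕ) (U : ℝ → (L2 N →L[ℂ] L2 N)) : Prop where
  zero : U 0 = ContinuousLinearMap.id ℂ (L2 N)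
  add : ∀ s t, U (s + t) = (U s).comp (U t)
  isometry : ∀ t f, ‖U t f‖ = ‖f‖
  continuous : ∀ f, Continuous fun t => U t f
  generator : {p : L2 N × L2 N | HasDerivAt (fun t : ℝ => U t p.1) (-Complex.I • p.2) 0} =
    closure (hamiltonianGraph V ω β N)

/-! ### Marginal densities and the lens transform -/

/-- `(x_k, x_{N-k}) ↦ x_N`. -/
def join {N k : ℕ} (x : Conf k) (z : Conf (N - k)) : Conf N :=
  WithLp.toLp 2 fun i : Fin N =>
    if h : (i : ℕ) < k then x ⟨i, h⟩ else z ⟨i - k, by omega⟩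

/-- The kernel `γ⁽ᵏ⁾(x; x') = ∫ ψ(x, z) conj ψ(x', z) dz` of the `k`-particle marginal density
of `ψ`, for `k ≤ N`. -/
def marginalKernel {N : ℕ} (ψ : L2 N) (k : ℕ) (x x' : Conf k) : ℂ :=
  ∫ z : Conf (N - k), ψ (join x z) * conj (ψ (join x' z))

/-- `τ = tan(ωt)/ω`, read as `t` if `ω = 0`. -/
def lensTime (ω t : ℝ) : ℝ := if ω = 0 then t else Real.tan (ω * t) / ω

/-- `t = arctan(ωτ)/ω`, read as `τ` if `ω = 0`. -/
def lensTimeInv (ω τ : ℝ) : ℝ := if ω = 0 then τ else Real.arctan (ω * τ) / ω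

/-- The inverse lens transform `T_k⁻¹ γ` of a time-dependent kernel `γ(t, x; x')`, at `(τ, y; y')`. -/
def lensInv (ω : ℝ) {k : ℕ} (γ : ℝ → Conf k → Conf k → ℂ) (τ : ℝ) (y y' : Conf k) : ℂ :=
  Complex.exp (Complex.I *
      ((ω ^ 2 * τ / (1 + ω ^ 2 * τ ^ 2) * ((‖y‖ ^ 2 - ‖y'‖ ^ 2) / 2) : ℝ) : ℂ))
    / (((1 + ω ^ 2 * τ ^ 2) ^ ((k : ℝ) / 2) : ℝ) : ℂ)
    * γ (lensTimeInv ω τ) ((√(1 + ω ^ 2 * τ ^ 2))⁻¹ • y) ((√(1 + ω ^ 2 * τ ^ 2))⁻¹ • y')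

/-- `T` is the integral operator with kernel `K`. -/
def HasKernel {k : ℕ} (T : L2 k →L[ℂ] L2 k) (K : Conf k → Conf k → ℂ) : Prop :=
  ∀ f : L2 k, ∀ᵐ x : Conf k, T f x = ∫ x', K x x' * f x'

open Classical in
/-- The bounded operator with kernel `K` (unique if it exists; `0` if there is none). -/
def kernelOp {k : ℕ} (K : Conf k → Conf k → ℂ) : L2 k →L[ℂ] L2 k :=
  if h : ∃ T : L2 k →L[ℂ] L2 k, HasKernel T K then h.choose else 0

/-- `u_N⁽ᵏ⁾(τ)`, the inverse lens transform of the `k`-particle marginal density of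
`ψ_N(t) = U(t) ψ_N(0)`, as an operator on `L²(ℝᵏ)`; it is `0` for `k > N`. -/
def lensMarginal (ω : ℝ) {N : ℕ} (U : ℝ → (L2 N →L[ℂ] L2 N)) (ψ₀ : L2 N) (k : ℕ) (τ : ℝ) :
    L2 k →L[ℂ] L2 k :=
  if k ≤ N then kernelOp (lensInv ω (fun t => marginalKernel (U t ψ₀) k) τ) else 0

/-! ### The energy bound -/

/-- `f` is in the domain of `L⁽ᵏ⁾ = ∏ⱼ (1 - ∂ⱼ²)^{1/2}`, and `L⁽ᵏ⁾ f = g`. The Fourier transform has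
the kernel `exp(-2πi⟨x, ξ⟩)`, so that `1 - ∂ⱼ²` becomes `1 + (2πξⱼ)²`. -/
def LMaps {k : ℕ} (f g : L2 k) : Prop :=
  ∀ᵐ ξ : Conf k, (𝓕 g : L2 k) ξ =
    ((∏ j, √(1 + (2 * Real.pi * ξ j) ^ 2) : ℝ) : ℂ) * (𝓕 f : L2 k) ξ

/-- `Tr L⁽ᵏ⁾ u L⁽ᵏ⁾ ≤ c` for a nonnegative operator `u`: the operator `L⁽ᵏ⁾ u L⁽ᵏ⁾` is defined on the
(dense) domain of `L⁽ᵏ⁾`, where it agrees with a trace class operator `B` with `Tr B ≤ c`. -/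
def EnergyAtMost {k : ℕ} (u : L2 k →L[ℂ] L2 k) (c : ℝ) : Prop :=
  ∃ B : L2 k →L[ℂ] L2 k, IsTraceClass B ∧ (∀ f g : L2 k, LMaps f g → LMaps (u g) (B f)) ∧
    (opTrace B).re ≤ c

end

end LensBBGKY

open LensBBGKY

/-! The theorem is Arzelà–Ascoli for each `k`, followed by Tychonoff. For `k ≤ N` the operator
`u_N⁽ᵏ⁾(τ)` is a Gram operator `X* X` whose Hilbert–Schmidt mass is `‖ψ_N‖² = 1`, so all values are
nonnegative of trace at most one. On such operators convergence in `d_k` amounts to weak operator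
convergence (`tendsto_weakStarDist`, `tendsto_inner_of_weakStarDist`), and they form a weakly
compact set: bounded forms converge along ultrafilters and the trace is lower semicontinuous
(`exists_weak_limit`, `isPosTrace_of_tendsto`). Hence relative compactness of the paths
(`isCompact_paths`) only needs every matrix element `⟨g, u_N⁽ᵏ⁾(τ) f⟩` to be equicontinuous in `τ`,
uniformly in `N`.

The inverse lens transform is conjugation by strongly continuous unitaries that do not depend on
`N`, so it suffices to treat `γ_N⁽ᵏ⁾` between Schwartz functions (`equiAt_conj`, `equiAt_of_dense`).
With `R_f ψ = ∫ conj f(x) ψ(x, ·) dx`, the matrix element is `⟨R_f ψ, R_g ψ⟩`, and its time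
derivative is a commutator form with `H_N`. This form is computed on Schwartz functions, extended to
the generator by closure, and integrated in time for general `ψ`. One-particle terms in the first
`k` variables move onto `f` and `g` by parts; everything that acts only on the other variables
cancels. The at most `k²` interactions inside the marginal are `O(N^β)` in sup norm and carry the
prefactor `1/N`. Each of the at most `kN` mixed interactions must be `O(1)`: split `|V_N|` into two
square roots and use Cauchy–Schwarz. The `L¹` norm of `V_N` does not depend on `N`, and the
one-dimensional Sobolev inequality controls an `L¹` weight along lines by one derivative
(`lintegral_mul_enorm_sq_le`). For `f` that derivative is explicit; for `ψ_N` it comes from the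
energy condition with `k = 2` and permutation symmetry, which the evolution preserves
(`lintegral_scaledV_pair_le`). The outcome is a Lipschitz bound with constant independent of `N`
(`norm_inner_marginalOp_lens_le`).

Limit points inherit positivity, symmetry and the trace bound through weak limits. For the energy
bound write `u_N = M B_N M` with the bounded operator `M = (L⁽ᵏ⁾)⁻¹` and take a weak limit of the
`B_N` (`energyAtMost_of_tendsto`). -/

namespace LensBBGKY

noncomputable section

/-! ### Trace class operators -/

section TraceTheory

open scoped ENNReal

variable {H : Type*} [NormedAddCommGroup H] [InnerProductSpace ℂ H] [CompleteSpace H]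

variable (H) in
/-- The Hilbert basis used in the definition of `opTrace`. -/
def traceBasis : HilbertBasis (exists_hilbertBasis ℂ H).choose ℂ H :=
  (exists_hilbertBasis ℂ H).choose_spec.choose

theorem opTrace_eq_tsum (T : H →L[ℂ] H) :
    opTrace T = ∑' i, inner ℂ (traceBasis H i) (T (traceBasis H i)) := by
  have h : ⇑(traceBasis H) = _ := (exists_hilbertBasis ℂ H).choose_spec.choose_spec
  simp only [opTrace, h]

/-- Parseval with values in the extended nonnegative reals, so that Hilbert–Schmidt sums can be
interchanged before they are known to be finite. -/
theorem tsum_enorm_inner_sq {ι : Type*} (b : HilbertBasis ι ℂ H) (x : H) :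
    ∑' i, ‖inner ℂ (b i) x‖ₑ ^ 2 = ‖x‖ₑ ^ 2 := by
  have h := b.hasSum_inner_mul_inner x x
  have h2 : HasSum (fun i => ‖inner ℂ (b i) x‖ ^ 2) (‖x‖ ^ 2) := by
    have := (Complex.hasSum_iff _ _).1 h |>.1
    convert this using 1
    · ext i
      rw [← inner_conj_symm x (b i), ← Complex.normSq_eq_conj_mul_self, Complex.ofReal_re,
        Complex.normSq_eq_norm_sq]
    · exact (inner_self_eq_norm_sq (𝕜 := ℂ) x).symm
  have e : ∀ r : H, ‖r‖ₑ ^ 2 = ENNReal.ofReal (‖r‖ ^ 2) := fun r => by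
    rw [ENNReal.ofReal_pow (norm_nonneg _), ofReal_norm]
  have e' : ∀ r : ℂ, ‖r‖ₑ ^ 2 = ENNReal.ofReal (‖r‖ ^ 2) := fun r => by
    rw [ENNReal.ofReal_pow (norm_nonneg _), ofReal_norm]
  simp_rw [e, e']
  rw [← ENNReal.ofReal_tsum_of_nonneg (fun i => by positivity) h2.summable, h2.tsum_eq]

/-- The Hilbert–Schmidt norm of an operator and of its adjoint agree. -/
theorem tsum_enorm_sq_adjoint {K : Type*} [NormedAddCommGroup K] [InnerProductSpace ℂ K]
    [CompleteSpace K] {ι κ : Type*} (b : HilbertBasis ι ℂ H) (b' : HilbertBasis κ ℂ K)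
    (X : H →L[ℂ] K) :
    ∑' i, ‖X (b i)‖ₑ ^ 2 = ∑' j, ‖X.adjoint (b' j)‖ₑ ^ 2 := by
  simp_rw [← tsum_enorm_inner_sq b', ← tsum_enorm_inner_sq b]
  rw [ENNReal.tsum_comm]
  refine tsum_congr fun j => tsum_congr fun i => ?_
  rw [ContinuousLinearMap.adjoint_inner_right, ← inner_conj_symm, RCLike.enorm_conj]

/-- For fixed `n`, Cauchy–Schwarz in `ℓ²` and Parseval bound the sum over the basis by `‖gₙ‖ ‖fₙ‖`.
The absolute convergence justifies interchanging the two sums in the trace. -/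
theorem summable_inner_mul_inner_prod {ι κ : Type*} (b : HilbertBasis κ ℂ H) (f g : ι → H)
    (hfg : Summable fun n => ‖f n‖ * ‖g n‖) :
    Summable fun p : ι × κ => inner ℂ (g p.1) (b p.2) * inner ℂ (b p.2) (f p.1) := by
  have key : ∀ x y : H, Summable (fun i => ‖inner ℂ x (b i) * inner ℂ (b i) y‖) ∧
      ∑' i, ‖inner ℂ x (b i) * inner ℂ (b i) y‖ ≤ ‖x‖ * ‖y‖ := by
    intro x y
    have sq : ∀ z : H, HasSum (fun i => ‖inner ℂ (b i) z‖ ^ 2) (‖z‖ ^ 2) := by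
      intro z
      have := (Complex.hasSum_iff _ _).1 (b.hasSum_inner_mul_inner z z) |>.1
      convert this using 1
      · ext i
        rw [← inner_conj_symm z (b i), ← Complex.normSq_eq_conj_mul_self, Complex.ofReal_re,
          Complex.normSq_eq_norm_sq]
      · exact (inner_self_eq_norm_sq (𝕜 := ℂ) z).symm
    have cs := Real.summable_and_inner_le_Lp_mul_Lq_tsum_of_nonneg (p := 2) (q := 2)
      Real.HolderConjugate.two_two
      (f := fun i => ‖inner ℂ x (b i)‖) (g := fun i => ‖inner ℂ (b i) y‖)
      (fun _ => norm_nonneg _) (fun _ => norm_nonneg _)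
      (by simp_rw [norm_inner_symm x]; exact_mod_cast (sq x).summable)
      (by exact_mod_cast (sq y).summable)
    simp_rw [norm_mul]
    refine ⟨cs.1, cs.2.trans (le_of_eq ?_)⟩
    simp_rw [norm_inner_symm x]
    have e : ∀ z : H, (∑' i, ‖inner ℂ (b i) z‖ ^ (2 : ℝ)) ^ (1 / 2 : ℝ) = ‖z‖ := by
      intro z
      have : ∑' i, ‖inner ℂ (b i) z‖ ^ (2 : ℝ) = ‖z‖ ^ 2 := by
        rw [← (sq z).tsum_eq]; exact tsum_congr fun i => by norm_cast
      rw [this, ← Real.sqrt_eq_rpow, Real.sqrt_sq (norm_nonneg _)]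
    rw [e, e]
  refine Summable.of_norm ?_
  refine (summable_prod_of_nonneg fun _ => norm_nonneg _).2 ⟨fun n => (key (g n) (f n)).1, ?_⟩
  refine Summable.of_nonneg_of_le (fun n => tsum_nonneg fun _ => norm_nonneg _)
    (fun n => (key (g n) (f n)).2) ?_
  simpa only [mul_comm] using hfg

/-- The trace of `∑ₙ |fₙ⟩⟨gₙ|` is `∑ₙ ⟨gₙ, fₙ⟩`. -/
theorem hasSum_trace {ι κ : Type*} (b : HilbertBasis κ ℂ H) (T : H →L[ℂ] H) (f g : ι → H)
    (hfg : Summable fun n => ‖f n‖ * ‖g n‖)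
    (hT : ∀ x, HasSum (fun n => inner ℂ (g n) x • f n) (T x)) :
    HasSum (fun i => inner ℂ (b i) (T (b i))) (∑' n, inner ℂ (g n) (f n)) := by
  have hs := summable_inner_mul_inner_prod b f g hfg
  have h1 : ∀ i, HasSum (fun n => inner ℂ (g n) (b i) * inner ℂ (b i) (f n))
      (inner ℂ (b i) (T (b i))) := by
    intro i
    have := (hT (b i)).mapL (innerSL ℂ (b i))
    simpa [inner_smul_right] using this
  have h2 : ∑' n, inner ℂ (g n) (f n) =
      ∑' p : ι × κ, inner ℂ (g p.1) (b p.2) * inner ℂ (b p.2) (f p.1) := by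
    rw [hs.tsum_prod]
    exact tsum_congr fun n => (b.tsum_inner_mul_inner _ _).symm
  rw [h2]
  have hs' := (Equiv.prodComm κ ι).hasSum_iff.2 hs.hasSum
  exact hs'.prod_fiberwise h1

theorem opTrace_of_hasSum {ι : Type*} (T : H →L[ℂ] H) (f g : ι → H)
    (hfg : Summable fun n => ‖f n‖ * ‖g n‖)
    (hT : ∀ x, HasSum (fun n => inner ℂ (g n) x • f n) (T x)) :
    opTrace T = ∑' n, inner ℂ (g n) (f n) := by
  rw [opTrace_eq_tsum]
  exact (hasSum_trace _ T f g hfg hT).tsum_eq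

theorem IsTraceClass.summable_trace {T : H →L[ℂ] H} (hT : IsTraceClass T) :
    Summable fun i => inner ℂ (traceBasis H i) (T (traceBasis H i)) := by
  obtain ⟨f, g, h, hs⟩ := hT
  exact (hasSum_trace _ T f g h hs).summable

theorem IsTraceClass.comp_left {T : H →L[ℂ] H} (hT : IsTraceClass T) (A : H →L[ℂ] H) :
    IsTraceClass (A.comp T) := by
  obtain ⟨f, g, h, hs⟩ := hT
  refine ⟨fun n => A (f n), g, ?_, fun x => ?_⟩
  · refine Summable.of_nonneg_of_le (fun n => by positivity) (fun n => ?_) (h.mul_left ‖A‖)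
    rw [← mul_assoc]
    gcongr
    exact A.le_opNorm _
  · simpa using (hs x).mapL A

/-- `K` is the nuclear sum of one chosen representation. No positivity is needed, so the bound
applies to arbitrary elements of the path space. -/
theorem IsTraceClass.exists_bound {T : H →L[ℂ] H} (hT : IsTraceClass T) :
    ∃ K : ℝ, 0 ≤ K ∧ ∀ A : H →L[ℂ] H, ‖opTrace (A.comp T)‖ ≤ ‖A‖ * K := by
  obtain ⟨f, g, h, hs⟩ := hT
  refine ⟨∑' n, ‖f n‖ * ‖g n‖, tsum_nonneg fun n => by positivity, fun A => ?_⟩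
  have hle : ∀ n, ‖A (f n)‖ * ‖g n‖ ≤ ‖A‖ * (‖f n‖ * ‖g n‖) := fun n => by
    rw [← mul_assoc]
    gcongr
    exact A.le_opNorm _
  have hsum : Summable fun n => ‖A (f n)‖ * ‖g n‖ :=
    Summable.of_nonneg_of_le (fun n => by positivity) hle (h.mul_left ‖A‖)
  rw [opTrace_of_hasSum (A.comp T) (fun n => A (f n)) g hsum
    (fun x => by simpa using (hs x).mapL A), ← tsum_mul_left]
  refine tsum_of_norm_bounded (h.mul_left ‖A‖).hasSum fun n => ?_
  refine (norm_inner_le_norm _ _).trans ?_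
  rw [mul_comm]
  exact hle n

theorem opTrace_comp_sub {T S : H →L[ℂ] H} (hT : IsTraceClass T) (hS : IsTraceClass S)
    (A : H →L[ℂ] H) :
    opTrace (A.comp (T - S)) = opTrace (A.comp T) - opTrace (A.comp S) := by
  rw [opTrace_eq_tsum, opTrace_eq_tsum, opTrace_eq_tsum,
    ← (hT.comp_left A).summable_trace.tsum_sub (hS.comp_left A).summable_trace]
  simp

theorem opTrace_sub_comp {T : H →L[ℂ] H} (hT : IsTraceClass T) (A B : H →L[ℂ] H) :
    opTrace ((A - B).comp T) = opTrace (A.comp T) - opTrace (B.comp T) := by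
  rw [opTrace_eq_tsum, opTrace_eq_tsum, opTrace_eq_tsum,
    ← (hT.comp_left A).summable_trace.tsum_sub (hT.comp_left B).summable_trace]
  simp

/-- The trace of `A T` for `A = ∑ᵢ |aᵢ⟩⟨cᵢ|` of finite rank. -/
theorem opTrace_finiteRank_comp {ι : Type*} [Fintype ι] (a c : ι → H) (A T : H →L[ℂ] H)
    (hA : ∀ x, A x = ∑ i, inner ℂ (c i) x • a i) :
    opTrace (A.comp T) = ∑ i, inner ℂ (c i) (T (a i)) := by
  rw [opTrace_of_hasSum (A.comp T) a (fun i => T.adjoint (c i)) (Summable.of_finite)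
    (fun x => ?_), tsum_fintype]
  · simp [ContinuousLinearMap.adjoint_inner_left]
  · simp only [ContinuousLinearMap.adjoint_inner_left, ContinuousLinearMap.comp_apply, hA]
    exact hasSum_fintype _

/-- The rank one operator `|a⟩⟨c|`. -/
def ketBra (a c : H) : H →L[ℂ] H := (innerSL ℂ c).smulRight a

@[simp] theorem ketBra_apply (a c x : H) : ketBra a c x = inner ℂ c x • a := by
  simp [ketBra]

theorem norm_ketBra_le (a c : H) : ‖ketBra a c‖ ≤ ‖a‖ * ‖c‖ := by
  refine ContinuousLinearMap.opNorm_le_bound _ (by positivity) fun x => ?_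
  rw [ketBra_apply, norm_smul]
  nlinarith [norm_inner_le_norm (𝕜 := ℂ) c x, norm_nonneg a]

theorem isCompactOperator_ketBra (a c : H) : IsCompactOperator (ketBra a c) := by
  have h : IsCompactOperator (innerSL ℂ c : H →L[ℂ] ℂ) :=
    (isCompactOperator_id (E := ℂ)).comp_clm (innerSL ℂ c : H →L[ℂ] ℂ)
  exact h.clm_comp ((ContinuousLinearMap.id ℂ ℂ).smulRight a)

theorem opTrace_ketBra_comp (a c : H) (T : H →L[ℂ] H) :
    opTrace ((ketBra a c).comp T) = inner ℂ c (T a) := by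
  rw [opTrace_finiteRank_comp (ι := Unit) (fun _ => a) (fun _ => c) _ _ (by simp)]
  simp

/-- Compact operators are norm limits of operators of finite rank. -/
theorem exists_finiteRank_approx {J : H →L[ℂ] H} (hJ : IsCompactOperator J) {ε : ℝ} (hε : 0 < ε) :
    ∃ (s : Finset (exists_hilbertBasis ℂ H).choose) (A : H →L[ℂ] H),
      (∀ x, A x = ∑ i : s, inner ℂ (J.adjoint (traceBasis H i)) x • traceBasis H i) ∧
      ‖J - A‖ ≤ ε := by
  set b := traceBasis H
  obtain ⟨K, hK, hKs⟩ := hJ.image_closedBall_subset_compact 1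
  obtain ⟨t, htf, ht⟩ := Metric.totallyBounded_iff.1 hK.totallyBounded (ε / 3) (by positivity)
  -- The projections onto spans of finitely many basis vectors are contractions tending strongly to
  -- the identity, hence uniformly on the compact closure of the image of the ball. An `ε/3`-net
  -- selects `s`, and the approximant is `P_s J`.
  let P : Finset (exists_hilbertBasis ℂ H).choose → H →L[ℂ] H :=
    fun s => ∑ i ∈ s, ketBra (b i) (b i)
  have hPx : ∀ s x, P s x = ∑ i ∈ s, inner ℂ (b i) x • b i := fun s x => by
    simp [P, sum_apply]
  have hP : ∀ s x, ‖P s x‖ ≤ ‖x‖ := by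
    intro s x
    refine le_of_sq_le_sq ?_ (norm_nonneg _)
    have h1 : ‖P s x‖ ^ 2 = ∑ i ∈ s, ‖inner ℂ (b i) x‖ ^ 2 := by
      have h2 := b.orthonormal.inner_sum (fun i => inner ℂ (b i) x) (fun i => inner ℂ (b i) x) s
      rw [← hPx, inner_self_eq_norm_sq_to_K] at h2
      have h3 : ((‖P s x‖ ^ 2 : ℝ) : ℂ) = ((∑ i ∈ s, ‖inner ℂ (b i) x‖ ^ 2 : ℝ) : ℂ) := by
        push_cast
        rw [← Complex.coe_algebraMap] at *
        refine h2.trans (Finset.sum_congr rfl fun i _ => ?_)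
        rw [RCLike.conj_mul]
      exact_mod_cast h3
    rw [h1]
    exact b.orthonormal.sum_inner_products_le x
  have hlim : ∀ y, Tendsto (fun s => P s y) atTop (𝓝 y) := fun y => by
    have := b.hasSum_repr y
    simp_rw [b.repr_apply_apply] at this
    simp only [hPx]
    exact this
  have hev : ∀ᶠ s in atTop, ∀ y ∈ t, dist (P s y) y < ε / 3 :=
    (htf.eventually_all (p := fun y s => dist (P s y) y < ε / 3)).2 fun y _ =>
      (Metric.tendsto_nhds.1 (hlim y)) _ (by positivity)
  obtain ⟨s, hs⟩ := hev.exists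
  refine ⟨s, (P s).comp J, fun x => ?_, ?_⟩
  · simp only [ContinuousLinearMap.comp_apply, hPx, ContinuousLinearMap.adjoint_inner_left]
    exact (Finset.sum_coe_sort s fun i => inner ℂ (b i) (J x) • b i).symm
  · refine ContinuousLinearMap.opNorm_le_of_unit_norm hε.le fun x hx => ?_
    have hxK := hKs ⟨x, by simp [hx], rfl⟩
    obtain ⟨y, hy, hxy⟩ := Set.mem_iUnion₂.1 (ht hxK)
    rw [Metric.mem_ball, dist_eq_norm] at hxy
    replace hxy : ‖J x - y‖ < ε / 3 := hxy
    have h1 := hs y hy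
    rw [dist_eq_norm] at h1
    have h2 := hP s (J x - y)
    have h3 : (J - (P s).comp J) x = (J x - y) - P s (J x - y) - (P s y - y) := by
      simp only [sub_apply, ContinuousLinearMap.comp_apply, map_sub]
      abel
    rw [h3]
    have h4 := norm_sub_le (J x - y - P s (J x - y)) (P s y - y)
    have h5 := norm_sub_le (J x - y) (P s (J x - y))
    linarith

theorem exists_sqrt {T : H →L[ℂ] H} (hT : T.IsPositive) :
    ∃ S : H →L[ℂ] H, S.IsPositive ∧ S.comp S = T := by
  have h0 : 0 ≤ T := (ContinuousLinearMap.nonneg_iff_isPositive T).2 hT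
  exact ⟨CFC.sqrt T, (ContinuousLinearMap.nonneg_iff_isPositive _).1 (CFC.sqrt_nonneg T),
    CFC.sqrt_mul_sqrt_self T h0⟩

/-- Expanding `X x` in the basis of the target gives a nuclear representation of `X* X` by the
vectors `X* bᵢ` on both sides; its nuclear sum is the squared Hilbert–Schmidt norm of `X*`. -/
theorem adjoint_comp_hasSum {ι : Type*} {K : Type*} [NormedAddCommGroup K]
    [InnerProductSpace ℂ K] [CompleteSpace K] (b : HilbertBasis ι ℂ K) (X : H →L[ℂ] K) (x : H) :
    HasSum (fun i => inner ℂ (X.adjoint (b i)) x • X.adjoint (b i)) ((X.adjoint.comp X) x) := by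
  have := (b.hasSum_repr (X x)).mapL X.adjoint
  simpa [b.repr_apply_apply, ContinuousLinearMap.adjoint_inner_left] using this

/-- Basis vectors are at distance `√2`, so the balls of radius `1/2` around them are disjoint.
Countability is needed to index nuclear representations by `ℕ` and to exchange basis sums with
integrals. -/
theorem HilbertBasis.countable_index [TopologicalSpace.SeparableSpace H] {ι : Type*}
    (b : HilbertBasis ι ℂ H) : Countable ι := by
  refine Pairwise.countable_of_isOpen_disjoint (s := fun i => Metric.ball (b i) (1 / 2))
    (fun i j hij => ?_) (fun i => Metric.isOpen_ball) (fun i => ⟨b i, by simp⟩)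
  refine Metric.ball_disjoint_ball ?_
  have h : ‖b i - b j‖ ^ 2 = 2 := by
    rw [@norm_sub_sq ℂ, b.orthonormal.1, b.orthonormal.1, b.orthonormal.2 hij]
    norm_num
  rw [dist_eq_norm]
  nlinarith [norm_nonneg (b i - b j)]

/-! ### Gram operators `X* X` and Hilbert–Schmidt norms. -/

section Gram

variable {K : Type*} [NormedAddCommGroup K] [InnerProductSpace ℂ K] [CompleteSpace K]
  {ι : Type*} (b : HilbertBasis ι ℂ H) {X : H →L[ℂ] K}

theorem summable_norm_sq_of_tsum_enorm_sq {κ E : Type*} [NormedAddCommGroup E] {v : κ → E}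
    (h : ∑' i, ‖v i‖ₑ ^ 2 ≠ ∞) : Summable fun i => ‖v i‖ ^ 2 := by
  have := ENNReal.summable_toReal h
  simpa using this

theorem tsum_enorm_sq_eq_ofReal {κ E : Type*} [NormedAddCommGroup E] {v : κ → E}
    (h : Summable fun i => ‖v i‖ ^ 2) :
    ∑' i, ‖v i‖ₑ ^ 2 = ENNReal.ofReal (∑' i, ‖v i‖ ^ 2) := by
  rw [ENNReal.ofReal_tsum_of_nonneg (fun i => by positivity) h]
  refine tsum_congr fun i => ?_
  rw [ENNReal.ofReal_pow (norm_nonneg _), ofReal_norm]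

include b in
/-- `X* X` is trace class if `X` is Hilbert–Schmidt. -/
theorem isTraceClass_adjoint_comp [TopologicalSpace.SeparableSpace K]
    (h : ∑' i, ‖X (b i)‖ₑ ^ 2 ≠ ∞) : IsTraceClass (X.adjoint.comp X) := by
  set c := traceBasis K
  have := HilbertBasis.countable_index c
  obtain ⟨e, he⟩ := exists_injective_nat (exists_hilbertBasis ℂ K).choose
  rw [tsum_enorm_sq_adjoint b c] at h
  have hs := summable_norm_sq_of_tsum_enorm_sq h
  -- The basis may be finite, so its index set is embedded in `ℕ` and the vectors are extended by
  -- zero.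
  let f : ℕ → H := Function.extend e (fun i => X.adjoint (c i)) 0
  have hfe : ∀ i, f (e i) = X.adjoint (c i) := fun i => he.extend_apply _ _ i
  have hf0 : ∀ n ∉ Set.range e, f n = 0 := fun n hn => by
    simp only [f]
    rw [Function.extend_apply' _ _ _ (by simpa using hn)]
    rfl
  refine ⟨f, f, ?_, fun x => ?_⟩
  · refine (he.summable_iff fun n hn => by simp [hf0 n hn]).1 ?_
    simpa only [Function.comp_def, hfe, ← sq] using hs
  · refine (he.hasSum_iff fun n hn => by simp [hf0 n hn]).1 ?_
    simpa only [Function.comp_def, hfe] using adjoint_comp_hasSum c X x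

/-- The trace of `X* X` is the square of the Hilbert–Schmidt norm of `X`. -/
theorem tsum_enorm_sq_eq_trace (h : IsTraceClass (X.adjoint.comp X)) :
    ∑' i, ‖X (b i)‖ₑ ^ 2 = ENNReal.ofReal (opTrace (X.adjoint.comp X)).re := by
  obtain ⟨f, g, hfg, hT⟩ := h
  have h1 := hasSum_trace b _ f g hfg hT
  rw [← opTrace_of_hasSum _ f g hfg hT] at h1
  have h2 : HasSum (fun i => ‖X (b i)‖ ^ 2) (opTrace (X.adjoint.comp X)).re := by
    have := ((Complex.hasSum_iff _ _).1 h1).1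
    convert this using 2 with i
    rw [ContinuousLinearMap.comp_apply, ContinuousLinearMap.adjoint_inner_right]
    exact (inner_self_eq_norm_sq (𝕜 := ℂ) _).symm
  rw [tsum_enorm_sq_eq_ofReal h2.summable, h2.tsum_eq]

/-- `A X* X` is the sum of `|A X* cᵢ⟩⟨X* cᵢ|`, and `∑ ‖X* cᵢ‖²` is the Hilbert–Schmidt norm squared
of `X*`, which equals the trace of `X* X`. -/
theorem norm_opTrace_comp_le_of_gram (h : IsTraceClass (X.adjoint.comp X)) (A : H →L[ℂ] H) :
    ‖opTrace (A.comp (X.adjoint.comp X))‖ ≤ ‖A‖ * (opTrace (X.adjoint.comp X)).re := by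
  set c := traceBasis K
  have h1 := tsum_enorm_sq_eq_trace (traceBasis H) h
  have h0 : 0 ≤ (opTrace (X.adjoint.comp X)).re := by
    rw [opTrace_eq_tsum, Complex.re_tsum h.summable_trace]
    refine tsum_nonneg fun i => ?_
    rw [ContinuousLinearMap.comp_apply, ContinuousLinearMap.adjoint_inner_right]
    exact inner_self_nonneg (𝕜 := ℂ)
  rw [tsum_enorm_sq_adjoint _ c] at h1
  have hs := summable_norm_sq_of_tsum_enorm_sq (h1 ▸ ENNReal.ofReal_ne_top)
  rw [tsum_enorm_sq_eq_ofReal hs, ENNReal.ofReal_eq_ofReal_iff (tsum_nonneg fun _ => by positivity)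
    h0] at h1
  have hle : ∀ i, ‖A (X.adjoint (c i))‖ * ‖X.adjoint (c i)‖ ≤ ‖A‖ * ‖X.adjoint (c i)‖ ^ 2 :=
    fun i => by
      rw [sq, ← mul_assoc]
      gcongr
      exact A.le_opNorm _
  rw [opTrace_of_hasSum (A.comp (X.adjoint.comp X)) (fun i => A (X.adjoint (c i)))
    (fun i => X.adjoint (c i))
    (Summable.of_nonneg_of_le (fun n => by positivity) hle (hs.mul_left ‖A‖))
    (fun x => by simpa using (adjoint_comp_hasSum c X x).mapL A), ← h1, ← tsum_mul_left]
  refine tsum_of_norm_bounded (hs.mul_left ‖A‖).hasSum fun n => ?_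
  refine (norm_inner_le_norm _ _).trans ?_
  rw [mul_comm]
  exact hle n

end Gram

/-- `T` is nonnegative and trace class, with trace at most `c`. -/
structure IsPosTrace (T : H →L[ℂ] H) (c : ℝ) : Prop where
  isPositive : T.IsPositive
  isTraceClass : IsTraceClass T
  trace_le : (opTrace T).re ≤ c

theorem exists_gram {T : H →L[ℂ] H} (hT : T.IsPositive) :
    ∃ S : H →L[ℂ] H, S.adjoint.comp S = T ∧ S.adjoint = S := by
  obtain ⟨S, hS, rfl⟩ := exists_sqrt hT
  have h := hS.isSelfAdjoint.adjoint_eq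
  exact ⟨S, by rw [h], h⟩

theorem IsPosTrace.norm_opTrace_comp_le {T : H →L[ℂ] H} {c : ℝ} (hT : IsPosTrace T c)
    (A : H →L[ℂ] H) : ‖opTrace (A.comp T)‖ ≤ ‖A‖ * c := by
  obtain ⟨S, rfl, -⟩ := exists_gram hT.isPositive
  exact (norm_opTrace_comp_le_of_gram hT.isTraceClass A).trans (by gcongr; exact hT.trace_le)

theorem IsPosTrace.norm_inner_le {T : H →L[ℂ] H} {c : ℝ} (hT : IsPosTrace T c) (x y : H) :
    ‖inner ℂ x (T y)‖ ≤ ‖x‖ * ‖y‖ * c := by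
  obtain ⟨S, rfl, -⟩ := exists_gram hT.isPositive
  have hc : 0 ≤ c := by
    refine le_trans ?_ hT.trace_le
    rw [opTrace_eq_tsum, Complex.re_tsum hT.isTraceClass.summable_trace]
    exact tsum_nonneg fun i => hT.isPositive.re_inner_nonneg_right _
  rw [← opTrace_ketBra_comp]
  refine (hT.norm_opTrace_comp_le _).trans ?_
  gcongr
  rw [mul_comm]
  exact norm_ketBra_le _ _

theorem IsPosTrace.sum_le {T : H →L[ℂ] H} {c : ℝ} (hT : IsPosTrace T c)
    (s : Finset (exists_hilbertBasis ℂ H).choose) :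
    ∑ i ∈ s, (inner ℂ (traceBasis H i) (T (traceBasis H i))).re ≤ c := by
  refine le_trans ?_ hT.trace_le
  have hs := hT.isTraceClass.summable_trace
  rw [opTrace_eq_tsum, Complex.re_tsum hs]
  exact (Complex.hasSum_re hs.hasSum).summable.sum_le_tsum s
    fun i _ => hT.isPositive.re_inner_nonneg_right _

/-- With `T = S* S` the diagonal entries are `‖S eᵢ‖²`, so bounded partial sums make `S`
Hilbert–Schmidt. The condition involves only finitely many matrix elements at a time and therefore
survives weak limits. -/
theorem isPosTrace_of_sum_le [TopologicalSpace.SeparableSpace H] {T : H →L[ℂ] H} {c : ℝ}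
    (hT : T.IsPositive)
    (h : ∀ s : Finset (exists_hilbertBasis ℂ H).choose,
      ∑ i ∈ s, (inner ℂ (traceBasis H i) (T (traceBasis H i))).re ≤ c) :
    IsPosTrace T c := by
  obtain ⟨S, rfl, -⟩ := exists_gram hT
  have e : ∀ i, (inner ℂ (traceBasis H i) ((S.adjoint.comp S) (traceBasis H i))).re =
      ‖S (traceBasis H i)‖ ^ 2 := fun i => by
    rw [ContinuousLinearMap.comp_apply, ContinuousLinearMap.adjoint_inner_right]
    exact inner_self_eq_norm_sq (𝕜 := ℂ) _
  have hs : Summable fun i => ‖S (traceBasis H i)‖ ^ 2 :=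
    summable_of_sum_le (fun i => by positivity) fun s => by simpa only [e] using h s
  have htc := isTraceClass_adjoint_comp (traceBasis H) (X := S)
    (by rw [tsum_enorm_sq_eq_ofReal hs]; exact ENNReal.ofReal_ne_top)
  refine ⟨hT, htc, ?_⟩
  rw [opTrace_eq_tsum, Complex.re_tsum htc.summable_trace]
  simp_rw [e]
  exact hs.tsum_le_of_sum_le fun s => by simpa only [e] using h s

theorem isPositive_of_tendsto {ι : Type*} {l : Filter ι} [l.NeBot] {T : ι → H →L[ℂ] H}
    {T' : H →L[ℂ] H} (hT : ∀ᶠ i in l, (T i).IsPositive)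
    (hlim : ∀ x y, Tendsto (fun i => inner ℂ x (T i y)) l (𝓝 (inner ℂ x (T' y)))) :
    T'.IsPositive := by
  rw [ContinuousLinearMap.isPositive_iff_complex]
  intro x
  have hre : 0 ≤ (inner ℂ x (T' x)).re :=
    ge_of_tendsto ((Complex.continuous_re.tendsto _).comp (hlim x x))
      (hT.mono fun i hi => hi.re_inner_nonneg_right x)
  have him : (inner ℂ x (T' x)).im = 0 := by
    refine tendsto_nhds_unique ((Complex.continuous_im.tendsto _).comp (hlim x x))
      (tendsto_const_nhds.congr' (hT.mono fun i hi => ?_))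
    have h := inner_conj_symm (𝕜 := ℂ) x (T i x)
    rw [hi.inner_left_eq_inner_right, Complex.conj_eq_iff_im] at h
    exact h.symm
  have h2 : inner ℂ (T' x) x = inner ℂ x (T' x) := by
    rw [← inner_conj_symm, Complex.conj_eq_iff_im]
    exact him
  rw [h2]
  exact ⟨Complex.ext rfl (by simpa using him.symm), hre⟩

/-- Lower semicontinuity of the trace: each finite partial trace passes to the limit. Mass can
escape in the limit, so only an upper bound is preserved. -/
theorem isPosTrace_of_tendsto [TopologicalSpace.SeparableSpace H] {ι : Type*} {l : Filter ι}
    [l.NeBot] {T : ι → H →L[ℂ] H} {T' : H →L[ℂ] H} {c : ℝ} (hT : ∀ᶠ i in l, IsPosTrace (T i) c)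
    (hlim : ∀ x y, Tendsto (fun i => inner ℂ x (T i y)) l (𝓝 (inner ℂ x (T' y)))) :
    IsPosTrace T' c := by
  refine isPosTrace_of_sum_le (isPositive_of_tendsto (hT.mono fun i hi => hi.1) hlim) fun s => ?_
  refine le_of_tendsto (tendsto_finsetSum s fun i _ =>
    (Complex.continuous_re.tendsto _).comp (hlim (traceBasis H i) (traceBasis H i))) ?_
  exact hT.mono fun i hi => hi.sum_le s

/-- Bounded families of operators have weak limits along ultrafilters. -/
theorem exists_weak_limit {ι : Type*} (l : Ultrafilter ι) {T : ι → H →L[ℂ] H} {c : ℝ}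
    (hT : ∀ᶠ i in l, ∀ x y, ‖inner ℂ x (T i y)‖ ≤ ‖x‖ * ‖y‖ * c) :
    ∃ T' : H →L[ℂ] H, ∀ x y, Tendsto (fun i => inner ℂ x (T i y)) l (𝓝 (inner ℂ x (T' y))) := by
  have hex : ∀ x y, ∃ a : ℂ, Tendsto (fun i => inner ℂ x (T i y)) l (𝓝 a) := by
    intro x y
    have hK : IsCompact (Metric.closedBall (0 : ℂ) (‖x‖ * ‖y‖ * c)) := isCompact_closedBall _ _
    have hmem : ∀ᶠ i in l, inner ℂ x (T i y) ∈ Metric.closedBall (0 : ℂ) (‖x‖ * ‖y‖ * c) :=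
      hT.mono fun i hi => by simpa using hi x y
    obtain ⟨a, -, ha⟩ := hK.ultrafilter_le_nhds (l.map fun i => inner ℂ x (T i y))
      (le_principal_iff.2 hmem)
    exact ⟨a, ha⟩
  choose B hB using hex
  have hbd : ∀ x y, ‖B x y‖ ≤ c * ‖x‖ * ‖y‖ := fun x y => by
    refine le_of_tendsto (hB x y).norm (hT.mono fun i hi => (hi x y).trans (le_of_eq (by ring)))
  -- The limits `B x y` inherit sesquilinearity by uniqueness of limits. The Riesz operator is
  -- characterised by `⟨T' y, x⟩`, so the form passed to it is the conjugate of `B x y`, antilinear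
  -- in `y`.
  let L : H →ₗ⋆[ℂ] H →ₗ[ℂ] ℂ := LinearMap.mk₂'ₛₗ (starRingEnd ℂ) (RingHom.id ℂ)
    (fun y x => conj (B x y))
    (fun y y' x => by
      rw [← map_add]
      congr 1
      refine tendsto_nhds_unique (hB x (y + y')) ?_
      simpa [inner_add_right] using (hB x y).add (hB x y'))
    (fun a y x => by
      simp only [smul_eq_mul, ← map_mul]
      congr 1
      refine tendsto_nhds_unique (hB x (a • y)) ?_
      simpa [inner_smul_right] using (hB x y).const_mul a)
    (fun y x x' => by
      rw [← map_add]
      congr 1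
      refine tendsto_nhds_unique (hB (x + x') y) ?_
      simpa [inner_add_left] using (hB x y).add (hB x' y))
    (fun a y x => by
      simp only [smul_eq_mul, RingHom.id_apply]
      rw [← Complex.conj_conj a, ← map_mul]
      congr 1
      rw [Complex.conj_conj a]
      refine tendsto_nhds_unique (hB (a • x) y) ?_
      simpa [inner_smul_left, mul_comm] using (hB x y).const_mul (conj a))
  let L' : H →L⋆[ℂ] H →L[ℂ] ℂ := LinearMap.mkContinuous₂ L c fun y x => by
    simpa [L, mul_comm, mul_left_comm, mul_assoc] using hbd x y
  refine ⟨InnerProductSpace.continuousLinearMapOfBilin L', fun x y => ?_⟩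
  have : inner ℂ x (InnerProductSpace.continuousLinearMapOfBilin L' y) = B x y := by
    rw [← inner_conj_symm, InnerProductSpace.continuousLinearMapOfBilin_apply]
    simp [L', L]
  rw [this]
  exact hB x y

end TraceTheory

/-! ### The spaces of continuous paths of trace class operators -/

section Paths

instance compactSpace_uIcc (a b : ℝ) : CompactSpace (Set.uIcc a b) :=
  isCompact_iff_compactSpace.1 isCompact_uIcc

instance nonempty_uIcc (a b : ℝ) : Nonempty (Set.uIcc a b) := ⟨⟨a, Set.left_mem_uIcc⟩⟩

instance fact_two_ne_top : Fact ((2 : ENNReal) ≠ ⊤) := ⟨by simp⟩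

instance separableSpace_L2 (k : ℕ) : TopologicalSpace.SeparableSpace (L2 k) := inferInstance

variable {k : ℕ} {J : ℕ → (L2 k →L[ℂ] L2 k)}

theorem tsum_geometric_succ : HasSum (fun i : ℕ => (1 / 2 : ℝ) ^ (i + 1)) 1 := by
  have := hasSum_geometric_two' 1
  convert this using 1
  ext i
  rw [pow_succ]
  simp
  ring

theorem exists_norm_opTrace_comp_sub_le (hJ : IsDenseInCompactBall J) (γ γ' : TraceClassOp k) :
    ∃ K : ℝ, 0 ≤ K ∧ ∀ i, ‖opTrace ((J i).comp (γ.op - γ'.op))‖ ≤ K := by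
  obtain ⟨K, hK0, hK⟩ := γ.isTraceClass.exists_bound
  obtain ⟨K', hK0', hK'⟩ := γ'.isTraceClass.exists_bound
  refine ⟨K + K', by positivity, fun i => ?_⟩
  rw [opTrace_comp_sub γ.isTraceClass γ'.isTraceClass]
  refine (norm_sub_le _ _).trans (add_le_add ((hK _).trans ?_) ((hK' _).trans ?_))
  · exact mul_le_of_le_one_left hK0 (hJ.1 i).2
  · exact mul_le_of_le_one_left hK0' (hJ.1 i).2

theorem summable_weakStarDist (hJ : IsDenseInCompactBall J) (γ γ' : TraceClassOp k) :
    Summable fun i : ℕ => (1 / 2 : ℝ) ^ (i + 1) * ‖opTrace ((J i).comp (γ.op - γ'.op))‖ := by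
  obtain ⟨K, -, hK⟩ := exists_norm_opTrace_comp_sub_le hJ γ γ'
  refine Summable.of_nonneg_of_le (fun i => by positivity) (fun i => ?_)
    (tsum_geometric_succ.summable.mul_right K)
  gcongr
  exact hK i

theorem weakStarDist_nonneg (γ γ' : TraceClassOp k) : 0 ≤ weakStarDist J γ γ' :=
  tsum_nonneg fun i => by positivity

theorem weakStarDist_self (γ : TraceClassOp k) : weakStarDist J γ γ = 0 := by
  simp [weakStarDist, opTrace]

theorem weakStarDist_comm (γ γ' : TraceClassOp k) :
    weakStarDist J γ γ' = weakStarDist J γ' γ := by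
  refine tsum_congr fun i => ?_
  congr 1
  rw [← neg_sub γ'.op γ.op, ContinuousLinearMap.comp_neg, opTrace_eq_tsum, opTrace_eq_tsum,
    ← norm_neg, ← tsum_neg]
  simp only [neg_apply, inner_neg_right, neg_neg]

theorem weakStarDist_triangle (hJ : IsDenseInCompactBall J) (γ₁ γ₂ γ₃ : TraceClassOp k) :
    weakStarDist J γ₁ γ₃ ≤ weakStarDist J γ₁ γ₂ + weakStarDist J γ₂ γ₃ := by
  rw [weakStarDist, weakStarDist, weakStarDist,
    ← (summable_weakStarDist hJ _ _).tsum_add (summable_weakStarDist hJ _ _)]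
  refine (summable_weakStarDist hJ _ _).tsum_le_tsum (fun i => ?_)
    ((summable_weakStarDist hJ _ _).add (summable_weakStarDist hJ _ _))
  rw [← mul_add]
  gcongr
  rw [opTrace_comp_sub γ₁.2 γ₃.2, opTrace_comp_sub γ₁.2 γ₂.2, opTrace_comp_sub γ₂.2 γ₃.2]
  exact norm_sub_le_norm_sub_add_norm_sub _ _ _

theorem norm_opTrace_comp_sub_le_weakStarDist (hJ : IsDenseInCompactBall J) (γ γ' : TraceClassOp k)
    (i : ℕ) : ‖opTrace ((J i).comp (γ.op - γ'.op))‖ ≤ 2 ^ (i + 1) * weakStarDist J γ γ' := by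
  have h := (summable_weakStarDist hJ γ γ').le_tsum i fun j _ => by positivity
  have h2 : (2 : ℝ) ^ (i + 1) * ((1 / 2 : ℝ) ^ (i + 1) * ‖opTrace ((J i).comp (γ.op - γ'.op))‖) =
      ‖opTrace ((J i).comp (γ.op - γ'.op))‖ := by
    rw [← mul_assoc, ← mul_pow]
    norm_num
  rw [← h2]
  gcongr
  exact h

/-- On nonnegative operators of bounded trace, weak operator convergence implies convergence of the
traces against compact operators. -/
theorem tendsto_opTrace_comp_sub {ι : Type*} {l : Filter ι} {c : ℝ} {γ γ' : ι → L2 k →L[ℂ] L2 k}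
    (hγ : ∀ᶠ i in l, IsPosTrace (γ i) c) (hγ' : ∀ᶠ i in l, IsPosTrace (γ' i) c)
    (h : ∀ x y, Tendsto (fun i => inner ℂ x ((γ i - γ' i) y)) l (𝓝 0))
    {A : L2 k →L[ℂ] L2 k} (hA : IsCompactOperator A) :
    Tendsto (fun i => opTrace (A.comp (γ i - γ' i))) l (𝓝 0) := by
  by_cases hl : l.NeBot
  swap
  · rw [not_neBot.1 hl]
    exact tendsto_bot
  have hc : 0 ≤ c := by
    obtain ⟨i, hi⟩ := hγ.exists
    simpa using (norm_nonneg _).trans (hi.norm_opTrace_comp_le (0 : L2 k →L[ℂ] L2 k) |>.trans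
      (by simp : _ ≤ (0 : ℝ)) |>.trans (by simpa using hi.sum_le ∅))
  rw [Metric.tendsto_nhds]
  intro ε hε
  -- Replacing `A` by the finite rank `F` costs at most `ε/4` for each of the two operators of trace
  -- at most `c`, which leaves `ε/2` for the finite rank part. The `+ 1` avoids dividing by zero.
  obtain ⟨s, F, hF, hAF⟩ := exists_finiteRank_approx hA (ε := ε / (4 * (c + 1))) (by positivity)
  have hlim : Tendsto (fun i => ∑ j : s, inner ℂ (A.adjoint (traceBasis (L2 k) j))
      ((γ i - γ' i) (traceBasis (L2 k) j))) l (𝓝 0) := by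
    have := tendsto_finsetSum (Finset.univ : Finset s) fun j _ =>
      h (A.adjoint (traceBasis (L2 k) j)) (traceBasis (L2 k) j)
    simpa using this
  filter_upwards [hγ, hγ', (Metric.tendsto_nhds.1 hlim) (ε / 2) (by positivity)] with i h1 h2 h3
  rw [dist_zero_right] at h3 ⊢
  rw [← opTrace_finiteRank_comp _ _ F _ hF] at h3
  have e : opTrace (A.comp (γ i - γ' i)) = opTrace ((A - F).comp (γ i)) -
      opTrace ((A - F).comp (γ' i)) + opTrace (F.comp (γ i - γ' i)) := by
    rw [opTrace_comp_sub h1.2 h2.2, opTrace_comp_sub h1.2 h2.2, opTrace_sub_comp h1.2,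
      opTrace_sub_comp h2.2]
    ring
  have b1 := h1.norm_opTrace_comp_le (A - F)
  have b2 := h2.norm_opTrace_comp_le (A - F)
  have b3 : ‖A - F‖ * c ≤ ε / 4 := by
    calc ‖A - F‖ * c ≤ ε / (4 * (c + 1)) * (c + 1) := by gcongr; linarith
      _ = ε / 4 := by field_simp
  rw [e]
  have t1 := norm_add_le (opTrace ((A - F).comp (γ i)) - opTrace ((A - F).comp (γ' i)))
    (opTrace (F.comp (γ i - γ' i)))
  have t2 := norm_sub_le (opTrace ((A - F).comp (γ i))) (opTrace ((A - F).comp (γ' i)))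
  linarith

/-- Dominated convergence in the series for `d_k`: each term vanishes in the limit because `Jᵢ` is
compact, and the trace bound dominates it by `2c · 2⁻⁽ⁱ⁺¹⁾`. Both arguments may vary, as the joint
limit in `isCompact_paths` requires. -/
theorem tendsto_weakStarDist (hJ : IsDenseInCompactBall J) {ι : Type*} {l : Filter ι} {c : ℝ}
    {γ γ' : ι → TraceClassOp k} (hγ : ∀ᶠ i in l, IsPosTrace (γ i).op c)
    (hγ' : ∀ᶠ i in l, IsPosTrace (γ' i).op c)
    (h : ∀ x y, Tendsto (fun i => inner ℂ x (((γ i).op - (γ' i).op) y)) l (𝓝 0)) :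
    Tendsto (fun i => weakStarDist J (γ i) (γ' i)) l (𝓝 0) := by
  have h0 : (0 : ℝ) = ∑' i : ℕ, (1 / 2 : ℝ) ^ (i + 1) * 0 := by simp
  rw [h0]
  refine tendsto_tsum_of_dominated_convergence (bound := fun i => (1 / 2 : ℝ) ^ (i + 1) * (c + c))
    (tsum_geometric_succ.summable.mul_right _) (fun i => ?_) ?_
  · have := (tendsto_opTrace_comp_sub hγ hγ' h (hJ.1 i).1).norm
    rw [norm_zero] at this
    exact this.const_mul _
  · filter_upwards [hγ, hγ'] with i h1 h2 j
    rw [norm_mul, norm_norm, Real.norm_of_nonneg (by positivity), opTrace_comp_sub h1.2 h2.2]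
    have hc : 0 ≤ c := by simpa using h1.sum_le ∅
    have b1 := (h1.norm_opTrace_comp_le (J j)).trans (mul_le_of_le_one_left hc (hJ.1 j).2)
    have b2 := (h2.norm_opTrace_comp_le (J j)).trans (mul_le_of_le_one_left hc (hJ.1 j).2)
    gcongr
    exact (norm_sub_le _ _).trans (add_le_add b1 b2)

/-- A matrix element `⟨x, T y⟩` is the trace of `T` against the rank one operator `|y⟩⟨x|`. Rescaled
into the unit ball of the compact operators, this operator is approximated in norm by some `J_j`,
whose trace is controlled by `d_k`. -/
theorem tendsto_inner_of_weakStarDist (hJ : IsDenseInCompactBall J) {ι : Type*} {l : Filter ι}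
    {c : ℝ} {γ : ι → TraceClassOp k} {γ' : TraceClassOp k}
    (hγ : ∀ᶠ i in l, IsPosTrace (γ i).op c)
    (h : Tendsto (fun i => weakStarDist J (γ i) γ') l (𝓝 0)) (x y : L2 k) :
    Tendsto (fun i => inner ℂ x ((γ i).op y)) l (𝓝 (inner ℂ x (γ'.op y))) := by
  obtain ⟨K, hK0, hK⟩ := γ'.isTraceClass.exists_bound
  obtain ⟨A, hAd⟩ : ∃ A : L2 k →L[ℂ] L2 k, A = ketBra y x := ⟨_, rfl⟩
  obtain ⟨a, haA⟩ : ∃ a : ℝ, a = ‖A‖ + 1 := ⟨_, rfl⟩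
  have ha : 0 < a := by rw [haA]; positivity
  have hA : IsCompactOperator ((a⁻¹ : ℂ) • A) := by
    rw [hAd]
    exact (isCompactOperator_ketBra y x).smul (a⁻¹ : ℂ)
  have hA1 : ‖(a⁻¹ : ℂ) • A‖ ≤ 1 := by
    rw [norm_smul, norm_inv, Complex.norm_real, Real.norm_of_nonneg ha.le, inv_mul_le_one₀ ha]
    simp [haA]
  have hAJ := hJ.2 _ hA hA1
  rw [tendsto_iff_norm_sub_tendsto_zero]
  rw [Metric.tendsto_nhds]
  intro ε hε
  by_cases hl : l.NeBot
  swap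
  · rw [not_neBot.1 hl]
    exact eventually_bot
  have hc : 0 ≤ c := by
    obtain ⟨i, hi⟩ := hγ.exists
    simpa using hi.sum_le ∅
  -- After division by `a` the target is `ε/a`. Half of it pays for replacing the rank one operator
  -- by `J_j`, with `c` and `K` bounding the traces against `γ i` and `γ'`; the other half is the
  -- `d_k` term.
  obtain ⟨_, ⟨j, rfl⟩, hj⟩ := Metric.mem_closure_iff.1 hAJ (ε / (2 * a * (c + K + 1)))
    (by positivity)
  rw [dist_eq_norm] at hj
  have hlim : Tendsto (fun i => 2 ^ (j + 1) * weakStarDist J (γ i) γ') l (𝓝 0) := by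
    simpa using h.const_mul (2 ^ (j + 1) : ℝ)
  filter_upwards [hγ, (Metric.tendsto_nhds.1 hlim) (ε / (2 * a)) (by positivity)] with i h1 h2
  rw [dist_zero_right] at h2
  rw [dist_zero_right, norm_norm]
  have h3 := (norm_opTrace_comp_sub_le_weakStarDist hJ (γ i) γ' j).trans_lt
    ((le_abs_self _).trans_lt h2)
  have e : (a⁻¹ : ℂ) * (inner ℂ x ((γ i).op y) - inner ℂ x (γ'.op y)) =
      opTrace (((a⁻¹ : ℂ) • A - J j).comp (γ i).op) - opTrace (((a⁻¹ : ℂ) • A - J j).comp γ'.op) +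
        opTrace ((J j).comp ((γ i).op - γ'.op)) := by
    have e1 : ∀ S : L2 k →L[ℂ] L2 k, opTrace (((a⁻¹ : ℂ) • A).comp S) =
        (a⁻¹ : ℂ) * inner ℂ x (S y) := fun S => by
      rw [← opTrace_ketBra_comp, opTrace_eq_tsum, opTrace_eq_tsum, ← tsum_mul_left]
      simp [hAd]
    rw [opTrace_comp_sub h1.2 γ'.2, opTrace_sub_comp h1.2, opTrace_sub_comp γ'.2, e1, e1]
    ring
  have b1 := h1.norm_opTrace_comp_le ((a⁻¹ : ℂ) • A - J j)
  have b2 := hK ((a⁻¹ : ℂ) • A - J j)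
  have b3 : ‖(a⁻¹ : ℂ) • A - J j‖ * (c + K) ≤ ε / (2 * a) := by
    calc ‖(a⁻¹ : ℂ) • A - J j‖ * (c + K) ≤ ε / (2 * a * (c + K + 1)) * (c + K + 1) := by
          exact mul_le_mul hj.le (by linarith) (by positivity) (by positivity)
      _ = ε / (2 * a) := by field_simp
  have t : ‖(a⁻¹ : ℂ) * (inner ℂ x ((γ i).op y) - inner ℂ x (γ'.op y))‖ < ε / a := by
    rw [e]
    have t1 := norm_add_le (opTrace (((a⁻¹ : ℂ) • A - J j).comp (γ i).op) -
      opTrace (((a⁻¹ : ℂ) • A - J j).comp γ'.op)) (opTrace ((J j).comp ((γ i).op - γ'.op)))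
    have t2 := norm_sub_le (opTrace (((a⁻¹ : ℂ) • A - J j).comp (γ i).op))
      (opTrace (((a⁻¹ : ℂ) • A - J j).comp γ'.op))
    have t3 : ε / (2 * a) + ε / (2 * a) = ε / a := by field_simp; ring
    linarith
  rw [norm_mul, norm_inv, Complex.norm_real, Real.norm_of_nonneg ha.le, inv_mul_lt_iff₀ ha] at t
  rwa [mul_div_cancel₀ _ ha.ne'] at t

variable {T : ℝ}

theorem abs_weakStarDist_sub_le (hJ : IsDenseInCompactBall J) (a b a' b' : TraceClassOp k) :
    |weakStarDist J a b - weakStarDist J a' b'| ≤ weakStarDist J a a' + weakStarDist J b b' := by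
  have h1 := weakStarDist_triangle hJ a a' b
  have h2 := weakStarDist_triangle hJ a' b' b
  have h3 := weakStarDist_triangle hJ a' a b'
  have h4 := weakStarDist_triangle hJ a b b'
  rw [weakStarDist_comm b' b] at h2
  rw [weakStarDist_comm a' a] at h3
  rw [abs_le]
  constructor <;> linarith

theorem continuous_weakStarDist (hJ : IsDenseInCompactBall J) (γ γ' : TraceClassPath J T) :
    Continuous fun τ => weakStarDist J (γ.toFun τ) (γ'.toFun τ) := by
  refine continuous_iff_continuousAt.2 fun τ₀ => ?_
  refine tendsto_iff_norm_sub_tendsto_zero.2 ?_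
  refine squeeze_zero (fun _ => norm_nonneg _)
    (fun τ => abs_weakStarDist_sub_le hJ _ _ _ _) ?_
  simpa using (γ.continuous τ₀).add (γ'.continuous τ₀)

theorem bddAbove_weakStarDist (hJ : IsDenseInCompactBall J) (γ γ' : TraceClassPath J T) :
    BddAbove (Set.range fun τ : Set.uIcc 0 T => weakStarDist J (γ.toFun τ) (γ'.toFun τ)) :=
  (isCompact_range (continuous_weakStarDist hJ γ γ')).bddAbove

theorem weakStarDist_le_pathDist (hJ : IsDenseInCompactBall J) (γ γ' : TraceClassPath J T)
    (τ : Set.uIcc 0 T) : weakStarDist J (γ.toFun τ) (γ'.toFun τ) ≤ pathDist γ γ' :=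
  le_ciSup (bddAbove_weakStarDist hJ γ γ') τ

/-- The pseudometric `d̂_k`. -/
abbrev pathPseudoMetric (hJ : IsDenseInCompactBall J) :
    PseudoMetricSpace (TraceClassPath J T) where
  dist := pathDist
  dist_self γ := by simp [pathDist, weakStarDist_self]
  dist_comm γ γ' := by simp_rw [pathDist, weakStarDist_comm]
  dist_triangle γ₁ γ₂ γ₃ := ciSup_le fun τ =>
    (weakStarDist_triangle hJ _ (γ₂.toFun τ) _).trans
      (add_le_add (weakStarDist_le_pathDist hJ _ _ τ) (weakStarDist_le_pathDist hJ _ _ τ))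

theorem topology_eq_pathPseudoMetric (hJ : IsDenseInCompactBall J) :
    (inferInstance : TopologicalSpace (TraceClassPath J T)) =
      (pathPseudoMetric hJ).toUniformSpace.toTopologicalSpace := by
  let m : PseudoMetricSpace (TraceClassPath J T) := pathPseudoMetric hJ
  refine (@TopologicalSpace.IsTopologicalBasis.eq_generateFrom _
    m.toUniformSpace.toTopologicalSpace _
    (@TopologicalSpace.isTopologicalBasis_of_isOpen_of_nhds _
      m.toUniformSpace.toTopologicalSpace _ ?_ ?_)).symm
  · rintro _ ⟨γ, r, rfl⟩
    exact Metric.isOpen_ball (x := γ) (ε := r)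
  · intro γ s hγ hs
    obtain ⟨r, hr, h⟩ := Metric.isOpen_iff.1 hs γ hγ
    exact ⟨_, ⟨γ, r, rfl⟩, Metric.mem_ball_self hr, h⟩

theorem tendsto_path_iff (hJ : IsDenseInCompactBall J) {ι : Type*} {l : Filter ι}
    {γ : ι → TraceClassPath J T} {γ' : TraceClassPath J T} :
    Tendsto γ l (𝓝 γ') ↔ Tendsto (fun i => pathDist (γ i) γ') l (𝓝 0) := by
  let m : PseudoMetricSpace (TraceClassPath J T) :=
    (pathPseudoMetric hJ).replaceTopology (topology_eq_pathPseudoMetric hJ)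
  exact tendsto_iff_dist_tendsto_zero

/-- R1 separation is enough for subsets of compact sets to have compact closure, so it need not be
shown that `d̂_k` separates points. -/
theorem r1Space_path (hJ : IsDenseInCompactBall J) : R1Space (TraceClassPath J T) := by
  let m : PseudoMetricSpace (TraceClassPath J T) :=
    (pathPseudoMetric hJ).replaceTopology (topology_eq_pathPseudoMetric hJ)
  infer_instance

/-- Equicontinuous families of nonnegative operators of bounded trace are compact. -/
theorem isCompact_paths (hJ : IsDenseInCompactBall J) (c : ℝ)
    (ρ : L2 k → L2 k → Set.uIcc 0 T → Set.uIcc 0 T → ℝ)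
    (hρ : ∀ f g τ₀, Tendsto (fun τ => ρ f g τ τ₀) (𝓝 τ₀) (𝓝 0)) :
    IsCompact {γ : TraceClassPath J T | (∀ τ, IsPosTrace (γ.toFun τ).op c) ∧
      ∀ f g τ τ₀, ‖inner ℂ f (((γ.toFun τ).op - (γ.toFun τ₀).op) g)‖ ≤ ρ f g τ τ₀} := by
  set K := {γ : TraceClassPath J T | (∀ τ, IsPosTrace (γ.toFun τ).op c) ∧
      ∀ f g τ τ₀, ‖inner ℂ f (((γ.toFun τ).op - (γ.toFun τ₀).op) g)‖ ≤ ρ f g τ τ₀}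
  refine isCompact_iff_ultrafilter_le_nhds.2 fun l hl => ?_
  have hK : ∀ᶠ γ in (l : Filter _), γ ∈ K := le_principal_iff.1 hl
  have hlim : ∀ τ, ∃ S : L2 k →L[ℂ] L2 k, ∀ x y,
      Tendsto (fun γ : TraceClassPath J T => inner ℂ x ((γ.toFun τ).op y)) l
        (𝓝 (inner ℂ x (S y))) := fun τ =>
    exists_weak_limit l (T := fun γ : TraceClassPath J T => (γ.toFun τ).op) (c := c)
      (hK.mono fun γ hγ => (hγ.1 τ).norm_inner_le)
  choose S hS using hlim
  have hSpos : ∀ τ, IsPosTrace (S τ) c := fun τ =>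
    isPosTrace_of_tendsto (hK.mono fun γ hγ => hγ.1 τ) (hS τ)
  have hSρ : ∀ f g τ τ₀, ‖inner ℂ f ((S τ - S τ₀) g)‖ ≤ ρ f g τ τ₀ := fun f g τ τ₀ => by
    have := ((hS τ f g).sub (hS τ₀ f g)).norm
    simp only [sub_apply, inner_sub_right]
    refine le_of_tendsto this (hK.mono fun γ hγ => ?_)
    simpa only [sub_apply, inner_sub_right] using hγ.2 f g τ τ₀
  let γ' : TraceClassPath J T :=
    { toFun := fun τ => ⟨S τ, (hSpos τ).isTraceClass⟩
      continuous := fun τ₀ => by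
        refine tendsto_weakStarDist hJ (Eventually.of_forall fun τ => hSpos τ)
          (Eventually.of_forall fun _ => hSpos τ₀) fun x y => ?_
        exact squeeze_zero_norm (fun τ => hSρ x y τ τ₀) (hρ x y τ₀) }
  refine ⟨γ', ⟨hSpos, hSρ⟩, ?_⟩
  refine (tendsto_path_iff hJ (γ := id)).2 ?_
  -- Near `τ₀`, the difference at `τ` is the increment of the path from `τ₀`, plus the difference at
  -- `τ₀`, minus the increment of the limit. Both increments are bounded by `ρ` uniformly over the
  -- family; compactness of the interval then turns local into global uniformity.
  have hu : TendstoLocallyUniformly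
      (fun (γ : TraceClassPath J T) τ => weakStarDist J (γ.toFun τ) (γ'.toFun τ))
      (fun _ => 0) l := by
    refine tendstoLocallyUniformly_iff_forall_tendsto.2 fun τ₀ => ?_
    have hpos : ∀ᶠ p : TraceClassPath J T × Set.uIcc 0 T in (l : Filter _) ×ˢ 𝓝 τ₀, p.1 ∈ K :=
      hK.prod_inl _
    have key : Tendsto (fun p : TraceClassPath J T × Set.uIcc 0 T =>
        weakStarDist J (p.1.toFun p.2) (γ'.toFun p.2)) (l ×ˢ 𝓝 τ₀) (𝓝 0) := by
      refine tendsto_weakStarDist hJ (hpos.mono fun p hp => hp.1 p.2)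
        (Eventually.of_forall fun p => hSpos p.2) fun x y => ?_
      have h1 : Tendsto (fun p : TraceClassPath J T × Set.uIcc 0 T =>
          inner ℂ x (((p.1.toFun p.2).op - (p.1.toFun τ₀).op) y)) (l ×ˢ 𝓝 τ₀) (𝓝 0) :=
        squeeze_zero_norm' (hpos.mono fun p hp => hp.2 x y p.2 τ₀)
          ((hρ x y τ₀).comp tendsto_snd)
      have h2 : Tendsto (fun p : TraceClassPath J T × Set.uIcc 0 T =>
          inner ℂ x ((p.1.toFun τ₀).op y) - inner ℂ x (S τ₀ y)) (l ×ˢ 𝓝 τ₀) (𝓝 0) := by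
        have h := (hS τ₀ x y).sub_const (inner ℂ x (S τ₀ y))
        rw [sub_self] at h
        exact h.comp tendsto_fst
      have h3 : Tendsto (fun p : TraceClassPath J T × Set.uIcc 0 T =>
          inner ℂ x ((S p.2 - S τ₀) y)) (l ×ˢ 𝓝 τ₀) (𝓝 0) :=
        squeeze_zero_norm (fun p => hSρ x y p.2 τ₀) ((hρ x y τ₀).comp tendsto_snd)
      have h4 := (h1.add h2).sub h3
      simp only [add_zero, sub_zero] at h4
      refine h4.congr fun p => ?_
      simp only [sub_apply, inner_sub_right, γ']
      ring
    refine tendsto_uniformity_iff_dist_tendsto_zero.2 ?_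
    simp only [dist_zero_left]
    simpa using key.norm
  have hu' := tendstoLocallyUniformly_iff_tendstoUniformly_of_compactSpace.1 hu
  rw [Metric.tendsto_nhds]
  intro ε hε
  filter_upwards [(Metric.tendstoUniformly_iff.1 hu') (ε / 2) (by positivity)] with γ hγ
  have h0 : 0 ≤ pathDist γ γ' := Real.iSup_nonneg fun τ => weakStarDist_nonneg _ _
  rw [dist_zero_right, id, Real.norm_of_nonneg h0]
  refine lt_of_le_of_lt (ciSup_le fun τ => ?_) (half_lt_self hε)
  have := hγ τ
  rw [dist_zero_left] at this
  exact (le_abs_self _).trans this.le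

end Paths

/-! ### Partial pairings and density operators -/

section Pairing

open scoped ENNReal

variable {α β : Type*} [MeasurableSpace α] [MeasurableSpace β] {μ : Measure α} {ν : Measure β}

theorem memLp_two_of_lintegral {E : Type*} [NormedAddCommGroup E] {f : α → E}
    (hf : AEStronglyMeasurable f μ) (h : ∫⁻ x, ‖f x‖ₑ ^ 2 ∂μ ≠ ∞) : MemLp f 2 μ := by
  refine ⟨hf, ?_⟩
  rw [eLpNorm_lt_top_iff_lintegral_rpow_enorm_lt_top (by simp) (by simp)]
  simpa using h.lt_top

theorem eLpNorm_two_sq {E : Type*} [NormedAddCommGroup E] (f : α → E) :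
    eLpNorm f 2 μ ^ 2 = ∫⁻ x, ‖f x‖ₑ ^ 2 ∂μ := by
  rw [eLpNorm_eq_lintegral_rpow_enorm_toReal (by simp) (by simp)]
  simp only [ENNReal.toReal_ofNat, ENNReal.rpow_ofNat, one_div]
  rw [← ENNReal.rpow_natCast, ← ENNReal.rpow_mul]
  simp

theorem enorm_sq_eq_lintegral {E : Type*} [NormedAddCommGroup E] (f : Lp E 2 μ) :
    ‖f‖ₑ ^ 2 = ∫⁻ x, ‖f x‖ₑ ^ 2 ∂μ := by
  rw [Lp.enorm_def, eLpNorm_two_sq]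

theorem MemLp.lintegral_sq_ne_top {E : Type*} [NormedAddCommGroup E] {f : α → E}
    (hf : MemLp f 2 μ) : ∫⁻ x, ‖f x‖ₑ ^ 2 ∂μ ≠ ∞ := by
  rw [← eLpNorm_two_sq]
  exact ENNReal.pow_ne_top hf.2.ne

theorem lintegral_mul_sq_le {f g : α → ℝ≥0∞} (hf : AEMeasurable f μ) (hg : AEMeasurable g μ) :
    (∫⁻ x, f x * g x ∂μ) ^ 2 ≤ (∫⁻ x, f x ^ 2 ∂μ) * ∫⁻ x, g x ^ 2 ∂μ := by
  have h := ENNReal.lintegral_mul_le_Lp_mul_Lq μ Real.HolderConjugate.two_two hf hg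
  simp only [Pi.mul_apply, ENNReal.rpow_ofNat] at h
  calc _ ≤ ((∫⁻ x, f x ^ 2 ∂μ) ^ (1 / 2 : ℝ) * (∫⁻ x, g x ^ 2 ∂μ) ^ (1 / 2 : ℝ)) ^ 2 := by
        gcongr
    _ = _ := by
        rw [mul_pow, ← ENNReal.rpow_natCast, ← ENNReal.rpow_natCast, ← ENNReal.rpow_mul,
          ← ENNReal.rpow_mul]
        simp

/-- `z ↦ ∫ f(x) Ψ(x, z) dx`. -/
def pairFun (μ : Measure α) (f : α → ℂ) (Ψ : α × β → ℂ) (z : β) : ℂ := ∫ x, f x * Ψ (x, z) ∂μ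

variable [SFinite μ] [SFinite ν]

theorem ae_memLp_slice {Ψ : α × β → ℂ} (hΨ : MemLp Ψ 2 (μ.prod ν)) :
    ∀ᵐ z ∂ν, MemLp (fun x => Ψ (x, z)) 2 μ := by
  have h1 : ∀ᵐ z ∂ν, AEStronglyMeasurable (fun x => Ψ (x, z)) μ :=
    (hΨ.1.prod_swap).prodMk_left
  have h2 : ∫⁻ z, ∫⁻ x, ‖Ψ (x, z)‖ₑ ^ 2 ∂μ ∂ν ≠ ∞ := by
    rw [← lintegral_prod_symm _ (hΨ.1.enorm.pow_const 2)]
    exact MemLp.lintegral_sq_ne_top hΨ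
  have h3 := ae_lt_top' (AEMeasurable.lintegral_prod_left' (hΨ.1.enorm.pow_const 2)) h2
  filter_upwards [h1, h3] with z hz1 hz2
  exact memLp_two_of_lintegral hz1 hz2.ne

theorem ae_memLp_slice_right {Ψ : α × β → ℂ} (hΨ : MemLp Ψ 2 (μ.prod ν)) :
    ∀ᵐ x ∂μ, MemLp (fun z => Ψ (x, z)) 2 ν :=
  ae_memLp_slice (Ψ := fun p : β × α => Ψ p.swap)
    (hΨ.comp_measurePreserving Measure.measurePreserving_swap)

theorem aestronglyMeasurable_pairFun {f : α → ℂ} {Ψ : α × β → ℂ} (hf : AEStronglyMeasurable f μ)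
    (hΨ : AEStronglyMeasurable Ψ (μ.prod ν)) : AEStronglyMeasurable (pairFun μ f Ψ) ν :=
  ((hf.comp_fst (ν := ν)).mul hΨ).prod_swap.integral_prod_right'

/-- Cauchy–Schwarz in `x` for fixed `z`, then Tonelli. -/
theorem lintegral_pairFun_sq_le {f : α → ℂ} {Ψ : α × β → ℂ} (hf : AEStronglyMeasurable f μ)
    (hΨ : AEStronglyMeasurable Ψ (μ.prod ν)) :
    ∫⁻ z, ‖pairFun μ f Ψ z‖ₑ ^ 2 ∂ν ≤
      (∫⁻ x, ‖f x‖ₑ ^ 2 ∂μ) * ∫⁻ p, ‖Ψ p‖ₑ ^ 2 ∂(μ.prod ν) := by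
  have h1 : ∀ᵐ z ∂ν, AEStronglyMeasurable (fun x => Ψ (x, z)) μ := hΨ.prod_swap.prodMk_left
  calc ∫⁻ z, ‖pairFun μ f Ψ z‖ₑ ^ 2 ∂ν
      ≤ ∫⁻ z, (∫⁻ x, ‖f x‖ₑ ^ 2 ∂μ) * (∫⁻ x, ‖Ψ (x, z)‖ₑ ^ 2 ∂μ) ∂ν := by
        refine lintegral_mono_ae (h1.mono fun z hz => ?_)
        refine le_trans ?_ (lintegral_mul_sq_le hf.enorm hz.enorm)
        gcongr
        refine (enorm_integral_le_lintegral_enorm _).trans (le_of_eq ?_)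
        simp_rw [enorm_mul]
    _ = _ := by
        rw [lintegral_const_mul'' _ (AEMeasurable.lintegral_prod_left' (hΨ.enorm.pow_const 2)),
          lintegral_prod_symm _ (hΨ.enorm.pow_const 2)]

theorem memLp_pairFun {f : α → ℂ} {Ψ : α × β → ℂ} (hf : MemLp f 2 μ) (hΨ : MemLp Ψ 2 (μ.prod ν)) :
    MemLp (pairFun μ f Ψ) 2 ν := by
  refine memLp_two_of_lintegral (aestronglyMeasurable_pairFun hf.1 hΨ.1) (ne_top_of_le_ne_top ?_
    (lintegral_pairFun_sq_le hf.1 hΨ.1))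
  exact ENNReal.mul_ne_top (MemLp.lintegral_sq_ne_top hf) (MemLp.lintegral_sq_ne_top hΨ)

theorem ae_integrable_pair {f : α → ℂ} {Ψ : α × β → ℂ} (hf : MemLp f 2 μ)
    (hΨ : MemLp Ψ 2 (μ.prod ν)) : ∀ᵐ z ∂ν, Integrable (fun x => f x * Ψ (x, z)) μ :=
  (ae_memLp_slice hΨ).mono fun _ hz => hf.integrable_mul hz

theorem pairFun_congr_ae {f f' : α → ℂ} {Ψ Ψ' : α × β → ℂ} (hf : f =ᵐ[μ] f')
    (hΨ : Ψ =ᵐ[μ.prod ν] Ψ') : pairFun μ f Ψ =ᵐ[ν] pairFun μ f' Ψ' := by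
  have h : ∀ᵐ z ∂ν, ∀ᵐ x ∂μ, Ψ (x, z) = Ψ' (x, z) :=
    Measure.ae_ae_of_ae_prod (Measure.measurePreserving_swap (μ := ν) (ν := μ)
      |>.quasiMeasurePreserving.ae hΨ)
  filter_upwards [h] with z hz
  refine integral_congr_ae ?_
  filter_upwards [hz, hf] with x h1 h2
  rw [h1, h2]

/-- The bilinear pairing `L²(α) × L²(α × β) → L²(β)`. -/
def pairing (μ : Measure α) (ν : Measure β) [SFinite μ] [SFinite ν] :
    Lp ℂ 2 μ →L[ℂ] Lp ℂ 2 (μ.prod ν) →L[ℂ] Lp ℂ 2 ν :=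
  LinearMap.mkContinuous₂
    (LinearMap.mk₂ ℂ (fun f Ψ => (memLp_pairFun (Lp.memLp f) (Lp.memLp Ψ)).toLp _)
      (fun f f' Ψ => by
        rw [← MemLp.toLp_add, MemLp.toLp_eq_toLp_iff]
        refine (pairFun_congr_ae (Lp.coeFn_add f f') (ae_eq_refl _)).trans ?_
        filter_upwards [ae_integrable_pair (Lp.memLp f) (Lp.memLp Ψ),
          ae_integrable_pair (Lp.memLp f') (Lp.memLp Ψ)] with z h1 h2
        simp only [pairFun, Pi.add_apply, add_mul]
        exact integral_add h1 h2)
      (fun c f Ψ => by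
        rw [← MemLp.toLp_const_smul, MemLp.toLp_eq_toLp_iff]
        refine (pairFun_congr_ae (Lp.coeFn_smul c f) (ae_eq_refl _)).trans ?_
        refine Eventually.of_forall fun z => ?_
        simp only [pairFun, Pi.smul_apply, smul_eq_mul, mul_assoc]
        exact integral_const_mul _ _)
      (fun f Ψ Ψ' => by
        rw [← MemLp.toLp_add, MemLp.toLp_eq_toLp_iff]
        refine (pairFun_congr_ae (ae_eq_refl _) (Lp.coeFn_add Ψ Ψ')).trans ?_
        filter_upwards [ae_integrable_pair (Lp.memLp f) (Lp.memLp Ψ),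
          ae_integrable_pair (Lp.memLp f) (Lp.memLp Ψ')] with z h1 h2
        simp only [pairFun, Pi.add_apply, mul_add]
        exact integral_add h1 h2)
      (fun c f Ψ => by
        rw [← MemLp.toLp_const_smul, MemLp.toLp_eq_toLp_iff]
        refine (pairFun_congr_ae (ae_eq_refl _) (Lp.coeFn_smul c Ψ)).trans ?_
        refine Eventually.of_forall fun z => ?_
        simp only [pairFun, Pi.smul_apply, smul_eq_mul, mul_left_comm _ c]
        exact integral_const_mul _ _)) 1
    (fun f Ψ => by
      have h : ‖(memLp_pairFun (Lp.memLp f) (Lp.memLp Ψ)).toLp _‖ₑ ^ 2 ≤ (‖f‖ₑ * ‖Ψ‖ₑ) ^ 2 := by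
        rw [mul_pow, enorm_sq_eq_lintegral, enorm_sq_eq_lintegral f, enorm_sq_eq_lintegral Ψ]
        refine le_trans (le_of_eq (lintegral_congr_ae ?_))
          (lintegral_pairFun_sq_le (Lp.memLp f).1 (Lp.memLp Ψ).1)
        filter_upwards [(memLp_pairFun (Lp.memLp f) (Lp.memLp Ψ)).coeFn_toLp] with z hz
        rw [hz]
      have h2 := (ENNReal.pow_le_pow_left_iff two_ne_zero).1 h
      have h3 := ENNReal.toReal_mono (by finiteness) h2
      simpa using h3)

theorem coeFn_pairing (f : Lp ℂ 2 μ) (Ψ : Lp ℂ 2 (μ.prod ν)) :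
    pairing μ ν f Ψ =ᵐ[ν] pairFun μ f Ψ :=
  (memLp_pairFun (Lp.memLp f) (Lp.memLp Ψ)).coeFn_toLp

theorem norm_pairing_le (f : Lp ℂ 2 μ) (Ψ : Lp ℂ 2 (μ.prod ν)) :
    ‖pairing μ ν f Ψ‖ ≤ ‖f‖ * ‖Ψ‖ := by
  refine ((pairing μ ν).le_opNorm₂ f Ψ).trans ?_
  have h : ‖pairing μ ν‖ ≤ 1 := LinearMap.mkContinuous₂_norm_le _ zero_le_one _
  calc ‖pairing μ ν‖ * ‖f‖ * ‖Ψ‖ ≤ 1 * ‖f‖ * ‖Ψ‖ := by gcongr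
    _ = ‖f‖ * ‖Ψ‖ := by rw [one_mul]

theorem memLp_mul_prod {f : α → ℂ} {g : β → ℂ} (hf : MemLp f 2 μ) (hg : MemLp g 2 ν) :
    MemLp (fun p : α × β => f p.1 * g p.2) 2 (μ.prod ν) := by
  refine memLp_two_of_lintegral (hf.1.comp_fst.mul hg.1.comp_snd) ?_
  simp only [enorm_mul, mul_pow]
  rw [lintegral_prod_mul (f := fun x => ‖f x‖ₑ ^ 2) (g := fun x => ‖g x‖ₑ ^ 2)
    (hf.1.enorm.pow_const 2) (hg.1.enorm.pow_const 2)]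
  exact ENNReal.mul_ne_top (MemLp.lintegral_sq_ne_top hf) (MemLp.lintegral_sq_ne_top hg)

theorem memLp_conj {f : α → ℂ} (hf : MemLp f 2 μ) : MemLp (fun x => conj (f x)) 2 μ :=
  hf.star

theorem inner_star_star (f g : Lp ℂ 2 μ) : inner ℂ (star f) (star g) = inner ℂ g f := by
  rw [L2.inner_def, L2.inner_def]
  refine integral_congr_ae ?_
  filter_upwards [Lp.coeFn_star f, Lp.coeFn_star g] with x h1 h2
  rw [h1, h2]
  simp [mul_comm]

theorem star_pairing (f : Lp ℂ 2 μ) (Ψ : Lp ℂ 2 (μ.prod ν)) :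
    star (pairing μ ν f Ψ) = pairing μ ν (star f) (star Ψ) := by
  refine Lp.ext ?_
  refine (Lp.coeFn_star _).trans ?_
  refine EventuallyEq.trans ?_ ((coeFn_pairing _ _).trans
    (pairFun_congr_ae (Lp.coeFn_star f) (Lp.coeFn_star Ψ))).symm
  filter_upwards [coeFn_pairing f Ψ] with z hz
  simp only [Pi.star_apply, hz, pairFun, RCLike.star_def, ← map_mul]
  exact integral_conj.symm

/-- The operator `f ↦ ∫ f(x) conj Ψ(x, ·) dx`. -/
def halfDensity (Ψ : Lp ℂ 2 (μ.prod ν)) : Lp ℂ 2 μ →L[ℂ] Lp ℂ 2 ν :=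
  (pairing μ ν).flip (star Ψ)

/-- The operator with kernel `∫ Ψ(x, z) conj Ψ(x', z) dz`. -/
def densityOp (Ψ : Lp ℂ 2 (μ.prod ν)) : Lp ℂ 2 μ →L[ℂ] Lp ℂ 2 μ :=
  (halfDensity Ψ).adjoint.comp (halfDensity Ψ)

/-- Conjugations are moved onto the test functions because `halfDensity` is antilinear in `Ψ`,
whereas `pairing` is linear. In this form the matrix element can be differentiated along the
evolution. -/
theorem inner_densityOp (Ψ : Lp ℂ 2 (μ.prod ν)) (f g : Lp ℂ 2 μ) :
    inner ℂ g (densityOp Ψ f) =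
      inner ℂ (pairing μ ν (star f) Ψ) (pairing μ ν (star g) Ψ) := by
  rw [densityOp, ContinuousLinearMap.comp_apply, ContinuousLinearMap.adjoint_inner_right,
    ← inner_star_star]
  simp only [halfDensity, ContinuousLinearMap.flip_apply, star_pairing, star_star]

theorem coeFn_halfDensity (Ψ : Lp ℂ 2 (μ.prod ν)) (f : Lp ℂ 2 μ) :
    halfDensity Ψ f =ᵐ[ν] fun z => ∫ x, f x * conj (Ψ (x, z)) ∂μ :=
  (coeFn_pairing f (star Ψ)).trans (pairFun_congr_ae (ae_eq_refl _) (Lp.coeFn_star Ψ))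

theorem coeFn_halfDensity_adjoint (Ψ : Lp ℂ 2 (μ.prod ν)) (χ : Lp ℂ 2 ν) :
    (halfDensity Ψ).adjoint χ =ᵐ[μ] fun x => ∫ z, Ψ (x, z) * χ z ∂ν := by
  have hΨ' : MemLp (fun p : β × α => Ψ p.swap) 2 (ν.prod μ) :=
    (Lp.memLp Ψ).comp_measurePreserving Measure.measurePreserving_swap
  have hm := memLp_pairFun (Lp.memLp χ) hΨ'
  have e : (halfDensity Ψ).adjoint χ = hm.toLp _ := by
    refine ext_inner_left ℂ fun f => ?_
    rw [ContinuousLinearMap.adjoint_inner_right, L2.inner_def, L2.inner_def]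
    have hint : Integrable (fun p : α × β => (conj (f p.1) * χ p.2) * Ψ p) (μ.prod ν) :=
      (memLp_mul_prod (memLp_conj (Lp.memLp f)) (Lp.memLp χ)).integrable_mul (Lp.memLp Ψ)
    have h1 := integral_prod _ hint
    rw [integral_prod_symm _ hint] at h1
    refine Eq.trans (Eq.trans (integral_congr_ae ?_) h1) (integral_congr_ae ?_)
    · filter_upwards [coeFn_halfDensity Ψ f] with z hz
      rw [hz, RCLike.inner_apply, ← integral_conj, ← integral_const_mul]
      refine integral_congr_ae (Eventually.of_forall fun x => ?_)
      simp
      ring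
    · filter_upwards [hm.coeFn_toLp] with x hx
      rw [hx, RCLike.inner_apply, pairFun, ← integral_mul_const]
      refine integral_congr_ae (Eventually.of_forall fun x => ?_)
      simp
      ring
  rw [e]
  refine hm.coeFn_toLp.trans (Eventually.of_forall fun x => ?_)
  simp only [pairFun, Prod.swap_prod_mk, mul_comm]

/-- `densityOp Ψ` is the integral operator with kernel `∫ Ψ(x, z) conj Ψ(x', z) dz`. -/
theorem coeFn_densityOp (Ψ : Lp ℂ 2 (μ.prod ν)) (f : Lp ℂ 2 μ) :
    densityOp Ψ f =ᵐ[μ] fun x => ∫ x', (∫ z, Ψ (x, z) * conj (Ψ (x', z)) ∂ν) * f x' ∂μ := by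
  refine (coeFn_halfDensity_adjoint Ψ (halfDensity Ψ f)).trans ?_
  filter_upwards [ae_memLp_slice_right (Lp.memLp Ψ)] with x hx
  have hint : Integrable (fun p : α × β => (f p.1 * Ψ (x, p.2)) * conj (Ψ p)) (μ.prod ν) :=
    (memLp_mul_prod (Lp.memLp f) hx).integrable_mul (memLp_conj (Lp.memLp Ψ))
  have h1 := integral_prod _ hint
  rw [integral_prod_symm _ hint] at h1
  refine Eq.trans (Eq.trans (integral_congr_ae ?_) h1) (integral_congr_ae ?_)
  · filter_upwards [coeFn_halfDensity Ψ f] with z hz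
    rw [hz, ← integral_const_mul]
    refine integral_congr_ae (Eventually.of_forall fun x => ?_)
    simp
    ring
  · refine Eventually.of_forall fun x' => ?_
    simp only
    rw [← integral_mul_const]
    refine integral_congr_ae (Eventually.of_forall fun x => ?_)
    simp
    ring

/-- The Hilbert–Schmidt norm of `halfDensity Ψ` is the norm of `Ψ`. -/
theorem tsum_enorm_halfDensity_sq [TopologicalSpace.SeparableSpace (Lp ℂ 2 μ)] {ι : Type*}
    (b : HilbertBasis ι ℂ (Lp ℂ 2 μ)) (Ψ : Lp ℂ 2 (μ.prod ν)) :
    ∑' i, ‖halfDensity Ψ (b i)‖ₑ ^ 2 = ‖Ψ‖ₑ ^ 2 := by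
  have := HilbertBasis.countable_index b
  simp_rw [enorm_sq_eq_lintegral (halfDensity Ψ _)]
  rw [← lintegral_tsum fun i => (Lp.memLp _).1.enorm.pow_const 2, enorm_sq_eq_lintegral,
    lintegral_prod_symm _ ((Lp.memLp Ψ).1.enorm.pow_const 2)]
  -- For almost every `z` the numbers `halfDensity Ψ (b i) z` are, up to conjugation, the
  -- coefficients of the slice `Ψ(·, z)`, so Parseval applies slice by slice. Countability of the
  -- basis makes the exceptional set null for all `i` at once.
  refine lintegral_congr_ae ?_
  filter_upwards [ae_memLp_slice (Lp.memLp Ψ), ae_all_iff.2 fun i => coeFn_halfDensity Ψ (b i)]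
    with z h1 h2
  have h3 := tsum_enorm_inner_sq b (h1.toLp _)
  rw [enorm_sq_eq_lintegral] at h3
  refine Eq.trans (tsum_congr fun i => ?_) (h3.trans (lintegral_congr_ae ?_))
  · rw [h2, ← RCLike.enorm_conj, ← integral_conj, L2.inner_def]
    congr 2
    refine integral_congr_ae ?_
    filter_upwards [h1.coeFn_toLp] with x hx
    rw [hx, RCLike.inner_apply]
    simp [mul_comm]
  · filter_upwards [h1.coeFn_toLp] with x hx
    rw [hx]

theorem isPosTrace_densityOp [TopologicalSpace.SeparableSpace (Lp ℂ 2 μ)]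
    [TopologicalSpace.SeparableSpace (Lp ℂ 2 ν)] (Ψ : Lp ℂ 2 (μ.prod ν)) :
    IsPosTrace (densityOp Ψ) (‖Ψ‖ ^ 2) := by
  have h := tsum_enorm_halfDensity_sq (traceBasis (Lp ℂ 2 μ)) Ψ
  have ht : IsTraceClass (densityOp Ψ) :=
    isTraceClass_adjoint_comp (traceBasis _) (by rw [h]; finiteness)
  refine ⟨ContinuousLinearMap.isPositive_adjoint_comp_self _, ht, ?_⟩
  rw [tsum_enorm_sq_eq_trace _ ht] at h
  by_contra! hc
  have h2 : ENNReal.ofReal (‖Ψ‖ ^ 2) < ENNReal.ofReal (opTrace (densityOp Ψ)).re :=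
    (ENNReal.ofReal_lt_ofReal_iff ((sq_nonneg _).trans_lt hc)).2 hc
  rw [ENNReal.ofReal_pow (norm_nonneg _), ofReal_norm] at h2
  exact h2.ne' h

end Pairing

/-! ### Joining coordinates -/

section Join

variable {N k : ℕ}

/-- The index equivalence behind `join`. -/
def joinIndex (h : k ≤ N) : Fin k ⊕ Fin (N - k) ≃ Fin N :=
  finSumFinEquiv.trans (finCongr (by omega))

/-- `join` as an equivalence. -/
def joinEquiv (h : k ≤ N) : Conf k × Conf (N - k) ≃ᵐ Conf N :=
  ((MeasurableEquiv.toLp 2 (Fin k → ℝ)).symm.prodCongr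
    (MeasurableEquiv.toLp 2 (Fin (N - k) → ℝ)).symm).trans
  ((MeasurableEquiv.sumPiEquivProdPi fun _ : Fin k ⊕ Fin (N - k) => ℝ).symm.trans
    ((MeasurableEquiv.piCongrLeft (fun _ : Fin N => ℝ) (joinIndex h)).trans
      (MeasurableEquiv.toLp 2 (Fin N → ℝ))))

theorem join_inl (h : k ≤ N) (x : Conf k) (z : Conf (N - k)) (i : Fin k) :
    (join x z : Conf N) (joinIndex h (Sum.inl i)) = x i := by
  simp [join, joinIndex]

theorem join_inr (h : k ≤ N) (x : Conf k) (z : Conf (N - k)) (i : Fin (N - k)) :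
    (join x z : Conf N) (joinIndex h (Sum.inr i)) = z i := by
  simp [join, joinIndex]

theorem joinEquiv_apply (h : k ≤ N) (p : Conf k × Conf (N - k)) :
    joinEquiv h p = join p.1 p.2 := by
  ext i
  obtain ⟨j, rfl⟩ := (joinIndex h).surjective i
  have : (joinEquiv h p) (joinIndex h j) =
      (Equiv.sumPiEquivProdPi fun _ : Fin k ⊕ Fin (N - k) => ℝ).symm
        (WithLp.ofLp p.1, WithLp.ofLp p.2) j :=
    Equiv.piCongrLeft_apply_apply (fun _ : Fin N => ℝ) (joinIndex h) _ j
  rw [this]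
  rcases j with i | i
  · rw [join_inl]; rfl
  · rw [join_inr]; rfl

theorem measurePreserving_joinEquiv (h : k ≤ N) :
    MeasurePreserving (joinEquiv h) (volume.prod volume) volume := by
  refine MeasurePreserving.trans ?_ (MeasurePreserving.trans
    (volume_measurePreserving_sumPiEquivProdPi_symm _) (MeasurePreserving.trans
      (volume_measurePreserving_piCongrLeft _ _)
      (EuclideanSpace.volume_preserving_symm_measurableEquiv_toLp (Fin N)).symm))
  exact (PiLp.volume_preserving_ofLp (Fin k)).prod (PiLp.volume_preserving_ofLp (Fin (N - k)))

/-- A function on `ℝᴺ` as a function on `ℝᵏ × ℝᴺ⁻ᵏ`. -/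
def splitL (h : k ≤ N) :
    L2 N →ₗᵢ[ℂ] Lp ℂ 2 ((volume : Measure (Conf k)).prod (volume : Measure (Conf (N - k)))) :=
  Lp.compMeasurePreservingₗᵢ ℂ (joinEquiv h) (measurePreserving_joinEquiv h)

theorem coeFn_splitL (h : k ≤ N) (ψ : L2 N) :
    splitL h ψ =ᵐ[(volume : Measure (Conf k)).prod (volume : Measure (Conf (N - k)))]
      fun p => ψ (join p.1 p.2) := by
  refine (Lp.coeFn_compMeasurePreserving ψ (measurePreserving_joinEquiv h)).trans ?_
  exact Eventually.of_forall fun p => by simp only [Function.comp_apply, joinEquiv_apply]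

theorem lintegral_join (h : k ≤ N) (F : Conf N → ENNReal) :
    ∫⁻ p, F (join p.1 p.2) ∂((volume : Measure (Conf k)).prod
      (volume : Measure (Conf (N - k)))) = ∫⁻ x, F x := by
  rw [← (measurePreserving_joinEquiv h).lintegral_comp_emb (joinEquiv h).measurableEmbedding]
  simp only [joinEquiv_apply]

/-- The `k`-particle marginal density operator. -/
def marginalOp (h : k ≤ N) (ψ : L2 N) : L2 k →L[ℂ] L2 k := densityOp (splitL h ψ)

theorem hasKernel_marginalOp (h : k ≤ N) (ψ : L2 N) :
    HasKernel (marginalOp h ψ) (marginalKernel ψ k) := by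
  intro f
  have hs : ∀ᵐ x : Conf k, ∀ᵐ z : Conf (N - k), splitL h ψ (x, z) = ψ (join x z) :=
    Measure.ae_ae_of_ae_prod (coeFn_splitL h ψ)
  filter_upwards [coeFn_densityOp (splitL h ψ) f, hs] with x hx h1
  rw [marginalOp, hx]
  refine integral_congr_ae ?_
  filter_upwards [hs] with x' h2
  congr 1
  refine integral_congr_ae ?_
  filter_upwards [h1, h2] with z h3 h4
  rw [h3, h4]

/-- The kernel determines the operator on every `f` almost everywhere, so the choice made in
`kernelOp` is immaterial. -/
theorem HasKernel.kernelOp_eq {T : L2 k →L[ℂ] L2 k} {K : Conf k → Conf k → ℂ}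
    (hT : HasKernel T K) : kernelOp K = T := by
  have hex : ∃ T : L2 k →L[ℂ] L2 k, HasKernel T K := ⟨T, hT⟩
  rw [kernelOp, dif_pos hex]
  ext1 f
  refine Lp.ext ?_
  filter_upwards [hex.choose_spec f, hT f] with x h1 h2
  rw [h1, h2]

end Join

/-! ### The lens transform as a unitary operator -/

section Lens

open scoped ENNReal

variable {k : ℕ}

theorem lintegral_comp_smul {s : ℝ} (hs : 0 < s) (F : Conf k → ℝ≥0∞) :
    ∫⁻ x, F (s • x) = ENNReal.ofReal (s ^ k)⁻¹ * ∫⁻ x, F x := by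
  have h := lintegral_map_equiv (μ := (volume : Measure (Conf k))) F
    (MeasurableEquiv.smul₀ s hs.ne')
  rw [MeasurableEquiv.coe_smul₀, Measure.map_addHaar_smul _ hs.ne', lintegral_smul_measure] at h
  rw [← h, abs_of_nonneg (by positivity)]
  simp

theorem quasiMeasurePreserving_smul {s : ℝ} (hs : 0 < s) :
    Measure.QuasiMeasurePreserving (fun x : Conf k => s • x) volume volume := by
  refine ⟨measurable_const_smul s, ?_⟩
  rw [Measure.map_addHaar_smul _ hs.ne']
  exact Measure.smul_absolutelyContinuous

/-- `s^{k/2} exp(iθ|x|²/2) f(s x)`. -/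
def lensFun (s θ : ℝ) (f : Conf k → ℂ) (x : Conf k) : ℂ :=
  ((s ^ ((k : ℝ) / 2) : ℝ) : ℂ) * Complex.exp (Complex.I * ((θ * (‖x‖ ^ 2 / 2) : ℝ) : ℂ)) *
    f (s • x)

theorem norm_lensFun {s : ℝ} (hs : 0 < s) (θ : ℝ) (f : Conf k → ℂ) (x : Conf k) :
    ‖lensFun s θ f x‖ = s ^ ((k : ℝ) / 2) * ‖f (s • x)‖ := by
  rw [lensFun, norm_mul, norm_mul, mul_comm Complex.I, Complex.norm_exp_ofReal_mul_I, mul_one,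
    Complex.norm_real, Real.norm_of_nonneg (by positivity)]

/-- The phase has modulus one, and the square of the amplitude `s^{k/2}` cancels the Jacobian of the
dilation. -/
theorem lintegral_lensFun_sq {s : ℝ} (hs : 0 < s) (θ : ℝ) (f : Conf k → ℂ) :
    ∫⁻ x, ‖lensFun s θ f x‖ₑ ^ 2 = ∫⁻ x, ‖f x‖ₑ ^ 2 := by
  have h : ∀ x, ‖lensFun s θ f x‖ₑ ^ 2 = ENNReal.ofReal (s ^ k) * ‖f (s • x)‖ₑ ^ 2 := fun x => by
    rw [← ofReal_norm, norm_lensFun hs, ENNReal.ofReal_mul (by positivity), ofReal_norm, mul_pow,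
      ← ENNReal.ofReal_pow (by positivity), ← Real.rpow_natCast, ← Real.rpow_mul hs.le]
    congr 2
    rw [← Real.rpow_natCast]
    congr 1
    push_cast
    ring
  simp_rw [h]
  rw [lintegral_const_mul' _ _ ENNReal.ofReal_ne_top,
    lintegral_comp_smul hs fun x => ‖f x‖ₑ ^ 2, ← mul_assoc, ← ENNReal.ofReal_mul (by positivity),
    mul_inv_cancel₀ (by positivity), ENNReal.ofReal_one, one_mul]

theorem memLp_lensFun {s : ℝ} (hs : 0 < s) (θ : ℝ) {f : Conf k → ℂ} (hf : MemLp f 2) :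
    MemLp (lensFun s θ f) 2 := by
  refine memLp_two_of_lintegral ?_ ?_
  · refine AEStronglyMeasurable.mul ?_ (hf.1.comp_quasiMeasurePreserving
      (quasiMeasurePreserving_smul hs))
    exact Continuous.aestronglyMeasurable (by fun_prop)
  · rw [lintegral_lensFun_sq hs]
    exact MemLp.lintegral_sq_ne_top hf

theorem lensFun_congr_ae {s : ℝ} (hs : 0 < s) (θ : ℝ) {f g : Conf k → ℂ} (h : f =ᵐ[volume] g) :
    lensFun s θ f =ᵐ[volume] lensFun s θ g := by
  filter_upwards [(quasiMeasurePreserving_smul hs).ae h] with x hx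
  rw [lensFun, lensFun, hx]

/-- The operator `f ↦ s^{k/2} exp(iθ|x|²/2) f(s x)` on `L²`. -/
def lensL {s : ℝ} (hs : 0 < s) (θ : ℝ) : L2 k →ₗᵢ[ℂ] L2 k where
  toFun f := (memLp_lensFun hs θ (Lp.memLp f)).toLp _
  map_add' f g := by
    rw [← MemLp.toLp_add, MemLp.toLp_eq_toLp_iff]
    refine (lensFun_congr_ae hs θ (Lp.coeFn_add f g)).trans (Eventually.of_forall fun x => ?_)
    simp only [lensFun, Pi.add_apply, mul_add]
  map_smul' c f := by
    rw [RingHom.id_apply, ← MemLp.toLp_const_smul, MemLp.toLp_eq_toLp_iff]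
    refine (lensFun_congr_ae hs θ (Lp.coeFn_smul c f)).trans (Eventually.of_forall fun x => ?_)
    simp only [lensFun, Pi.smul_apply, smul_eq_mul]
    ring
  norm_map' f := by
    have h : ‖(memLp_lensFun hs θ (Lp.memLp f)).toLp _‖ₑ ^ 2 = ‖f‖ₑ ^ 2 := by
      rw [enorm_sq_eq_lintegral, enorm_sq_eq_lintegral, ← lintegral_lensFun_sq hs θ f]
      refine lintegral_congr_ae ?_
      filter_upwards [(memLp_lensFun hs θ (Lp.memLp f)).coeFn_toLp] with x hx
      rw [hx]
    have h2 := le_antisymm ((ENNReal.pow_le_pow_left_iff two_ne_zero).1 h.le)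
      ((ENNReal.pow_le_pow_left_iff two_ne_zero).1 h.ge)
    have h3 := congrArg ENNReal.toReal h2
    simpa using h3

theorem coeFn_lensL {s : ℝ} (hs : 0 < s) (θ : ℝ) (f : L2 k) :
    lensL hs θ f =ᵐ[volume] lensFun s θ f :=
  (memLp_lensFun hs θ (Lp.memLp f)).coeFn_toLp

theorem integral_comp_smul_conf {s : ℝ} (hs : 0 < s) (F : Conf k → ℂ) :
    ∫ x, F (s • x) = (((s ^ k)⁻¹ : ℝ) : ℂ) * ∫ x, F x := by
  rw [Measure.integral_comp_smul, finrank_euclideanSpace_fin, abs_of_nonneg (by positivity)]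
  rfl

/-- The adjoint of the lens transform is the inverse lens transform. -/
theorem lensL_adjoint {s : ℝ} (hs : 0 < s) (θ : ℝ) :
    (lensL (k := k) hs θ).toContinuousLinearMap.adjoint =
      (lensL (inv_pos.2 hs) (-(θ / s ^ 2))).toContinuousLinearMap := by
  refine ((ContinuousLinearMap.eq_adjoint_iff _ _).2 fun f g => ?_).symm
  simp only [LinearIsometry.coe_toContinuousLinearMap]
  rw [L2.inner_def, L2.inner_def]
  have e1 : ∫ x, inner ℂ (lensL (inv_pos.2 hs) (-(θ / s ^ 2)) f x) (g x) =
      ∫ x, inner ℂ (lensFun s⁻¹ (-(θ / s ^ 2)) f x) (g x) := by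
    refine integral_congr_ae ?_
    filter_upwards [coeFn_lensL (inv_pos.2 hs) (-(θ / s ^ 2)) f] with x hx
    rw [hx]
  have e2 : ∫ x, inner ℂ (f x) (lensL hs θ g x) = ∫ x, inner ℂ (f x) (lensFun s θ g x) := by
    refine integral_congr_ae ?_
    filter_upwards [coeFn_lensL hs θ g] with x hx
    rw [hx]
  rw [e1, e2]
  have h := integral_comp_smul_conf hs
    (fun x => inner ℂ (lensFun s⁻¹ (-(θ / s ^ 2)) f x) (g x))
  have hsk : (((s ^ k : ℝ)) : ℂ) ≠ 0 := by exact_mod_cast (pow_pos hs k).ne'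
  have h' : ∫ x, inner ℂ (lensFun s⁻¹ (-(θ / s ^ 2)) f x) (g x) = ((s ^ k : ℝ) : ℂ) *
      ∫ x, inner ℂ (lensFun s⁻¹ (-(θ / s ^ 2)) f (s • x)) (g (s • x)) := by
    rw [h, ← mul_assoc, ← Complex.ofReal_mul, mul_inv_cancel₀ (pow_pos hs k).ne',
      Complex.ofReal_one, one_mul]
  rw [h', ← integral_const_mul]
  refine integral_congr_ae (Eventually.of_forall fun x => ?_)
  simp only [RCLike.inner_apply, lensFun, smul_smul, inv_mul_cancel₀ hs.ne', one_smul, norm_smul,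
    map_mul, Complex.conj_ofReal, ← Complex.exp_conj, Complex.conj_I]
  have hp : ((s ^ k : ℝ) : ℂ) * ((s⁻¹ ^ ((k : ℝ) / 2) : ℝ) : ℂ) =
      ((s ^ ((k : ℝ) / 2) : ℝ) : ℂ) := by
    rw [← Complex.ofReal_mul]
    congr 1
    rw [Real.inv_rpow hs.le, ← Real.rpow_natCast, ← Real.rpow_neg hs.le, ← Real.rpow_add hs]
    congr 1
    ring
  have he : -Complex.I * ((-(θ / s ^ 2) * ((‖s‖ * ‖x‖) ^ 2 / 2) : ℝ) : ℂ) =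
      Complex.I * ((θ * (‖x‖ ^ 2 / 2) : ℝ) : ℂ) := by
    rw [neg_mul, ← mul_neg, ← Complex.ofReal_neg]
    congr 2
    rw [mul_pow, Real.norm_eq_abs, sq_abs]
    field_simp
  rw [he, ← hp]
  ring

/-- The scale `√(1 + ω²τ²)` of the lens transform. -/
def lensScale (ω τ : ℝ) : ℝ := √(1 + ω ^ 2 * τ ^ 2)

theorem lensScale_pos (ω τ : ℝ) : 0 < lensScale ω τ := Real.sqrt_pos.2 (by positivity)

theorem lensScale_sq (ω τ : ℝ) : lensScale ω τ ^ 2 = 1 + ω ^ 2 * τ ^ 2 :=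
  Real.sq_sqrt (by positivity)

theorem one_le_lensScale (ω τ : ℝ) : 1 ≤ lensScale ω τ :=
  Real.one_le_sqrt.2 (by nlinarith [mul_nonneg (sq_nonneg ω) (sq_nonneg τ)])

/-- The adjoint of the inverse lens transform at time `τ`. -/
def lensPull (ω τ : ℝ) : L2 k →ₗᵢ[ℂ] L2 k := lensL (lensScale_pos ω τ) (-(ω ^ 2 * τ))

theorem norm_lensPull_adjoint (ω τ : ℝ) (f : L2 k) :
    ‖(lensPull ω τ).toContinuousLinearMap.adjoint f‖ = ‖f‖ := by
  rw [lensPull, lensL_adjoint]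
  exact LinearIsometry.norm_map _ _

theorem coeFn_lensPull_adjoint (ω τ : ℝ) (f : L2 k) :
    (lensPull ω τ).toContinuousLinearMap.adjoint f =ᵐ[volume]
      lensFun (lensScale ω τ)⁻¹ (ω ^ 2 * τ / (1 + ω ^ 2 * τ ^ 2)) f := by
  rw [lensPull, lensL_adjoint]
  refine (coeFn_lensL (inv_pos.2 (lensScale_pos ω τ)) _ f).trans (Eventually.of_forall fun x => ?_)
  rw [lensScale_sq, neg_div, neg_neg]

/-- The three groups of factors are those of the kernel of `E* γ E`: the prefactor of `E*`, the
Jacobian of the substitution `y' = s x'`, and the prefactor of `E` written in the variable `y'`. -/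
theorem lensInv_eq (ω τ : ℝ) (G : ℝ → Conf k → Conf k → ℂ) (y y' : Conf k) :
    lensInv ω G τ y y' =
      (((lensScale ω τ)⁻¹ ^ ((k : ℝ) / 2) : ℝ) : ℂ) *
        Complex.exp (Complex.I * ((ω ^ 2 * τ / (1 + ω ^ 2 * τ ^ 2) * (‖y‖ ^ 2 / 2) : ℝ) : ℂ)) *
      ((((lensScale ω τ ^ k)⁻¹ : ℝ) : ℂ) *
        (G (lensTimeInv ω τ) ((lensScale ω τ)⁻¹ • y) ((lensScale ω τ)⁻¹ • y') *
          (((lensScale ω τ ^ ((k : ℝ) / 2) : ℝ) : ℂ) * Complex.exp (Complex.I *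
            ((-(ω ^ 2 * τ / (1 + ω ^ 2 * τ ^ 2)) * (‖y'‖ ^ 2 / 2) : ℝ) : ℂ))))) := by
  have hs := lensScale_pos ω τ
  have hsk : (1 + ω ^ 2 * τ ^ 2) ^ ((k : ℝ) / 2) = lensScale ω τ ^ k := by
    rw [← lensScale_sq, ← Real.rpow_natCast, ← Real.rpow_natCast, ← Real.rpow_mul hs.le]
    congr 1
    push_cast
    ring
  rw [lensInv, hsk]
  change _ / _ * G (lensTimeInv ω τ) ((lensScale ω τ)⁻¹ • y) ((lensScale ω τ)⁻¹ • y') = _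
  generalize G (lensTimeInv ω τ) ((lensScale ω τ)⁻¹ • y) ((lensScale ω τ)⁻¹ • y') = g
  generalize ω ^ 2 * τ / (1 + ω ^ 2 * τ ^ 2) = θ
  generalize lensScale ω τ = s at *
  have hexp : Complex.exp (Complex.I * ((θ * ((‖y‖ ^ 2 - ‖y'‖ ^ 2) / 2) : ℝ) : ℂ)) =
      Complex.exp (Complex.I * ((θ * (‖y‖ ^ 2 / 2) : ℝ) : ℂ)) *
        Complex.exp (Complex.I * ((-θ * (‖y'‖ ^ 2 / 2) : ℝ) : ℂ)) := by
    rw [← Complex.exp_add]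
    congr 1
    push_cast
    ring
  have hpow : ((s⁻¹ ^ ((k : ℝ) / 2) : ℝ) : ℂ) * ((s ^ ((k : ℝ) / 2) : ℝ) : ℂ) = 1 := by
    rw [← Complex.ofReal_mul, ← Real.mul_rpow (inv_nonneg.2 hs.le) hs.le, inv_mul_cancel₀ hs.ne',
      Real.one_rpow, Complex.ofReal_one]
  rw [hexp, Complex.ofReal_inv, div_eq_mul_inv]
  generalize Complex.exp (Complex.I * ((θ * (‖y‖ ^ 2 / 2) : ℝ) : ℂ)) = a
  generalize Complex.exp (Complex.I * ((-θ * (‖y'‖ ^ 2 / 2) : ℝ) : ℂ)) = b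
  generalize ((s⁻¹ ^ ((k : ℝ) / 2) : ℝ) : ℂ) = p at *
  generalize ((s ^ ((k : ℝ) / 2) : ℝ) : ℂ) = q at *
  generalize ((s ^ k : ℝ) : ℂ)⁻¹ = r
  linear_combination -(a * b * r * g) * hpow

theorem lensFun_lensScale (ω τ : ℝ) (f : Conf k → ℂ) (x : Conf k) :
    lensFun (lensScale ω τ) (-(ω ^ 2 * τ)) f x = ((lensScale ω τ ^ ((k : ℝ) / 2) : ℝ) : ℂ) *
      Complex.exp (Complex.I * ((-(ω ^ 2 * τ / (1 + ω ^ 2 * τ ^ 2)) *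
        (‖lensScale ω τ • x‖ ^ 2 / 2) : ℝ) : ℂ)) * f (lensScale ω τ • x) := by
  have h : -(ω ^ 2 * τ) * (‖x‖ ^ 2 / 2) = -(ω ^ 2 * τ / (1 + ω ^ 2 * τ ^ 2)) *
      (‖lensScale ω τ • x‖ ^ 2 / 2) := by
    have h0 : 1 + ω ^ 2 * τ ^ 2 ≠ 0 := by positivity
    rw [norm_smul, mul_pow, Real.norm_eq_abs, sq_abs, lensScale_sq]
    field_simp
  rw [lensFun, h]

theorem hasKernel_lens (ω τ : ℝ) {γ : L2 k →L[ℂ] L2 k} {G : ℝ → Conf k → Conf k → ℂ}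
    (hγ : HasKernel γ (G (lensTimeInv ω τ))) :
    HasKernel ((lensPull ω τ).toContinuousLinearMap.adjoint.comp
      (γ.comp (lensPull ω τ).toContinuousLinearMap)) (lensInv ω G τ) := by
  intro f
  have hs := lensScale_pos ω τ
  have h1 := (quasiMeasurePreserving_smul (k := k) (inv_pos.2 hs)).ae (hγ (lensPull ω τ f))
  filter_upwards [coeFn_lensPull_adjoint ω τ (γ (lensPull ω τ f)), h1] with y hy hy1
  rw [ContinuousLinearMap.comp_apply, ContinuousLinearMap.comp_apply,
    LinearIsometry.coe_toContinuousLinearMap, hy, lensFun, hy1]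
  let F : Conf k → ℂ := fun y' =>
    G (lensTimeInv ω τ) ((lensScale ω τ)⁻¹ • y) ((lensScale ω τ)⁻¹ • y') *
    (((lensScale ω τ ^ ((k : ℝ) / 2) : ℝ) : ℂ) *
      Complex.exp (Complex.I * ((-(ω ^ 2 * τ / (1 + ω ^ 2 * τ ^ 2)) * (‖y'‖ ^ 2 / 2) : ℝ) : ℂ)) *
        f y')
  have e1 : ∫ x', G (lensTimeInv ω τ) ((lensScale ω τ)⁻¹ • y) x' * (lensPull ω τ f) x' =
      ∫ x', F (lensScale ω τ • x') := by
    refine integral_congr_ae ?_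
    filter_upwards [coeFn_lensL hs (-(ω ^ 2 * τ)) f] with x hx
    simp only [F]
    rw [lensPull, hx, lensFun_lensScale, smul_smul, inv_mul_cancel₀ hs.ne', one_smul]
  rw [e1, integral_comp_smul_conf hs F, ← integral_const_mul, ← integral_const_mul]
  refine integral_congr_ae (Eventually.of_forall fun y' => ?_)
  simp only [lensInv_eq, F]
  ring

/-- `u_N⁽ᵏ⁾(τ)` is the conjugate of the marginal density operator by the lens transform. -/
theorem lensMarginal_eq {N : ℕ} (h : k ≤ N) (ω τ : ℝ) (U : ℝ → (L2 N →L[ℂ] L2 N)) (ψ₀ : L2 N) :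
    lensMarginal ω U ψ₀ k τ = (lensPull ω τ).toContinuousLinearMap.adjoint.comp
      ((marginalOp h (U (lensTimeInv ω τ) ψ₀)).comp (lensPull ω τ).toContinuousLinearMap) := by
  rw [lensMarginal, if_pos h]
  exact (hasKernel_lens ω τ (hasKernel_marginalOp h _)).kernelOp_eq

theorem adjoint_comp_comp {H K : Type*} [NormedAddCommGroup H] [InnerProductSpace ℂ H]
    [CompleteSpace H] [NormedAddCommGroup K] [InnerProductSpace ℂ K] [CompleteSpace K]
    (X : H →L[ℂ] K) (E : H →L[ℂ] H) :
    E.adjoint.comp ((X.adjoint.comp X).comp E) = (X.comp E).adjoint.comp (X.comp E) := by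
  rw [ContinuousLinearMap.adjoint_comp]
  rfl

/-- `u_N⁽ᵏ⁾(τ) = X* X` with this operator `X`. -/
def lensHalf {N : ℕ} (h : k ≤ N) (ω τ : ℝ) (ψ : L2 N) : L2 k →L[ℂ] L2 (N - k) :=
  (halfDensity (splitL h ψ)).comp (lensPull ω τ).toContinuousLinearMap

theorem lensMarginal_eq_gram {N : ℕ} (h : k ≤ N) (ω τ : ℝ) (U : ℝ → (L2 N →L[ℂ] L2 N))
    (ψ₀ : L2 N) : lensMarginal ω U ψ₀ k τ =
      (lensHalf h ω τ (U (lensTimeInv ω τ) ψ₀)).adjoint.comp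
        (lensHalf h ω τ (U (lensTimeInv ω τ) ψ₀)) := by
  rw [lensMarginal_eq h]
  exact adjoint_comp_comp (halfDensity (splitL h (U (lensTimeInv ω τ) ψ₀))) _

/-- Hilbert–Schmidt norms are invariant under unitaries. On the adjoint side `(X E)* = E* X*`, and
`E*` preserves norms because it is itself a lens transform. -/
theorem tsum_enorm_comp_lensPull {K : Type*} [NormedAddCommGroup K] [InnerProductSpace ℂ K]
    [CompleteSpace K] {ι : Type*} (b : HilbertBasis ι ℂ (L2 k)) (ω τ : ℝ) (X : L2 k →L[ℂ] K) :
    ∑' i, ‖X (lensPull ω τ (b i))‖ₑ ^ 2 = ∑' i, ‖X (b i)‖ₑ ^ 2 := by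
  have h1 := tsum_enorm_sq_adjoint b (traceBasis K)
    (X.comp (lensPull (k := k) ω τ).toContinuousLinearMap)
  simp only [ContinuousLinearMap.adjoint_comp, ContinuousLinearMap.comp_apply,
    LinearIsometry.coe_toContinuousLinearMap] at h1
  rw [h1, tsum_enorm_sq_adjoint b (traceBasis K) X]
  refine tsum_congr fun i => ?_
  rw [← ofReal_norm, norm_lensPull_adjoint, ofReal_norm]

/-- For `k ≤ N` the trace of the Gram operator is `‖ψ‖² = 1`; otherwise the operator is zero.
Normalisation is asked for only if `k ≤ N`, since nothing is assumed about the data for `N = 0`. -/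
theorem isPosTrace_lensMarginal {N : ℕ} (ω τ : ℝ) (U : ℝ → (L2 N →L[ℂ] L2 N)) (ψ₀ : L2 N)
    (hn : k ≤ N → ‖U (lensTimeInv ω τ) ψ₀‖ = 1) :
    IsPosTrace (lensMarginal ω U ψ₀ k τ) 1 := by
  by_cases h : k ≤ N
  · set ψ := U (lensTimeInv ω τ) ψ₀
    have hX := tsum_enorm_comp_lensPull (traceBasis (L2 k)) ω τ (halfDensity (splitL h ψ))
    rw [tsum_enorm_halfDensity_sq, ← ofReal_norm, LinearIsometry.norm_map, hn h] at hX
    have ht : IsTraceClass (lensMarginal ω U ψ₀ k τ) := by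
      rw [lensMarginal_eq_gram h]
      refine isTraceClass_adjoint_comp (traceBasis _) ?_
      simp only [lensHalf, ContinuousLinearMap.comp_apply,
        LinearIsometry.coe_toContinuousLinearMap]
      rw [hX]
      finiteness
    refine ⟨?_, ht, ?_⟩
    · rw [lensMarginal_eq_gram h]
      exact ContinuousLinearMap.isPositive_adjoint_comp_self _
    · rw [lensMarginal_eq_gram h] at ht ⊢
      have h2 := tsum_enorm_sq_eq_trace (traceBasis _) ht
      simp only [lensHalf, ContinuousLinearMap.comp_apply,
        LinearIsometry.coe_toContinuousLinearMap] at h2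
      rw [hX] at h2
      by_contra! hc
      have h3 := (ENNReal.ofReal_lt_ofReal_iff (by linarith)).2 hc
      simp only [ENNReal.ofReal_one, one_pow] at h2 h3
      exact h3.ne h2
  · rw [lensMarginal, if_neg h]
    refine ⟨ContinuousLinearMap.isPositive_zero, ?_, by simp [opTrace]⟩
    exact ⟨fun _ => 0, fun _ => 0, by simp [summable_zero], fun x => by simp [hasSum_zero]⟩

end Lens

/-! ### Permutation symmetry -/

section Permutation

variable {k N : ℕ}

/-- `permute` as a linear isometry. -/
def permuteEquiv (σ : Equiv.Perm (Fin k)) : Conf k ≃ₗᵢ[ℝ] Conf k :=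
  LinearIsometryEquiv.piLpCongrLeft 2 ℝ ℝ σ.symm

theorem permuteEquiv_apply (σ : Equiv.Perm (Fin k)) (x : Conf k) :
    permuteEquiv σ x = permute σ x := by
  ext i
  simp [permuteEquiv, permute, LinearIsometryEquiv.piLpCongrLeft_apply,
    Equiv.piCongrLeft'_apply]

theorem measurePreserving_permute (σ : Equiv.Perm (Fin k)) :
    MeasurePreserving (permute σ : Conf k → Conf k) volume volume := by
  have h := (permuteEquiv σ).measurePreserving
  simpa only [funext (permuteEquiv_apply σ)] using h

theorem measurableEmbedding_permute (σ : Equiv.Perm (Fin k)) :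
    MeasurableEmbedding (permute σ : Conf k → Conf k) := by
  have h := (permuteEquiv σ).toHomeomorph.measurableEmbedding
  have e : ⇑(permuteEquiv σ).toHomeomorph = permute σ := funext (permuteEquiv_apply σ)
  rwa [e] at h

theorem permute_permute (σ π : Equiv.Perm (Fin k)) (x : Conf k) :
    permute σ (permute π x) = permute (π * σ) x := rfl

theorem permute_one (x : Conf k) : permute 1 x = x := rfl

theorem permute_smul (σ : Equiv.Perm (Fin k)) (s : ℝ) (x : Conf k) :
    permute σ (s • x) = s • permute σ x := rfl

theorem norm_permute (σ : Equiv.Perm (Fin k)) (x : Conf k) : ‖permute σ x‖ = ‖x‖ := by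
  rw [← permuteEquiv_apply]
  exact (permuteEquiv σ).norm_map x

/-- The action of permutations on `L²`. -/
def permL (σ : Equiv.Perm (Fin k)) : L2 k →ₗᵢ[ℂ] L2 k :=
  Lp.compMeasurePreservingₗᵢ ℂ (permute σ) (measurePreserving_permute σ)

theorem coeFn_permL (σ : Equiv.Perm (Fin k)) (f : L2 k) :
    permL σ f =ᵐ[volume] fun x => f (permute σ x) :=
  Lp.coeFn_compMeasurePreserving f (measurePreserving_permute σ)

theorem permL_permL (σ π : Equiv.Perm (Fin k)) (f : L2 k) :
    permL σ (permL π f) = permL (σ * π) f := by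
  refine Lp.ext ?_
  filter_upwards [coeFn_permL σ (permL π f), coeFn_permL (σ * π) f,
    (measurePreserving_permute σ).quasiMeasurePreserving.ae (coeFn_permL π f)] with x h1 h2 h3
  rw [h1, h3, h2, permute_permute]

theorem permL_one (f : L2 k) : permL 1 f = f := by
  refine Lp.ext ?_
  filter_upwards [coeFn_permL 1 f] with x h1
  rw [h1, permute_one]

theorem permL_permL_inv (σ : Equiv.Perm (Fin k)) (f : L2 k) : permL σ (permL σ⁻¹ f) = f := by
  rw [permL_permL, mul_inv_cancel, permL_one]

theorem inner_permL_left (σ : Equiv.Perm (Fin k)) (f g : L2 k) :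
    inner ℂ (permL σ f) g = inner ℂ f (permL σ⁻¹ g) := by
  rw [← (permL σ).inner_map_map f, permL_permL_inv]

theorem isSymmetricState_iff (ψ : L2 k) : IsSymmetricState ψ ↔ ∀ σ, permL σ ψ = ψ := by
  refine forall_congr' fun σ => ⟨fun h => Lp.ext ((coeFn_permL σ ψ).trans h), fun h => ?_⟩
  have h1 := coeFn_permL σ ψ
  rw [h] at h1
  exact h1.symm

theorem isSymmetricOp_of_permL {u : L2 k →L[ℂ] L2 k} (h1 : ∀ σ f, permL σ (u f) = u f)
    (h2 : ∀ σ f, u (permL σ f) = u f) : IsSymmetricOp u := by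
  refine ⟨fun f => (isSymmetricState_iff _).2 fun σ => h1 σ f, fun σ f g hg => ?_⟩
  rw [← h2 σ f]
  congr 1
  exact Lp.ext (EventuallyEq.trans hg (coeFn_permL σ f).symm)

/-- A permutation of the first `k` of `N` particles. -/
def liftPerm (h : k ≤ N) (σ : Equiv.Perm (Fin k)) : Equiv.Perm (Fin N) :=
  ((joinIndex h).symm.trans (Equiv.sumCongr σ (Equiv.refl _))).trans (joinIndex h)

theorem permute_liftPerm_join (h : k ≤ N) (σ : Equiv.Perm (Fin k)) (x : Conf k)
    (z : Conf (N - k)) : permute (liftPerm h σ) (join x z) = join (permute σ x) z := by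
  ext i
  obtain ⟨j, rfl⟩ := (joinIndex h).surjective i
  rcases j with i | i
  · rw [join_inl h]
    simp only [permute, liftPerm, Equiv.trans_apply, Equiv.symm_apply_apply, Equiv.sumCongr_apply,
      Sum.map_inl]
    exact join_inl h x z (σ i)
  · rw [join_inr h]
    simp only [permute, liftPerm, Equiv.trans_apply, Equiv.symm_apply_apply, Equiv.sumCongr_apply,
      Sum.map_inr]
    exact join_inr h x z i

/-- A permutation of the first `k` particles extends to all `N` particles, so the slices `Ψ(·, z)`
are invariant; the measure preserving substitution `x ↦ σ x` then removes `σ` from `f`. -/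
theorem halfDensity_permL (h : k ≤ N) {ψ : L2 N} (hψ : IsSymmetricState ψ)
    (σ : Equiv.Perm (Fin k)) (f : L2 k) :
    halfDensity (splitL h ψ) (permL σ f) = halfDensity (splitL h ψ) f := by
  refine Lp.ext ?_
  have hs := coeFn_splitL h ψ
  have hsym : ∀ᵐ p ∂((volume : Measure (Conf k)).prod (volume : Measure (Conf (N - k)))),
      ψ (join (permute σ p.1) p.2) = ψ (join p.1 p.2) := by
    have := (measurePreserving_joinEquiv h).quasiMeasurePreserving.ae (hψ (liftPerm h σ))
    filter_upwards [this] with p hp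
    rwa [joinEquiv_apply, permute_liftPerm_join] at hp
  have hswap : ∀ {P : Conf k × Conf (N - k) → Prop},
      (∀ᵐ p ∂((volume : Measure (Conf k)).prod (volume : Measure (Conf (N - k)))), P p) →
      ∀ᵐ z : Conf (N - k), ∀ᵐ x : Conf k, P (x, z) := fun hP =>
    Measure.ae_ae_of_ae_prod
      (Measure.measurePreserving_swap.quasiMeasurePreserving.ae hP)
  filter_upwards [coeFn_halfDensity (splitL h ψ) (permL σ f), coeFn_halfDensity (splitL h ψ) f,
    hswap hs, hswap hsym] with z h1 h2 h3 h4
  rw [h1, h2]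
  have e1 : ∫ x, permL σ f x * conj (splitL h ψ (x, z)) =
      ∫ x, (fun x => f x * conj (ψ (join x z))) (permute σ x) := by
    refine integral_congr_ae ?_
    filter_upwards [coeFn_permL σ f, h3, h4] with x h5 h6 h7
    rw [h5, h6, h7]
  rw [e1]
  refine ((measurePreserving_permute σ).integral_comp (measurableEmbedding_permute σ)
    (fun x => f x * conj (ψ (join x z)))).trans ?_
  refine integral_congr_ae ?_
  filter_upwards [h3] with x h6
  rw [h6]

theorem lensPull_permL (ω τ : ℝ) (σ : Equiv.Perm (Fin k)) (f : L2 k) :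
    lensPull ω τ (permL σ f) = permL σ (lensPull ω τ f) := by
  refine Lp.ext ?_
  have hs := lensScale_pos ω τ
  filter_upwards [coeFn_lensL hs (-(ω ^ 2 * τ)) (permL σ f), coeFn_permL σ (lensPull ω τ f),
    (measurePreserving_permute σ).quasiMeasurePreserving.ae (coeFn_lensL hs (-(ω ^ 2 * τ)) f),
    (quasiMeasurePreserving_smul hs).ae (coeFn_permL σ f)] with x h1 h2 h3 h4
  rw [lensPull, h1, ← lensPull, h2, lensPull, h3, lensFun, lensFun, h4, norm_permute, permute_smul]

/-- Invariance on the right is immediate from that of `X`; invariance on the left follows by taking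
adjoints, as `X* X` is self-adjoint. -/
theorem permL_gram {K : Type*} [NormedAddCommGroup K] [InnerProductSpace ℂ K] [CompleteSpace K]
    {X : L2 k →L[ℂ] K} (hX : ∀ σ f, X (permL σ f) = X f) :
    (∀ σ f, permL σ ((X.adjoint.comp X) f) = (X.adjoint.comp X) f) ∧
      ∀ σ f, (X.adjoint.comp X) (permL σ f) = (X.adjoint.comp X) f := by
  refine ⟨fun σ f => ext_inner_left ℂ fun g => ?_, fun σ f => ?_⟩
  · rw [← inner_conj_symm, inner_permL_left, inner_conj_symm, ContinuousLinearMap.comp_apply,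
      ContinuousLinearMap.adjoint_inner_right, ContinuousLinearMap.adjoint_inner_right, hX]
  · rw [ContinuousLinearMap.comp_apply, ContinuousLinearMap.comp_apply, hX]

theorem lensMarginal_permL (ω τ : ℝ) (U : ℝ → (L2 N →L[ℂ] L2 N)) (ψ₀ : L2 N)
    (hψ : k ≤ N → IsSymmetricState (U (lensTimeInv ω τ) ψ₀)) :
    (∀ σ f, permL σ (lensMarginal ω U ψ₀ k τ f) = lensMarginal ω U ψ₀ k τ f) ∧
      ∀ σ f, lensMarginal ω U ψ₀ k τ (permL σ f) = lensMarginal ω U ψ₀ k τ f := by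
  by_cases h : k ≤ N
  · rw [lensMarginal_eq_gram h]
    refine permL_gram fun σ f => ?_
    rw [lensHalf, ContinuousLinearMap.comp_apply, ContinuousLinearMap.comp_apply,
      LinearIsometry.coe_toContinuousLinearMap, lensPull_permL, halfDensity_permL h (hψ h)]
  · rw [lensMarginal, if_neg h]
    simp

end Permutation

/-! ### Unitary groups and their generators -/

section UnitaryGroup

variable {H : Type*} [NormedAddCommGroup H] [InnerProductSpace ℂ H]

/-- A strongly continuous one-parameter group of isometries. -/
structure IsUnitaryGroup (U : ℝ → (H →L[ℂ] H)) : Prop where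
  zero : U 0 = ContinuousLinearMap.id ℂ H
  add : ∀ s t, U (s + t) = (U s).comp (U t)
  isometry : ∀ t f, ‖U t f‖ = ‖f‖

/-- The graph of the self-adjoint generator of a unitary group. -/
def generatorGraph (U : ℝ → (H →L[ℂ] H)) : Set (H × H) :=
  {p | HasDerivAt (fun t : ℝ => U t p.1) (-Complex.I • p.2) 0}

namespace IsUnitaryGroup

variable {U : ℝ → (H →L[ℂ] H)} (hU : IsUnitaryGroup U)

include hU

theorem inner_map_map (t : ℝ) (f g : H) : inner ℂ (U t f) (U t g) = inner ℂ f g :=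
  (LinearMap.norm_map_iff_inner_map_map (U t)).1 (hU.isometry t) f g

theorem map_neg_map (t : ℝ) (f : H) : U t (U (-t) f) = f := by
  rw [← ContinuousLinearMap.comp_apply, ← hU.add, add_neg_cancel, hU.zero]
  rfl

theorem hasDerivAt {p : H × H} (hp : p ∈ generatorGraph U) (t : ℝ) :
    HasDerivAt (fun s : ℝ => U s p.1) (-Complex.I • U t p.2) t := by
  have h1 : HasDerivAt (fun s : ℝ => U s p.1) (-Complex.I • p.2) (t - t) := by
    rw [sub_self]
    exact hp
  have h2 := h1.comp_sub_const t t
  have h3 := (U t).restrictScalars ℝ |>.hasFDerivAt.comp_hasDerivAt t h2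
  rw [← map_smul]
  refine h3.congr_of_eventuallyEq (Eventually.of_forall fun s => ?_)
  simp only [Function.comp_apply, ContinuousLinearMap.coe_restrictScalars',
    ← ContinuousLinearMap.comp_apply, ← hU.add]
  congr 2
  ring

theorem map_mem_generatorGraph {p : H × H} (hp : p ∈ generatorGraph U) (t : ℝ) :
    (U t p.1, U t p.2) ∈ generatorGraph U := by
  have h3 := (U t).restrictScalars ℝ |>.hasFDerivAt.comp_hasDerivAt 0 (show HasDerivAt _ _ _ from hp)
  change HasDerivAt _ _ _
  rw [← map_smul]
  refine h3.congr_of_eventuallyEq (Eventually.of_forall fun s => ?_)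
  simp only [Function.comp_apply, ContinuousLinearMap.coe_restrictScalars',
    ← ContinuousLinearMap.comp_apply, ← hU.add]
  rw [add_comm]

/-- Differentiate the constant function `t ↦ ⟨U_t p, U_t q⟩` at zero. -/
theorem inner_symm {p q : H × H} (hp : p ∈ generatorGraph U) (hq : q ∈ generatorGraph U) :
    inner ℂ p.2 q.1 = inner ℂ p.1 q.2 := by
  have h1 := HasDerivAt.inner ℂ (hU.hasDerivAt hp 0) (hU.hasDerivAt hq 0)
  simp only [hU.inner_map_map, inner_smul_left, inner_smul_right, map_neg, Complex.conj_I] at h1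
  have h2 := h1.unique (hasDerivAt_const 0 _)
  have h3 : Complex.I * (inner ℂ p.2 q.1 - inner ℂ p.1 q.2) = 0 := by linear_combination h2
  simpa [sub_eq_zero] using h3

/-- For `p` and `q` in the graph, `s ↦ ⟨U_s q, P U_s p⟩` has derivative zero, by symmetry of the
generator and invariance of its graph under `P`. Hence `U_{-t} P U_t` and `P` have equal matrix
elements on a dense domain. -/
theorem commute_of_generatorGraph (hdense : Dense (Prod.fst '' generatorGraph U))
    {P : H →L[ℂ] H} (hP : ∀ p ∈ generatorGraph U, (P p.1, P p.2) ∈ generatorGraph U) (t : ℝ)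
    (f : H) : P (U t f) = U t (P f) := by
  have key : ∀ p ∈ generatorGraph U, P (U t p.1) = U t (P p.1) := by
    intro p hp
    rw [← sub_eq_zero]
    have h0 : ∀ q ∈ generatorGraph U, inner ℂ q.1 (U (-t) (P (U t p.1) - U t (P p.1))) = 0 := by
      intro q hq
      have h1 : ∀ s, HasDerivAt (fun s : ℝ => inner ℂ (U s q.1) (P (U s p.1))) 0 s := by
        intro s
        have h2 := (P.restrictScalars ℝ).hasFDerivAt.comp_hasDerivAt s (hU.hasDerivAt hp s)
        have h3 := HasDerivAt.inner ℂ (hU.hasDerivAt hq s) h2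
        have h4 := hU.inner_symm (hU.map_mem_generatorGraph hq s)
          (hP _ (hU.map_mem_generatorGraph hp s))
        simp only at h4
        refine h3.congr_deriv ?_
        simp only [Function.comp_apply, ContinuousLinearMap.coe_restrictScalars', map_smul,
          inner_smul_left, inner_smul_right, map_neg, Complex.conj_I, h4]
        ring
      have h5 := is_const_of_deriv_eq_zero (fun s => (h1 s).differentiableAt)
        (fun s => (h1 s).deriv) t 0
      simp only [hU.zero, ContinuousLinearMap.id_apply] at h5
      rw [← hU.inner_map_map t, hU.map_neg_map, inner_sub_right, h5, hU.inner_map_map, sub_self]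
    have h6 : U (-t) (P (U t p.1) - U t (P p.1)) = 0 := by
      refine hdense.eq_zero_of_inner_right ℂ ?_
      rintro _ ⟨q, hq, rfl⟩
      exact h0 q hq
    rw [← hU.map_neg_map t (P (U t p.1) - U t (P p.1)), h6, map_zero]
  have hc : Set.EqOn (fun f => P (U t f)) (fun f => U t (P f)) (Prod.fst '' generatorGraph U) := by
    rintro _ ⟨p, hp, rfl⟩
    exact key p hp
  exact congrFun (Continuous.ext_on hdense (by fun_prop) (by fun_prop) hc) f

end IsUnitaryGroup

end UnitaryGroup

/-! ### The Hamiltonian on Schwartz functions -/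

section Hamiltonian

variable {V : 𝓢(ℝ, ℝ)} {ω β : ℝ} {N : ℕ}

open LineDeriv

/-- The scaled pair interaction `N^β V(N^β r)`. -/
def scaledV (V : 𝓢(ℝ, ℝ)) (β : ℝ) (N : ℕ) (r : ℝ) : ℝ := (N : ℝ) ^ β * V ((N : ℝ) ^ β * r)

theorem scaledV_neg (hV : ∀ x, V (-x) = V x) (r : ℝ) : scaledV V β N (-r) = scaledV V β N r := by
  simp [scaledV, hV]

theorem hasTemperateGrowth_coord (i : Fin N) :
    Function.HasTemperateGrowth (fun x : Conf N => x i) :=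
  (EuclideanSpace.proj (𝕜 := ℝ) i : Conf N →L[ℝ] ℝ).hasTemperateGrowth

theorem hasTemperateGrowth_scaledV (i j : Fin N) :
    Function.HasTemperateGrowth (fun x : Conf N => scaledV V β N (x i - x j)) := by
  have h := (V.hasTemperateGrowth).comp (f := fun x : Conf N => (N : ℝ) ^ β * (x i - x j))
    ((Function.HasTemperateGrowth.const _).mul
      ((hasTemperateGrowth_coord i).sub (hasTemperateGrowth_coord j)))
  exact (Function.HasTemperateGrowth.const _).mul h

/-- The interaction potential. -/
def pairPot (V : 𝓢(ℝ, ℝ)) (β : ℝ) (N : ℕ) (x : Conf N) : ℝ :=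
  1 / (N : ℝ) * ∑ i, ∑ j ∈ Finset.Ioi i, scaledV V β N (x i - x j)

theorem hasTemperateGrowth_pairPot : Function.HasTemperateGrowth (pairPot V β N) :=
  (Function.HasTemperateGrowth.const _).mul (Function.HasTemperateGrowth.sum fun i _ =>
    Function.HasTemperateGrowth.sum fun j _ => hasTemperateGrowth_scaledV i j)

theorem hasTemperateGrowth_ofReal_comp {f : Conf N → ℝ} (hf : f.HasTemperateGrowth) :
    Function.HasTemperateGrowth (fun x => (f x : ℂ)) :=
  Function.HasTemperateGrowth.comp Function.Complex.hasTemperateGrowth_ofReal hf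

/-- Multiplication of Schwartz functions by a real function of temperate growth. -/
def mulS (w : Conf N → ℝ) : 𝓢(Conf N, ℂ) →L[ℂ] 𝓢(Conf N, ℂ) :=
  SchwartzMap.smulLeftCLM ℂ (fun x => (w x : ℂ))

theorem mulS_apply {w : Conf N → ℝ} (hw : w.HasTemperateGrowth) (φ : 𝓢(Conf N, ℂ)) (x : Conf N) :
    mulS w φ x = (w x : ℂ) * φ x :=
  SchwartzMap.smulLeftCLM_apply_apply (hasTemperateGrowth_ofReal_comp hw) φ x

theorem hasTemperateGrowth_harmonic (ω : ℝ) (i : Fin N) :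
    Function.HasTemperateGrowth (fun x : Conf N => ω ^ 2 / 2 * (x i) ^ 2) :=
  (Function.HasTemperateGrowth.const _).mul ((hasTemperateGrowth_coord i).pow 2)

/-- The standard basis vectors. -/
def unitVec (i : Fin N) : Conf N := EuclideanSpace.basisFun (Fin N) ℝ i

/-- The harmonic oscillator in the `i`-th variable. -/
def oscS (ω : ℝ) (i : Fin N) (φ : 𝓢(Conf N, ℂ)) : 𝓢(Conf N, ℂ) :=
  -(1 / 2 : ℂ) • ∂_{unitVec i} (∂_{unitVec i} φ) + mulS (fun x => ω ^ 2 / 2 * (x i) ^ 2) φ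

/-- The Hamiltonian as a map of the Schwartz space. -/
def hamS (V : 𝓢(ℝ, ℝ)) (ω β : ℝ) (N : ℕ) (φ : 𝓢(Conf N, ℂ)) : 𝓢(Conf N, ℂ) :=
  (∑ i : Fin N, oscS ω i φ) + mulS (pairPot V β N) φ

theorem hamS_apply (φ : 𝓢(Conf N, ℂ)) (x : Conf N) :
    hamS V ω β N φ x = hamiltonian V ω β N φ x := by
  have h1 : Laplacian.laplacian (φ : Conf N → ℂ) x =
      ∑ i : Fin N, (∂_{unitVec i} (∂_{unitVec i} φ) : 𝓢(Conf N, ℂ)) x := by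
    rw [← SchwartzMap.laplacian_apply,
      SchwartzMap.laplacian_eq_sum (EuclideanSpace.basisFun (Fin N) ℝ), sum_apply]
    rfl
  rw [hamS, add_apply, sum_apply, mulS_apply hasTemperateGrowth_pairPot,
    hamiltonian, h1]
  simp only [oscS, add_apply, smul_apply,
    mulS_apply (hasTemperateGrowth_harmonic ω _), Finset.sum_add_distrib, smul_eq_mul,
    ← Finset.sum_mul, pairPot, scaledV]
  rw [← Finset.mul_sum Finset.univ
    (fun i : Fin N => (∂_{unitVec i} (∂_{unitVec i} φ) : 𝓢(Conf N, ℂ)) x)]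
  push_cast
  ring

/-- A Schwartz function as an element of `L²`. -/
def toL2 (φ : 𝓢(Conf N, ℂ)) : L2 N := φ.toLp 2 volume

theorem coeFn_toL2 (φ : 𝓢(Conf N, ℂ)) : toL2 φ =ᵐ[volume] φ := φ.coeFn_toLp 2 volume

theorem mem_hamiltonianGraph (φ : 𝓢(Conf N, ℂ)) :
    (toL2 φ, toL2 (hamS V ω β N φ)) ∈ hamiltonianGraph V ω β N := by
  refine ⟨φ, coeFn_toL2 φ, ?_⟩
  filter_upwards [coeFn_toL2 (hamS V ω β N φ)] with x hx
  rw [hx, hamS_apply]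

theorem hamiltonianGraph_eq : hamiltonianGraph V ω β N =
    Set.range fun φ : 𝓢(Conf N, ℂ) => (toL2 φ, toL2 (hamS V ω β N φ)) := by
  ext p
  constructor
  · rintro ⟨φ, h1, h2⟩
    refine ⟨φ, Prod.ext (Lp.ext ?_) (Lp.ext ?_)⟩
    · filter_upwards [coeFn_toL2 φ, h1] with x h3 h4
      rw [h3, h4]
    · filter_upwards [coeFn_toL2 (hamS V ω β N φ), h2] with x h3 h4
      rw [h3, h4, hamS_apply]
  · rintro ⟨φ, rfl⟩
    exact mem_hamiltonianGraph φ

/-- Evenness makes the sums over `i < j` and `i > j` equal. The full double sum, unlike the ordered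
one, is visibly invariant under permutations. -/
theorem pairPot_eq (hV : ∀ x, V (-x) = V x) (x : Conf N) : pairPot V β N x =
    1 / (N : ℝ) * (((∑ i, ∑ j, scaledV V β N (x i - x j)) - N * scaledV V β N 0) / 2) := by
  have h1 : ∑ i, ∑ j, scaledV V β N (x i - x j) =
      ∑ i, ∑ j ∈ Finset.Ioi i, scaledV V β N (x i - x j) +
      ∑ i, ∑ j ∈ Finset.Iio i, scaledV V β N (x i - x j) + N * scaledV V β N 0 := by
    have h2 : ∀ i, ∑ j, scaledV V β N (x i - x j) = ∑ j ∈ Finset.Ioi i, scaledV V β N (x i - x j) +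
        ∑ j ∈ Finset.Iio i, scaledV V β N (x i - x j) + scaledV V β N 0 := by
      intro i
      have h3 : (Finset.univ : Finset (Fin N)) =
          ((Finset.Ioi i).disjUnion (Finset.Iio i) (by
            rw [Finset.disjoint_left]; intro a ha hb
            exact lt_asymm (Finset.mem_Ioi.1 ha) (Finset.mem_Iio.1 hb))).disjUnion {i} (by
              rw [Finset.disjoint_left]; intro a ha hb
              simp only [Finset.mem_disjUnion, Finset.mem_Ioi, Finset.mem_Iio,
                Finset.mem_singleton] at ha hb
              subst hb; simp at ha) := by
        ext j
        simp only [Finset.mem_univ, Finset.mem_disjUnion, Finset.mem_Ioi, Finset.mem_Iio,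
          Finset.mem_singleton, true_iff]
        rcases lt_trichotomy i j with h | h | h
        · exact Or.inl (Or.inl h)
        · exact Or.inr h.symm
        · exact Or.inl (Or.inr h)
      rw [h3, Finset.sum_disjUnion, Finset.sum_disjUnion, Finset.sum_singleton, sub_self]
    rw [Finset.sum_congr rfl fun i _ => h2 i, Finset.sum_add_distrib, Finset.sum_add_distrib]
    simp
  have h4 : ∑ i, ∑ j ∈ Finset.Iio i, scaledV V β N (x i - x j) =
      ∑ i, ∑ j ∈ Finset.Ioi i, scaledV V β N (x i - x j) := by
    rw [Finset.sum_comm' (t' := Finset.univ) (s' := fun j => Finset.Ioi j) (by simp)]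
    refine Finset.sum_congr rfl fun i _ => Finset.sum_congr rfl fun j _ => ?_
    rw [← scaledV_neg hV, neg_sub]
  rw [h1, h4, pairPot]
  ring

theorem pairPot_permute (hV : ∀ x, V (-x) = V x) (σ : Equiv.Perm (Fin N)) (x : Conf N) :
    pairPot V β N (permute σ x) = pairPot V β N x := by
  rw [pairPot_eq hV, pairPot_eq hV]
  have h : ∑ i, ∑ j, scaledV V β N (permute σ x i - permute σ x j) =
      ∑ i, ∑ j, scaledV V β N (x i - x j) := by
    simp only [permute]
    rw [Equiv.sum_comp σ (fun i => ∑ j, scaledV V β N (x i - x (σ j)))]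
    exact Finset.sum_congr rfl fun i _ => Equiv.sum_comp σ (fun j => scaledV V β N (x i - x j))
  rw [h]

/-- The action of permutations on Schwartz functions. -/
def permS (σ : Equiv.Perm (Fin N)) : 𝓢(Conf N, ℂ) →L[ℂ] 𝓢(Conf N, ℂ) :=
  SchwartzMap.compCLMOfContinuousLinearEquiv ℂ (permuteEquiv σ).toContinuousLinearEquiv

theorem permS_apply (σ : Equiv.Perm (Fin N)) (φ : 𝓢(Conf N, ℂ)) (x : Conf N) :
    permS σ φ x = φ (permute σ x) := by
  rw [← permuteEquiv_apply]
  rfl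

theorem permL_toL2 (σ : Equiv.Perm (Fin N)) (φ : 𝓢(Conf N, ℂ)) :
    permL σ (toL2 φ) = toL2 (permS σ φ) := by
  refine Lp.ext ?_
  filter_upwards [coeFn_permL σ (toL2 φ), coeFn_toL2 (permS σ φ),
    (measurePreserving_permute σ).quasiMeasurePreserving.ae (coeFn_toL2 φ)] with x h1 h2 h3
  rw [h1, h2, h3, permS_apply]

/-- The Laplacian may be computed in any orthonormal basis; on the right it is computed in the
permuted one, so the sums match term by term. -/
theorem laplacian_permS (σ : Equiv.Perm (Fin N)) (φ : 𝓢(Conf N, ℂ)) :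
    Laplacian.laplacian (permS σ φ) = permS σ (Laplacian.laplacian φ) := by
  rw [SchwartzMap.laplacian_eq_sum (EuclideanSpace.basisFun (Fin N) ℝ),
    SchwartzMap.laplacian_eq_sum ((EuclideanSpace.basisFun (Fin N) ℝ).map (permuteEquiv σ)),
    map_sum]
  refine Finset.sum_congr rfl fun i _ => ?_
  rw [permS, SchwartzMap.lineDerivOp_compCLMOfContinuousLinearEquiv,
    SchwartzMap.lineDerivOp_compCLMOfContinuousLinearEquiv]
  rfl

theorem hamS_permS (hV : ∀ x, V (-x) = V x) (σ : Equiv.Perm (Fin N)) (φ : 𝓢(Conf N, ℂ)) :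
    hamS V ω β N (permS σ φ) = permS σ (hamS V ω β N φ) := by
  ext x
  rw [permS_apply, hamS_apply, hamS_apply, hamiltonian, hamiltonian,
    ← SchwartzMap.laplacian_apply, ← SchwartzMap.laplacian_apply, laplacian_permS, permS_apply,
    permS_apply]
  have h1 := pairPot_permute (β := β) hV σ x
  have h2 : ∑ j, ω ^ 2 / 2 * (permute σ x j) ^ 2 = ∑ j, ω ^ 2 / 2 * (x j) ^ 2 :=
    Equiv.sum_comp σ fun j => ω ^ 2 / 2 * (x j) ^ 2
  rw [h2]
  simp only [pairPot, scaledV] at h1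
  rw [h1]

theorem dense_schwartz : Dense (Set.range fun φ : 𝓢(Conf N, ℂ) => (toL2 φ : L2 N)) :=
  SchwartzMap.denseRange_toLpCLM (p := 2) (by simp)

namespace IsEvolution

variable {U : ℝ → (L2 N →L[ℂ] L2 N)} (hU : IsEvolution V ω β N U)

include hU

theorem isUnitaryGroup : IsUnitaryGroup U := ⟨hU.zero, hU.add, hU.isometry⟩

theorem generatorGraph_eq : generatorGraph U = closure (hamiltonianGraph V ω β N) := hU.generator

theorem dense_domain : Dense (Prod.fst '' generatorGraph U) := by
  refine dense_schwartz.mono ?_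
  rintro _ ⟨φ, rfl⟩
  refine ⟨(toL2 φ, toL2 (hamS V ω β N φ)), ?_, rfl⟩
  rw [hU.generatorGraph_eq]
  exact subset_closure (mem_hamiltonianGraph φ)

/-- Permutations commute with the Hamiltonian on Schwartz functions, hence preserve the closure of
its graph, which is the graph of the generator. -/
theorem permL_map (hV : ∀ x, V (-x) = V x) (σ : Equiv.Perm (Fin N)) (t : ℝ) (f : L2 N) :
    permL σ (U t f) = U t (permL σ f) := by
  refine hU.isUnitaryGroup.commute_of_generatorGraph hU.dense_domain
    (P := (permL σ).toContinuousLinearMap) ?_ t f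
  intro p hp
  rw [hU.generatorGraph_eq] at hp ⊢
  have hc : Continuous fun p : L2 N × L2 N => (permL σ p.1, permL σ p.2) := by fun_prop
  refine map_mem_closure (f := fun p : L2 N × L2 N => (permL σ p.1, permL σ p.2)) hc hp ?_
  rw [hamiltonianGraph_eq]
  rintro _ ⟨φ, rfl⟩
  refine ⟨permS σ φ, ?_⟩
  simp only [permL_toL2, hamS_permS hV]

theorem isSymmetricState (hV : ∀ x, V (-x) = V x) {ψ : L2 N} (hψ : IsSymmetricState ψ) (t : ℝ) :
    IsSymmetricState (U t ψ) := by
  rw [isSymmetricState_iff] at hψ ⊢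
  intro σ
  rw [hU.permL_map hV, hψ]

end IsEvolution

end Hamiltonian

/-! ### Multiplication operators -/

section Multiplication

variable {α : Type*} [MeasurableSpace α] {μ : Measure α} {m : α → ℂ} {C : ℝ}

theorem memLp_mul_of_bounded (hm : Measurable m) (hC : ∀ x, ‖m x‖ ≤ C) (f : Lp ℂ 2 μ) :
    MemLp (fun x => m x * f x) 2 μ :=
  (Lp.memLp f).of_le_mul (hm.aestronglyMeasurable.mul (Lp.memLp f).1)
    (Eventually.of_forall fun x => by
      rw [norm_mul]
      exact mul_le_mul_of_nonneg_right (hC x) (norm_nonneg _))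

/-- Multiplication by a bounded function on `L²`. -/
def mulOp (hm : Measurable m) (hC : ∀ x, ‖m x‖ ≤ C) : Lp ℂ 2 μ →L[ℂ] Lp ℂ 2 μ :=
  LinearMap.mkContinuous
    { toFun := fun f => (memLp_mul_of_bounded hm hC f).toLp _
      map_add' := fun f g => by
        rw [← MemLp.toLp_add, MemLp.toLp_eq_toLp_iff]
        filter_upwards [Lp.coeFn_add f g] with x hx
        simp only [hx, Pi.add_apply, mul_add]
      map_smul' := fun c f => by
        rw [← MemLp.toLp_const_smul, MemLp.toLp_eq_toLp_iff]
        filter_upwards [Lp.coeFn_smul c f] with x hx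
        simp only [hx, Pi.smul_apply, smul_eq_mul, RingHom.id_apply]
        ring } C fun f => by
    refine Lp.norm_le_mul_norm_of_ae_le_mul ?_
    filter_upwards [(memLp_mul_of_bounded hm hC f).coeFn_toLp] with x hx
    simp only [LinearMap.coe_mk, AddHom.coe_mk, hx, norm_mul]
    exact mul_le_mul_of_nonneg_right (hC x) (norm_nonneg _)

theorem coeFn_mulOp (hm : Measurable m) (hC : ∀ x, ‖m x‖ ≤ C) (f : Lp ℂ 2 μ) :
    mulOp hm hC f =ᵐ[μ] fun x => m x * f x :=
  (memLp_mul_of_bounded hm hC f).coeFn_toLp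

theorem norm_mulOp_apply_le (hm : Measurable m) (hC : ∀ x, ‖m x‖ ≤ C) (f : Lp ℂ 2 μ) :
    ‖mulOp hm hC f‖ ≤ C * ‖f‖ := by
  refine Lp.norm_le_mul_norm_of_ae_le_mul ?_
  filter_upwards [coeFn_mulOp hm hC f] with x hx
  rw [hx, norm_mul]
  exact mul_le_mul_of_nonneg_right (hC x) (norm_nonneg _)

theorem inner_mulOp_left (hm : Measurable m) (hC : ∀ x, ‖m x‖ ≤ C) (hr : ∀ x, conj (m x) = m x)
    (f g : Lp ℂ 2 μ) : inner ℂ (mulOp hm hC f) g = inner ℂ f (mulOp hm hC g) := by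
  rw [L2.inner_def, L2.inner_def]
  refine integral_congr_ae ?_
  filter_upwards [coeFn_mulOp hm hC f, coeFn_mulOp hm hC g] with x h1 h2
  simp only [h1, h2, RCLike.inner_apply, map_mul, hr]
  ring

end Multiplication

/-! ### Partial inner products -/

section PartialInner

variable {N k : ℕ}

/-- `(R_f ψ)(z) = ∫ conj f(x) ψ(x, z) dx`. -/
def partialInner (h : k ≤ N) (f : L2 k) : L2 N →L[ℂ] L2 (N - k) :=
  (pairing volume volume (star f)).comp (splitL h).toContinuousLinearMap

theorem coeFn_partialInner (h : k ≤ N) (f : L2 k) (ψ : L2 N) {f' : Conf k → ℂ} {ψ' : Conf N → ℂ}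
    (hf : f =ᵐ[volume] f') (hψ : ψ =ᵐ[volume] ψ') :
    partialInner h f ψ =ᵐ[volume] fun z => ∫ x, conj (f' x) * ψ' (join x z) := by
  have h1 : (star f : L2 k) =ᵐ[volume] fun x => conj (f' x) := by
    filter_upwards [Lp.coeFn_star f, hf] with x h2 h3
    rw [h2, Pi.star_apply, h3]
    rfl
  have h4 : splitL h ψ =ᵐ[(volume : Measure (Conf k)).prod (volume : Measure (Conf (N - k)))]
      fun p => ψ' (join p.1 p.2) := by
    filter_upwards [coeFn_splitL h ψ,
      (measurePreserving_joinEquiv h).quasiMeasurePreserving.ae hψ] with p h2 h3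
    rw [h2, ← joinEquiv_apply h, h3]
  exact (coeFn_pairing (star f) (splitL h ψ)).trans (pairFun_congr_ae h1 h4)

theorem norm_partialInner_le (h : k ≤ N) (f : L2 k) (ψ : L2 N) :
    ‖partialInner h f ψ‖ ≤ ‖f‖ * ‖ψ‖ := by
  have h1 : ‖(star f : L2 k)‖ ≤ ‖f‖ := by
    refine Lp.norm_le_norm_of_ae_le ?_
    filter_upwards [Lp.coeFn_star f] with x hx
    rw [hx, Pi.star_apply, norm_star]
  refine (norm_pairing_le (star f) (splitL h ψ)).trans ?_
  rw [LinearIsometry.norm_map]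
  gcongr

theorem inner_marginalOp (h : k ≤ N) (ψ : L2 N) (f g : L2 k) :
    inner ℂ g (marginalOp h ψ f) = inner ℂ (partialInner h f ψ) (partialInner h g ψ) :=
  inner_densityOp _ _ _

/-- Fubini brings the integral over the outside variables `z` innermost, with `x` and `y` fixed.
There one can integrate by parts, or move real multipliers, in the variables outside the marginal.
-/
theorem inner_pairFun_pairFun {α β : Type*} [MeasurableSpace α] [MeasurableSpace β]
    {μ : Measure α} {ν : Measure β} [SFinite μ] [SFinite ν] {f g : α → ℂ} {Φ Ψ : α × β → ℂ}
    (hf : MemLp f 2 μ) (hg : MemLp g 2 μ) (hΦ : MemLp Φ 2 (μ.prod ν)) (hΨ : MemLp Ψ 2 (μ.prod ν)) :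
    ∫ z, conj (∫ x, conj (f x) * Φ (x, z) ∂μ) * ∫ y, conj (g y) * Ψ (y, z) ∂μ ∂ν =
      ∫ x, f x * ∫ y, conj (g y) * ∫ z, conj (Φ (x, z)) * Ψ (y, z) ∂ν ∂μ ∂μ := by
  have hη := memLp_pairFun (memLp_conj hg) hΨ
  have h1 : Integrable (fun p : α × β => f p.1 * pairFun μ (fun y => conj (g y)) Ψ p.2 *
      conj (Φ p)) (μ.prod ν) := (memLp_mul_prod hf hη).integrable_mul (memLp_conj hΦ)
  have h2 := integral_prod _ h1
  rw [integral_prod_symm _ h1] at h2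
  refine Eq.trans (Eq.trans (integral_congr_ae ?_) h2) (integral_congr_ae ?_)
  · refine Eventually.of_forall fun z => ?_
    simp only [pairFun]
    rw [← integral_conj, ← integral_mul_const]
    refine integral_congr_ae (Eventually.of_forall fun x => ?_)
    simp only [map_mul, Complex.conj_conj]
    ring
  · filter_upwards [ae_memLp_slice_right hΦ] with x hx
    have h3 : Integrable (fun p : α × β => conj (g p.1) * conj (Φ (x, p.2)) * Ψ p) (μ.prod ν) :=
      (memLp_mul_prod (memLp_conj hg) (memLp_conj hx)).integrable_mul hΨ
    have h4 := integral_prod _ h3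
    rw [integral_prod_symm _ h3] at h4
    simp only [mul_assoc, integral_const_mul] at h4 ⊢
    rw [← h4]
    congr 1
    refine integral_congr_ae (Eventually.of_forall fun z => ?_)
    simp only [pairFun]
    rw [mul_comm, ← integral_const_mul]
    refine integral_congr_ae (Eventually.of_forall fun y => ?_)
    simp only
    ring

theorem memLp_schwartz_join (h : k ≤ N) (φ : 𝓢(Conf N, ℂ)) :
    MemLp (fun p : Conf k × Conf (N - k) => φ (join p.1 p.2)) 2 (volume.prod volume) := by
  have h1 := (φ.memLp 2 volume).comp_measurePreserving (measurePreserving_joinEquiv h)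
  exact h1.ae_eq (Eventually.of_forall fun p => by
    rw [Function.comp_apply, joinEquiv_apply])

theorem inner_partialInner_schwartz (h : k ≤ N) (f g : 𝓢(Conf k, ℂ)) (φ χ : 𝓢(Conf N, ℂ)) :
    inner ℂ (partialInner h (toL2 f) (toL2 φ)) (partialInner h (toL2 g) (toL2 χ)) =
      ∫ x, f x * ∫ y, conj (g y) *
        ∫ z : Conf (N - k), conj (φ (join x z)) * χ (join y z) := by
  rw [← inner_pairFun_pairFun (f.memLp 2 volume) (g.memLp 2 volume) (memLp_schwartz_join h φ)
    (memLp_schwartz_join h χ), L2.inner_def]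
  refine integral_congr_ae ?_
  filter_upwards [coeFn_partialInner h (toL2 f) (toL2 φ) (coeFn_toL2 f) (coeFn_toL2 φ),
    coeFn_partialInner h (toL2 g) (toL2 χ) (coeFn_toL2 g) (coeFn_toL2 χ)] with z h1 h2
  rw [h1, h2, RCLike.inner_apply, mul_comm]

end PartialInner

/-! ### Slices of Schwartz functions -/

section Slices

variable {N k : ℕ}

open LineDeriv

theorem join_add (x x' : Conf k) (z z' : Conf (N - k)) :
    (join (x + x') (z + z') : Conf N) = join x z + join x' z' := by
  ext i
  simp only [join, PiLp.add_apply]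
  split_ifs <;> rfl

theorem join_smul (t : ℝ) (x : Conf k) (z : Conf (N - k)) :
    (join (t • x) (t • z) : Conf N) = t • join x z := by
  ext i
  simp only [join, PiLp.smul_apply]
  split_ifs <;> rfl

theorem norm_join_sq (h : k ≤ N) (x : Conf k) (z : Conf (N - k)) :
    ‖(join x z : Conf N)‖ ^ 2 = ‖x‖ ^ 2 + ‖z‖ ^ 2 := by
  simp only [EuclideanSpace.norm_sq_eq]
  rw [← Equiv.sum_comp (joinIndex h), Fintype.sum_sum_type]
  simp only [join_inl, join_inr]

theorem norm_join_zero (h : k ≤ N) (x : Conf k) :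
    ‖(join x (0 : Conf (N - k)) : Conf N)‖ = ‖x‖ := by
  rw [← sq_eq_sq₀ (norm_nonneg _) (norm_nonneg _), norm_join_sq h, norm_zero]
  ring

theorem norm_zero_join (h : k ≤ N) (z : Conf (N - k)) :
    ‖(join (0 : Conf k) z : Conf N)‖ = ‖z‖ := by
  rw [← sq_eq_sq₀ (norm_nonneg _) (norm_nonneg _), norm_join_sq h, norm_zero]
  ring

/-- `x ↦ (x, 0)` as a linear isometry. -/
def joinLeft (h : k ≤ N) : Conf k →ₗᵢ[ℝ] Conf N where
  toFun x := join x 0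
  map_add' x x' := by rw [← join_add, add_zero]
  map_smul' t x := by
    rw [RingHom.id_apply, ← join_smul, smul_zero]
  norm_map' x := norm_join_zero h x

/-- `z ↦ (0, z)` as a linear isometry. -/
def joinRight (h : k ≤ N) : Conf (N - k) →ₗᵢ[ℝ] Conf N where
  toFun z := join 0 z
  map_add' z z' := by rw [← join_add, add_zero]
  map_smul' t z := by
    rw [RingHom.id_apply, ← join_smul, smul_zero]
  norm_map' z := norm_zero_join h z

theorem join_eq (h : k ≤ N) (x : Conf k) (z : Conf (N - k)) :
    (join x z : Conf N) = joinLeft h x + joinRight h z := by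
  change _ = join x 0 + join 0 z
  rw [← join_add, add_zero, zero_add]

/-- The restriction of a Schwartz function to an affine subspace. -/
def sliceS {D E : Type*} [NormedAddCommGroup D] [NormedSpace ℝ D] [NormedAddCommGroup E]
    [NormedSpace ℝ E] (L : D →ₗᵢ[ℝ] E) (c : E) : 𝓢(E, ℂ) →L[ℂ] 𝓢(D, ℂ) :=
  SchwartzMap.compCLMOfAntilipschitz ℂ (K := 1) (g := fun x => L x + c)
    (L.toContinuousLinearMap.hasTemperateGrowth.add (Function.HasTemperateGrowth.const c))
    (AntilipschitzWith.of_le_mul_dist fun x y => by simp)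

theorem sliceS_apply {D E : Type*} [NormedAddCommGroup D] [NormedSpace ℝ D] [NormedAddCommGroup E]
    [NormedSpace ℝ E] (L : D →ₗᵢ[ℝ] E) (c : E) (φ : 𝓢(E, ℂ)) (x : D) :
    sliceS L c φ x = φ (L x + c) := rfl

theorem lineDerivOp_sliceS {D E : Type*} [NormedAddCommGroup D] [NormedSpace ℝ D]
    [NormedAddCommGroup E] [NormedSpace ℝ E] (L : D →ₗᵢ[ℝ] E) (c : E) (φ : 𝓢(E, ℂ)) (v : D) :
    (∂_{v} (sliceS L c φ) : 𝓢(D, ℂ)) = sliceS L c (∂_{L v} φ) := by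
  ext x
  rw [sliceS_apply, SchwartzMap.lineDerivOp_apply, SchwartzMap.lineDerivOp_apply, lineDeriv,
    lineDeriv]
  congr 1
  ext t
  rw [sliceS_apply, L.map_add, L.map_smul, add_right_comm]

theorem integral_conj_mul_lineDerivOp {n : ℕ} (f g : 𝓢(Conf n, ℂ)) (v : Conf n) :
    ∫ x, conj (f x) * (∂_{v} g : 𝓢(Conf n, ℂ)) x =
      -∫ x, conj ((∂_{v} f : 𝓢(Conf n, ℂ)) x) * g x :=
  SchwartzMap.integral_bilinear_lineDerivOp_right_eq_neg_left (μ := volume) f g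
    ((ContinuousLinearMap.mul ℝ ℂ).comp (Complex.conjCLE : ℂ →L[ℝ] ℂ)) v

/-- For each `z`, integrate by parts in the inside variable on the Schwartz slice `φ(·, z)`. -/
theorem partialInner_lineDerivOp (h : k ≤ N) (f : 𝓢(Conf k, ℂ)) (φ : 𝓢(Conf N, ℂ)) (v : Conf k) :
    partialInner h (toL2 f) (toL2 (∂_{joinLeft h v} φ)) =
      -partialInner h (toL2 (∂_{v} f)) (toL2 φ) := by
  refine Lp.ext ?_
  filter_upwards [coeFn_partialInner h _ _ (coeFn_toL2 f) (coeFn_toL2 (∂_{joinLeft h v} φ)),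
    coeFn_partialInner h _ _ (coeFn_toL2 (∂_{v} f)) (coeFn_toL2 φ),
    Lp.coeFn_neg (partialInner h (toL2 (∂_{v} f)) (toL2 φ))] with z h1 h2 h3
  rw [h1, h3, Pi.neg_apply, h2]
  have h4 := integral_conj_mul_lineDerivOp f (sliceS (joinLeft h) (joinRight h z) φ) v
  simp only [lineDerivOp_sliceS, sliceS_apply, ← join_eq] at h4
  exact h4

/-- For fixed `x` and `y`, integrate by parts in `z`; the test functions depend only on the inside
variables and are not differentiated. -/
theorem inner_partialInner_lineDerivOp (h : k ≤ N) (f g : 𝓢(Conf k, ℂ)) (φ χ : 𝓢(Conf N, ℂ))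
    (w : Conf (N - k)) :
    inner ℂ (partialInner h (toL2 f) (toL2 (∂_{joinRight h w} φ)))
        (partialInner h (toL2 g) (toL2 χ)) =
      -inner ℂ (partialInner h (toL2 f) (toL2 φ))
        (partialInner h (toL2 g) (toL2 (∂_{joinRight h w} χ))) := by
  have key : ∀ x y : Conf k, ∫ z : Conf (N - k),
      conj ((∂_{joinRight h w} φ : 𝓢(Conf N, ℂ)) (join x z)) * χ (join y z) =
      -∫ z : Conf (N - k), conj (φ (join x z)) * (∂_{joinRight h w} χ : 𝓢(Conf N, ℂ)) (join y z) := by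
    intro x y
    have h4 := integral_conj_mul_lineDerivOp (sliceS (joinRight h) (joinLeft h x) φ)
      (sliceS (joinRight h) (joinLeft h y) χ) w
    simp only [lineDerivOp_sliceS, sliceS_apply, add_comm (joinRight h _), ← join_eq] at h4
    rw [h4, neg_neg]
  rw [inner_partialInner_schwartz, inner_partialInner_schwartz]
  simp only [key, mul_neg, integral_neg]

theorem partialInner_mulS (h : k ≤ N) (f : 𝓢(Conf k, ℂ)) (φ : 𝓢(Conf N, ℂ)) {w : Conf k → ℝ}
    {W : Conf N → ℝ} (hw : w.HasTemperateGrowth) (hW : W.HasTemperateGrowth)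
    (he : ∀ x z, W (join x z) = w x) :
    partialInner h (toL2 f) (toL2 (mulS W φ)) = partialInner h (toL2 (mulS w f)) (toL2 φ) := by
  refine Lp.ext ?_
  filter_upwards [coeFn_partialInner h _ _ (coeFn_toL2 f) (coeFn_toL2 (mulS W φ)),
    coeFn_partialInner h _ _ (coeFn_toL2 (mulS w f)) (coeFn_toL2 φ)] with z h1 h2
  rw [h1, h2]
  refine integral_congr_ae (Eventually.of_forall fun x => ?_)
  simp only [mulS_apply hw, mulS_apply hW, he, map_mul, Complex.conj_ofReal]
  ring

theorem inner_partialInner_mulS (h : k ≤ N) (f g : 𝓢(Conf k, ℂ)) (φ χ : 𝓢(Conf N, ℂ))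
    {w : Conf (N - k) → ℝ} {W : Conf N → ℝ} (hW : W.HasTemperateGrowth)
    (he : ∀ (x : Conf k) z, W (join x z) = w z) :
    inner ℂ (partialInner h (toL2 f) (toL2 (mulS W φ))) (partialInner h (toL2 g) (toL2 χ)) =
      inner ℂ (partialInner h (toL2 f) (toL2 φ)) (partialInner h (toL2 g) (toL2 (mulS W χ))) := by
  rw [inner_partialInner_schwartz, inner_partialInner_schwartz]
  simp only [mulS_apply hW, he, map_mul, Complex.conj_ofReal]
  congr! 6
  refine integral_congr_ae (Eventually.of_forall fun z => ?_)
  simp only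
  ring

end Slices

/-! ### The commutator with the Hamiltonian -/

section Commutator

variable {V : 𝓢(ℝ, ℝ)} {ω β : ℝ} {N k : ℕ}

open LineDeriv

theorem toL2_add (φ χ : 𝓢(Conf N, ℂ)) : toL2 (φ + χ) = toL2 φ + toL2 χ :=
  map_add (SchwartzMap.toLpCLM ℂ ℂ 2 (volume : Measure (Conf N))) φ χ

theorem toL2_smul (c : ℂ) (φ : 𝓢(Conf N, ℂ)) : toL2 (c • φ) = c • toL2 φ :=
  map_smul (SchwartzMap.toLpCLM ℂ ℂ 2 (volume : Measure (Conf N))) c φ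

theorem toL2_sum {ι : Type*} (s : Finset ι) (φ : ι → 𝓢(Conf N, ℂ)) :
    toL2 (∑ i ∈ s, φ i) = ∑ i ∈ s, toL2 (φ i) :=
  map_sum (SchwartzMap.toLpCLM ℂ ℂ 2 (volume : Measure (Conf N))) φ s

theorem partialInner_add (h : k ≤ N) (f g : L2 k) :
    partialInner h (f + g) = partialInner h f + partialInner h g := by
  have h1 : (star (f + g) : L2 k) = (star f : L2 k) + (star g : L2 k) := by
    refine Lp.ext ?_
    filter_upwards [Lp.coeFn_star (f + g), Lp.coeFn_star f, Lp.coeFn_star g, Lp.coeFn_add f g,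
      Lp.coeFn_add (star f : L2 k) (star g : L2 k)] with x h1 h2 h3 h4 h5
    rw [h1, h5, Pi.star_apply, Pi.add_apply, h2, h3, h4, Pi.star_apply, Pi.star_apply, Pi.add_apply,
      star_add]
  rw [partialInner, h1, map_add, ContinuousLinearMap.add_comp]
  rfl

theorem partialInner_smul (h : k ≤ N) (c : ℂ) (f : L2 k) :
    partialInner h (c • f) = conj c • partialInner h f := by
  have h1 : (star (c • f) : L2 k) = conj c • (star f : L2 k) := by
    refine Lp.ext ?_
    filter_upwards [Lp.coeFn_star (c • f), Lp.coeFn_star f, Lp.coeFn_smul c f,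
      Lp.coeFn_smul (conj c) (star f : L2 k)] with x h1 h2 h4 h5
    rw [h1, h5, Pi.star_apply, Pi.smul_apply, h2, h4, Pi.star_apply, Pi.smul_apply, smul_eq_mul,
      smul_eq_mul, star_mul', RCLike.star_def]
  rw [partialInner, h1, map_smul, ContinuousLinearMap.smul_comp]
  rfl

theorem unitVec_inl (h : k ≤ N) (i : Fin k) :
    unitVec (joinIndex h (Sum.inl i)) = joinLeft h (unitVec i) := by
  ext l
  obtain ⟨j, rfl⟩ := (joinIndex h).surjective l
  change _ = (join (unitVec i) 0 : Conf N) _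
  rcases j with j | j
  · rw [join_inl]
    simp [unitVec, PiLp.single_apply]
  · rw [join_inr]
    simp [unitVec]

theorem unitVec_inr (h : k ≤ N) (i : Fin (N - k)) :
    unitVec (joinIndex h (Sum.inr i)) = joinRight h (unitVec i) := by
  ext l
  obtain ⟨j, rfl⟩ := (joinIndex h).surjective l
  change _ = (join 0 (unitVec i) : Conf N) _
  rcases j with j | j
  · rw [join_inl]
    simp [unitVec]
  · rw [join_inr]
    simp [unitVec, PiLp.single_apply]

theorem toL2_oscS (i : Fin N) (φ : 𝓢(Conf N, ℂ)) :
    toL2 (oscS ω i φ) = (-(1 / 2 : ℂ)) • toL2 (∂_{unitVec i} (∂_{unitVec i} φ)) +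
      toL2 (mulS (fun x => ω ^ 2 / 2 * (x i) ^ 2) φ) := by
  rw [oscS, toL2_add, toL2_smul]

theorem conj_neg_half : conj (-(1 / 2 : ℂ)) = -(1 / 2) := by
  rw [map_neg, map_div₀, map_one, map_ofNat]

theorem partialInner_oscS (h : k ≤ N) (f : 𝓢(Conf k, ℂ)) (φ : 𝓢(Conf N, ℂ)) (i : Fin k) :
    partialInner h (toL2 f) (toL2 (oscS ω (joinIndex h (Sum.inl i)) φ)) =
      partialInner h (toL2 (oscS ω i f)) (toL2 φ) := by
  rw [toL2_oscS, toL2_oscS, map_add, map_smul, unitVec_inl, partialInner_lineDerivOp,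
    partialInner_lineDerivOp, neg_neg, partialInner_add, partialInner_smul,
    partialInner_mulS h f φ (hasTemperateGrowth_harmonic ω i)
      (hasTemperateGrowth_harmonic ω (joinIndex h (Sum.inl i))) fun x z => by rw [join_inl h],
    conj_neg_half]
  rfl

/-- Two integrations by parts make the second derivative symmetric, and the real potential is
symmetric as well. Thus the oscillators outside the marginal drop out of the commutator. -/
theorem inner_partialInner_oscS (h : k ≤ N) (f g : 𝓢(Conf k, ℂ)) (φ χ : 𝓢(Conf N, ℂ))
    (i : Fin (N - k)) :
    inner ℂ (partialInner h (toL2 f) (toL2 (oscS ω (joinIndex h (Sum.inr i)) φ)))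
        (partialInner h (toL2 g) (toL2 χ)) =
      inner ℂ (partialInner h (toL2 f) (toL2 φ))
        (partialInner h (toL2 g) (toL2 (oscS ω (joinIndex h (Sum.inr i)) χ))) := by
  have h1 := inner_partialInner_lineDerivOp h f g (∂_{joinRight h (unitVec i)} φ) χ (unitVec i)
  have h2 := inner_partialInner_lineDerivOp h f g φ (∂_{joinRight h (unitVec i)} χ) (unitVec i)
  have h3 := inner_partialInner_mulS h f g φ χ (w := fun z => ω ^ 2 / 2 * (z i) ^ 2)
    (hasTemperateGrowth_harmonic ω (joinIndex h (Sum.inr i))) fun x z => by rw [join_inr h]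
  rw [h2, neg_neg] at h1
  rw [toL2_oscS, toL2_oscS, map_add, map_smul, map_add, map_smul, inner_add_left, inner_add_right,
    inner_smul_left, inner_smul_right, unitVec_inr, h3, h1, conj_neg_half]

/-- The sup norm bound of the scaled interaction. -/
def boundV (V : 𝓢(ℝ, ℝ)) : ℝ := SchwartzMap.seminorm ℝ 0 0 V

theorem abs_le_boundV (r : ℝ) : |V r| ≤ boundV V := SchwartzMap.norm_le_seminorm ℝ V r

theorem boundV_nonneg : 0 ≤ boundV V := (abs_nonneg _).trans (abs_le_boundV 0)

theorem abs_scaledV_le (r : ℝ) : |scaledV V β N r| ≤ (N : ℝ) ^ β * boundV V := by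
  have h1 : 0 ≤ (N : ℝ) ^ β := by positivity
  rw [scaledV, abs_mul, abs_of_nonneg h1]
  exact mul_le_mul_of_nonneg_left (abs_le_boundV _) h1

theorem measurable_scaledV : Measurable (scaledV V β N) :=
  (V.continuous.comp (continuous_const.mul continuous_id)).measurable.const_mul _

theorem measurable_pairV (i j : Fin N) :
    Measurable fun x : Conf N => ((scaledV V β N (x i - x j) : ℝ) : ℂ) :=
  Complex.measurable_ofReal.comp (measurable_scaledV.comp (by fun_prop))

theorem norm_pairV_le (i j : Fin N) (x : Conf N) :
    ‖((scaledV V β N (x i - x j) : ℝ) : ℂ)‖ ≤ (N : ℝ) ^ β * boundV V := by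
  rw [Complex.norm_real]
  exact abs_scaledV_le _

/-- Multiplication by the interaction of the particles `i` and `j`. -/
def pairOp (V : 𝓢(ℝ, ℝ)) (β : ℝ) (N : ℕ) (i j : Fin N) : L2 N →L[ℂ] L2 N :=
  mulOp (measurable_pairV (V := V) (β := β) i j) (norm_pairV_le i j)

theorem coeFn_pairOp (i j : Fin N) (ψ : L2 N) :
    pairOp V β N i j ψ =ᵐ[volume] fun x => ((scaledV V β N (x i - x j) : ℝ) : ℂ) * ψ x :=
  coeFn_mulOp _ _ ψ

/-- Multiplication by the interaction potential. -/
def interOp (V : 𝓢(ℝ, ℝ)) (β : ℝ) (N : ℕ) : L2 N →L[ℂ] L2 N :=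
  (1 / (N : ℂ)) • ∑ i, ∑ j ∈ Finset.Ioi i, pairOp V β N i j

theorem toL2_mulS_scaledV (i j : Fin N) (φ : 𝓢(Conf N, ℂ)) :
    toL2 (mulS (fun x => scaledV V β N (x i - x j)) φ) = pairOp V β N i j (toL2 φ) := by
  refine Lp.ext ?_
  filter_upwards [coeFn_toL2 (mulS (fun x => scaledV V β N (x i - x j)) φ), coeFn_toL2 φ,
    coeFn_pairOp (V := V) (β := β) i j (toL2 φ)] with x h1 h2 h3
  rw [h1, h3, h2, mulS_apply (hasTemperateGrowth_scaledV i j)]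

theorem toL2_mulS_pairPot (φ : 𝓢(Conf N, ℂ)) :
    toL2 (mulS (pairPot V β N) φ) = interOp V β N (toL2 φ) := by
  have h1 : mulS (pairPot V β N) φ = (1 / (N : ℂ)) •
      ∑ i, ∑ j ∈ Finset.Ioi i, mulS (fun x => scaledV V β N (x i - x j)) φ := by
    ext x
    rw [mulS_apply hasTemperateGrowth_pairPot, smul_apply, sum_apply]
    simp only [sum_apply, mulS_apply (hasTemperateGrowth_scaledV _ _), pairPot, ← Finset.sum_mul,
      smul_eq_mul]
    push_cast
    ring
  rw [h1, toL2_smul, toL2_sum, interOp, smul_apply, sum_apply]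
  simp only [toL2_sum, toL2_mulS_scaledV, sum_apply]

theorem toL2_hamS (h : k ≤ N) (φ : 𝓢(Conf N, ℂ)) :
    toL2 (hamS V ω β N φ) = (∑ i, toL2 (oscS ω (joinIndex h (Sum.inl i)) φ)) +
      (∑ i, toL2 (oscS ω (joinIndex h (Sum.inr i)) φ)) + interOp V β N (toL2 φ) := by
  rw [hamS, toL2_add, toL2_mulS_pairPot, toL2_sum, ← Equiv.sum_comp (joinIndex h),
    Fintype.sum_sum_type]

/-- The part of the commutator due to the interaction operator `W`. -/
def interForm (h : k ≤ N) (f g : L2 k) (W : L2 N →L[ℂ] L2 N) (ψ : L2 N) : ℂ :=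
  inner ℂ (partialInner h f (W ψ)) (partialInner h g ψ) -
    inner ℂ (partialInner h f ψ) (partialInner h g (W ψ))

/-- The derivative of `⟨R_f ψ, R_g ψ⟩` along the evolution, up to the factor `i`. -/
def commForm (V : 𝓢(ℝ, ℝ)) (ω β : ℝ) (h : k ≤ N) (f g : 𝓢(Conf k, ℂ)) (ψ : L2 N) : ℂ :=
  (∑ i, (inner ℂ (partialInner h (toL2 (oscS ω i f)) ψ) (partialInner h (toL2 g) ψ) -
    inner ℂ (partialInner h (toL2 f) ψ) (partialInner h (toL2 (oscS ω i g)) ψ))) +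
  interForm h (toL2 f) (toL2 g) (interOp V β N) ψ

/-- Oscillators outside the marginal cancel and those inside move onto `f` and `g`. No derivative of
`φ` remains, so `commForm` makes sense on all of `L²` and is continuous there for fixed `N`. -/
theorem commForm_schwartz (h : k ≤ N) (f g : 𝓢(Conf k, ℂ)) (φ : 𝓢(Conf N, ℂ)) :
    inner ℂ (partialInner h (toL2 f) (toL2 (hamS V ω β N φ))) (partialInner h (toL2 g) (toL2 φ)) -
      inner ℂ (partialInner h (toL2 f) (toL2 φ))
        (partialInner h (toL2 g) (toL2 (hamS V ω β N φ))) =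
      commForm V ω β h f g (toL2 φ) := by
  rw [toL2_hamS h]
  simp only [map_add, map_sum, inner_add_left, inner_add_right, sum_inner, inner_sum,
    partialInner_oscS, inner_partialInner_oscS, commForm, interForm, Finset.sum_sub_distrib]
  ring

theorem continuous_commForm (h : k ≤ N) (f g : 𝓢(Conf k, ℂ)) :
    Continuous (commForm V ω β h f g) := by
  unfold commForm interForm
  fun_prop

/-- A crude bound, usually depending on `N` through `‖W‖`. It supplies the domination in the
approximation by the domain, and it suffices for pairs inside the marginal. -/
theorem norm_interForm_le_norm (h : k ≤ N) (f g : L2 k) (W : L2 N →L[ℂ] L2 N) (ψ : L2 N) :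
    ‖interForm h f g W ψ‖ ≤ 2 * ‖f‖ * ‖g‖ * ‖W‖ * ‖ψ‖ ^ 2 := by
  have h1 := norm_partialInner_le h f ψ
  have h2 := norm_partialInner_le h g ψ
  have h3 := (norm_partialInner_le h f (W ψ)).trans
    (mul_le_mul_of_nonneg_left (W.le_opNorm ψ) (norm_nonneg _))
  have h4 := (norm_partialInner_le h g (W ψ)).trans
    (mul_le_mul_of_nonneg_left (W.le_opNorm ψ) (norm_nonneg _))
  calc ‖interForm h f g W ψ‖
      ≤ (‖f‖ * (‖W‖ * ‖ψ‖)) * (‖g‖ * ‖ψ‖) + (‖f‖ * ‖ψ‖) * (‖g‖ * (‖W‖ * ‖ψ‖)) := by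
        refine (norm_sub_le _ _).trans (add_le_add ?_ ?_)
        · exact (norm_inner_le_norm _ _).trans
            (mul_le_mul h3 h2 (norm_nonneg _) (by positivity))
        · exact (norm_inner_le_norm _ _).trans
            (mul_le_mul h1 h4 (norm_nonneg _) (by positivity))
    _ = _ := by ring

/-- The bound of the one-particle part of the commutator. -/
def oscBound (ω : ℝ) (f g : 𝓢(Conf k, ℂ)) : ℝ :=
  ∑ i, (‖toL2 (oscS ω i f)‖ * ‖toL2 g‖ + ‖toL2 f‖ * ‖toL2 (oscS ω i g)‖)

theorem norm_commForm_le (h : k ≤ N) (f g : 𝓢(Conf k, ℂ)) (ψ : L2 N) :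
    ‖commForm V ω β h f g ψ‖ ≤ oscBound ω f g * ‖ψ‖ ^ 2 +
      ‖interForm h (toL2 f) (toL2 g) (interOp V β N) ψ‖ := by
  refine (norm_add_le _ _).trans (add_le_add_left ?_ _)
  rw [oscBound, Finset.sum_mul]
  refine (norm_sum_le _ _).trans (Finset.sum_le_sum fun i _ => (norm_sub_le _ _).trans ?_)
  have h1 : ∀ a b : L2 k, ‖inner ℂ (partialInner h a ψ) (partialInner h b ψ)‖ ≤
      ‖a‖ * ‖b‖ * ‖ψ‖ ^ 2 := fun a b =>
    ((norm_inner_le_norm _ _).trans (mul_le_mul (norm_partialInner_le h a ψ)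
      (norm_partialInner_le h b ψ) (norm_nonneg _) (by positivity))).trans_eq (by ring)
  rw [add_mul]
  exact add_le_add (h1 _ _) (h1 _ _)

/-- Both sides are continuous in the pair `p`, so the identity extends from the graph on Schwartz
functions to its closure. -/
theorem commForm_generatorGraph {U : ℝ → (L2 N →L[ℂ] L2 N)} (hU : IsEvolution V ω β N U)
    (h : k ≤ N) (f g : 𝓢(Conf k, ℂ)) {p : L2 N × L2 N} (hp : p ∈ generatorGraph U) :
    inner ℂ (partialInner h (toL2 f) p.2) (partialInner h (toL2 g) p.1) -
      inner ℂ (partialInner h (toL2 f) p.1) (partialInner h (toL2 g) p.2) =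
      commForm V ω β h f g p.1 := by
  have hc : IsClosed {p : L2 N × L2 N |
      inner ℂ (partialInner h (toL2 f) p.2) (partialInner h (toL2 g) p.1) -
      inner ℂ (partialInner h (toL2 f) p.1) (partialInner h (toL2 g) p.2) =
      commForm V ω β h f g p.1} :=
    isClosed_eq (by fun_prop) ((continuous_commForm h f g).comp continuous_fst)
  rw [hU.generatorGraph_eq] at hp
  refine closure_minimal ?_ hc hp
  rw [hamiltonianGraph_eq]
  rintro _ ⟨φ, rfl⟩
  exact commForm_schwartz h f g φ

/-- On the domain this is the fundamental theorem of calculus. For general `ψ` one approximates by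
vectors in the domain; unitarity and the quadratic bound on `Q` give domination on the time
interval, without any derivative at `ψ` itself. -/
theorem sub_eq_integral_of_generatorGraph {H : Type*} [NormedAddCommGroup H]
    [InnerProductSpace ℂ H] {U : ℝ → (H →L[ℂ] H)} (hU : IsUnitaryGroup U)
    (hcont : ∀ f, Continuous fun t => U t f) (hdense : Dense (Prod.fst '' generatorGraph U))
    {q Q : H → ℂ} (hq : Continuous q) (hQ : Continuous Q) {K : ℝ} (hK : ∀ ψ, ‖Q ψ‖ ≤ K * ‖ψ‖ ^ 2)
    (hd : ∀ p ∈ generatorGraph U, ∀ t, HasDerivAt (fun t : ℝ => q (U t p.1)) (Q (U t p.1)) t)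
    (ψ : H) (s t : ℝ) : q (U t ψ) - q (U s ψ) = ∫ r in s..t, Q (U r ψ) := by
  obtain ⟨u, hu, hlim⟩ := mem_closure_iff_seq_limit.1 (hdense ψ)
  have h1 : ∀ n, q (U t (u n)) - q (U s (u n)) = ∫ r in s..t, Q (U r (u n)) := by
    intro n
    obtain ⟨p, hp, hpu⟩ := hu n
    rw [← hpu]
    exact (intervalIntegral.integral_eq_sub_of_hasDerivAt (fun r _ => hd p hp r)
      ((hQ.comp (hcont _)).intervalIntegrable _ _)).symm
  have h2 : ∀ r, Tendsto (fun n => U r (u n)) atTop (𝓝 (U r ψ)) := fun r =>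
    ((U r).continuous.tendsto ψ).comp hlim
  have h3 : Tendsto (fun n => q (U t (u n)) - q (U s (u n))) atTop (𝓝 (q (U t ψ) - q (U s ψ))) :=
    ((hq.tendsto _).comp (h2 t)).sub ((hq.tendsto _).comp (h2 s))
  obtain ⟨R, hR⟩ := (hlim.norm.bddAbove_range)
  have hR' : ∀ n, ‖u n‖ ≤ R := fun n => hR ⟨n, rfl⟩
  have h4 : Tendsto (fun n => ∫ r in s..t, Q (U r (u n))) atTop (𝓝 (∫ r in s..t, Q (U r ψ))) := by
    refine intervalIntegral.tendsto_integral_filter_of_dominated_convergence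
      (fun _ => |K| * R ^ 2) (Eventually.of_forall fun n =>
        (hQ.comp (hcont _)).aestronglyMeasurable) (Eventually.of_forall fun n =>
        Eventually.of_forall fun r _ => ?_) (by simp)
      (Eventually.of_forall fun r _ => (hQ.tendsto _).comp (h2 r))
    refine (hK _).trans ?_
    rw [hU.isometry]
    exact mul_le_mul (le_abs_self K) (pow_le_pow_left₀ (norm_nonneg _) (hR' n) 2) (by positivity)
      (abs_nonneg K)
  exact tendsto_nhds_unique (h3.congr h1) h4

/-- The matrix elements of the marginal density are Lipschitz in time as soon as the commutator
form is bounded along the evolution. -/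
theorem norm_inner_marginalOp_sub_le {U : ℝ → (L2 N →L[ℂ] L2 N)} (hU : IsEvolution V ω β N U)
    (h : k ≤ N) (f g : 𝓢(Conf k, ℂ)) (ψ : L2 N) {s t C : ℝ}
    (hC : ∀ r ∈ Set.uIcc s t, ‖commForm V ω β h f g (U r ψ)‖ ≤ C) :
    ‖inner ℂ (toL2 g) (marginalOp h (U t ψ) (toL2 f)) -
      inner ℂ (toL2 g) (marginalOp h (U s ψ) (toL2 f))‖ ≤ C * |t - s| := by
  have key := sub_eq_integral_of_generatorGraph hU.isUnitaryGroup hU.continuous hU.dense_domain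
    (q := fun ψ => inner ℂ (partialInner h (toL2 f) ψ) (partialInner h (toL2 g) ψ))
    (Q := fun ψ => Complex.I * commForm V ω β h f g ψ) (by fun_prop)
    (continuous_const.mul (continuous_commForm h f g))
    -- This constant depends on `N`, which is harmless: it serves only the dominated convergence.
    -- The Lipschitz constant is the hypothesis `hC` along the given trajectory.
    (K := oscBound ω f g + 2 * ‖toL2 f‖ * ‖toL2 g‖ * ‖interOp V β N‖) (fun ψ => by
      rw [norm_mul, Complex.norm_I, one_mul, add_mul]
      exact (norm_commForm_le h f g ψ).trans
        (add_le_add_right (norm_interForm_le_norm h _ _ _ ψ) _)) (fun p hp t => by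
      have h1 := hU.isUnitaryGroup.hasDerivAt hp t
      have h2 := ((partialInner h (toL2 f)).restrictScalars ℝ).hasFDerivAt.comp_hasDerivAt t h1
      have h3 := ((partialInner h (toL2 g)).restrictScalars ℝ).hasFDerivAt.comp_hasDerivAt t h1
      refine (HasDerivAt.inner ℂ h2 h3).congr_deriv ?_
      have h4 := commForm_generatorGraph hU h f g (hU.isUnitaryGroup.map_mem_generatorGraph hp t)
      simp only at h4
      rw [← h4]
      simp only [Function.comp_apply, ContinuousLinearMap.coe_restrictScalars', map_smul,
        inner_smul_left, inner_smul_right, map_neg, Complex.conj_I]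
      ring) ψ s t
  rw [inner_marginalOp, inner_marginalOp, key]
  refine intervalIntegral.norm_integral_le_of_norm_le_const fun r hr => ?_
  rw [norm_mul, Complex.norm_I, one_mul]
  exact hC r (Set.uIoc_subset_uIcc hr)

end Commutator

/-! ### A trace inequality -/

section TraceInequality

open LineDeriv ENNReal

/-- One-dimensional Sobolev inequality: `|φ(x)|²` is the integral of its derivative from `-∞`, and
that derivative is at most `|φ|² + |φ'|²`. -/
theorem norm_sq_le_integral_schwartz (φ : 𝓢(ℝ, ℂ)) (x : ℝ) :
    ‖φ x‖ₑ ^ 2 ≤ ∫⁻ t, (‖φ t‖ₑ ^ 2 + ‖(∂_{(1 : ℝ)} φ : 𝓢(ℝ, ℂ)) t‖ₑ ^ 2) := by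
  obtain ⟨φ', hφ'⟩ : ∃ φ' : 𝓢(ℝ, ℂ), φ' = ∂_{(1 : ℝ)} φ := ⟨_, rfl⟩
  rw [← hφ']
  have h1 : ∀ t, HasDerivAt (fun t => ‖φ t‖ ^ 2) (2 * inner ℝ (φ t) (φ' t)) t := by
    intro t
    have h2 : HasDerivAt φ (φ' t) t := by
      rw [hφ', SchwartzMap.lineDerivOp_apply_eq_fderiv]
      exact φ.differentiableAt.hasFDerivAt.hasDerivAt
    exact h2.norm_sq
  have i1 : Integrable (fun t => ‖φ t‖ ^ 2) :=
    (memLp_two_iff_integrable_sq_norm φ.continuous.aestronglyMeasurable).1 (φ.memLp 2 volume)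
  have i2 : Integrable (fun t => ‖φ' t‖ ^ 2) :=
    (memLp_two_iff_integrable_sq_norm φ'.continuous.aestronglyMeasurable).1 (φ'.memLp 2 volume)
  have hle : ∀ t, ‖2 * inner ℝ (φ t) (φ' t)‖ ≤ ‖φ t‖ ^ 2 + ‖φ' t‖ ^ 2 := by
    intro t
    rw [norm_mul, Real.norm_ofNat]
    have := norm_inner_le_norm (𝕜 := ℝ) (φ t) (φ' t)
    nlinarith [sq_nonneg (‖φ t‖ - ‖φ' t‖)]
  have i12 : Integrable (fun t => ‖φ t‖ ^ 2 + ‖φ' t‖ ^ 2) := i1.add i2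
  have i3 : Integrable (fun t => 2 * inner ℝ (φ t) (φ' t)) :=
    i12.mono' (by fun_prop) (Eventually.of_forall hle)
  have hlim : Tendsto (fun t => ‖φ t‖ ^ 2) atBot (𝓝 0) := by
    have h3 : Tendsto φ (cocompact ℝ) (𝓝 0) := φ.toZeroAtInfty.zero_at_infty'
    have h4 := ((h3.mono_left atBot_le_cocompact).norm).pow 2
    simpa using h4
  have h5 := integral_Iic_of_hasDerivAt_of_tendsto' (a := x) (fun t _ => h1 t) i3.integrableOn hlim
  rw [sub_zero] at h5
  have h6 : ‖φ x‖ ^ 2 ≤ ∫ t, (‖φ t‖ ^ 2 + ‖φ' t‖ ^ 2) := by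
    rw [← h5]
    calc ∫ t in Set.Iic x, 2 * inner ℝ (φ t) (φ' t)
        ≤ ∫ t in Set.Iic x, (‖φ t‖ ^ 2 + ‖φ' t‖ ^ 2) :=
          integral_mono i3.integrableOn i12.integrableOn
            fun t => (le_abs_self _).trans (hle t)
      _ ≤ _ := setIntegral_le_integral i12 (Eventually.of_forall fun t => by positivity)
  have h7 := ENNReal.ofReal_le_ofReal h6
  rw [ofReal_integral_eq_lintegral_ofReal i12 (Eventually.of_forall fun t => by positivity),
    ENNReal.ofReal_pow (norm_nonneg _), ofReal_norm] at h7
  refine h7.trans_eq (lintegral_congr fun t => ?_)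
  rw [ENNReal.ofReal_add (by positivity) (by positivity), ENNReal.ofReal_pow (norm_nonneg _),
    ENNReal.ofReal_pow (norm_nonneg _), ofReal_norm, ofReal_norm]

/-- Apply the one-dimensional inequality on the line through `x` in direction `v`, integrate against
`W`, and translate so that the line integral falls on `W`. Only the `L¹` norms of `W` on lines
enter, not its supremum. -/
theorem lintegral_mul_enorm_sq_le {n : ℕ} (φ : 𝓢(Conf n, ℂ)) {v : Conf n} (hv : ‖v‖ = 1)
    {W : Conf n → ℝ≥0∞} (hW : Measurable W) {B : ℝ≥0∞}
    (hB : ∀ x, ∫⁻ t : ℝ, W (-(t • v) + x) ≤ B) :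
    ∫⁻ x, W x * ‖φ x‖ₑ ^ 2 ≤
      B * ∫⁻ x, (‖φ x‖ₑ ^ 2 + ‖(∂_{v} φ : 𝓢(Conf n, ℂ)) x‖ₑ ^ 2) := by
  obtain ⟨Q, hQ⟩ : ∃ Q : Conf n → ℝ≥0∞,
      Q = fun x => ‖φ x‖ₑ ^ 2 + ‖(∂_{v} φ : 𝓢(Conf n, ℂ)) x‖ₑ ^ 2 := ⟨_, rfl⟩
  have hQm : Measurable Q := by
    rw [hQ]
    exact (φ.continuous.enorm.measurable.pow_const 2).add
      ((∂_{v} φ : 𝓢(Conf n, ℂ)).continuous.enorm.measurable.pow_const 2)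
  have hpt : ∀ x, ‖φ x‖ₑ ^ 2 ≤ ∫⁻ t : ℝ, Q (t • v + x) := by
    intro x
    obtain ⟨L, hL⟩ : ∃ L : ℝ →ₗᵢ[ℝ] Conf n, ∀ t, L t = t • v :=
      ⟨LinearIsometry.toSpanSingleton ℝ (Conf n) hv, fun t => by simp⟩
    have h1 := norm_sq_le_integral_schwartz (sliceS L x φ) 0
    rw [lineDerivOp_sliceS] at h1
    simp only [sliceS_apply, hL, zero_smul, zero_add, one_smul] at h1
    rw [hQ]
    exact h1
  calc ∫⁻ x, W x * ‖φ x‖ₑ ^ 2 ≤ ∫⁻ x, ∫⁻ t : ℝ, W x * Q (t • v + x) := by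
        refine lintegral_mono fun x => ?_
        rw [lintegral_const_mul (W x) (f := fun t : ℝ => Q (t • v + x)) (hQm.comp (by fun_prop))]
        exact mul_le_mul_right (hpt x) _
    _ = ∫⁻ t : ℝ, ∫⁻ x, W x * Q (t • v + x) := by
        refine lintegral_lintegral_swap (Measurable.aemeasurable ?_)
        exact (hW.comp measurable_fst).mul (hQm.comp (by fun_prop))
    _ = ∫⁻ t : ℝ, ∫⁻ x, W (-(t • v) + x) * Q x := by
        refine lintegral_congr fun t => ?_
        rw [← lintegral_add_left_eq_self (fun x => W (-(t • v) + x) * Q x) (t • v)]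
        simp only [neg_add_cancel_left]
    _ = ∫⁻ x, ∫⁻ t : ℝ, W (-(t • v) + x) * Q x := by
        refine lintegral_lintegral_swap (Measurable.aemeasurable ?_)
        exact (hW.comp (by fun_prop)).mul (hQm.comp measurable_snd)
    _ ≤ ∫⁻ x, B * Q x := by
        refine lintegral_mono fun x => ?_
        rw [lintegral_mul_const (Q x) (f := fun t : ℝ => W (-(t • v) + x)) (hW.comp (by fun_prop))]
        exact mul_le_mul_left (hB x) _
    _ = _ := by rw [lintegral_const_mul _ hQm, hQ]

end TraceInequality

/-! ### The Fourier multiplier of `(L⁽ᵏ⁾)⁻¹` -/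

section Multiplier

variable {k : ℕ}

open LineDeriv

/-- The symbol of `L⁽ᵏ⁾`. -/
def symbolL (k : ℕ) (ξ : Conf k) : ℝ := ∏ j, √(1 + (2 * Real.pi * ξ j) ^ 2)

theorem one_le_symbolL (ξ : Conf k) : 1 ≤ symbolL k ξ :=
  Finset.one_le_prod fun j _ => Real.one_le_sqrt.2 (by nlinarith [sq_nonneg (2 * Real.pi * ξ j)])

theorem symbolL_pos (ξ : Conf k) : 0 < symbolL k ξ := one_pos.trans_le (one_le_symbolL ξ)

/-- This makes `(L⁽ᵏ⁾)⁻¹` preserve Schwartz functions, for which the trace inequality is available.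
-/
theorem hasTemperateGrowth_inv_symbolL :
    Function.HasTemperateGrowth fun ξ : Conf k => (symbolL k ξ)⁻¹ := by
  have h1 : ∀ j : Fin k, Function.HasTemperateGrowth
      fun ξ : Conf k => (√(1 + (2 * Real.pi * ξ j) ^ 2))⁻¹ := by
    intro j
    have h2 := (Function.hasTemperateGrowth_one_add_norm_sq_rpow ℝ (-(1 / 2))).comp
      (f := fun ξ : Conf k => 2 * Real.pi * ξ j)
      ((Function.HasTemperateGrowth.const _).mul (hasTemperateGrowth_coord j))
    convert! h2 using 1
    funext ξ
    simp only [Function.comp_apply, Real.norm_eq_abs, sq_abs]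
    rw [Real.rpow_neg (by positivity), Real.sqrt_eq_rpow]
  have h3 : ∀ s : Finset (Fin k), Function.HasTemperateGrowth
      fun ξ : Conf k => ∏ j ∈ s, (√(1 + (2 * Real.pi * ξ j) ^ 2))⁻¹ := by
    classical
    intro s
    induction s using Finset.induction_on with
    | empty => simp
    | insert a s ha ih =>
      simp only [Finset.prod_insert ha]
      exact (h1 a).mul ih
  convert! h3 Finset.univ using 1
  funext ξ
  rw [symbolL, Finset.prod_inv_distrib]

theorem measurable_inv_symbolL : Measurable fun ξ : Conf k => (((symbolL k ξ)⁻¹ : ℝ) : ℂ) := by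
  have h := (hasTemperateGrowth_inv_symbolL (k := k)).1.continuous
  exact (Complex.continuous_ofReal.comp h).measurable

theorem norm_inv_symbolL_le (ξ : Conf k) : ‖(((symbolL k ξ)⁻¹ : ℝ) : ℂ)‖ ≤ 1 := by
  rw [Complex.norm_real, Real.norm_eq_abs, abs_of_pos (inv_pos.2 (symbolL_pos ξ))]
  exact inv_le_one_of_one_le₀ (one_le_symbolL ξ)

/-- The operator `(L⁽ᵏ⁾)⁻¹`. -/
def invL (k : ℕ) : L2 k →L[ℂ] L2 k :=
  ((Lp.fourierTransformₗᵢ (Conf k) ℂ).symm.toContinuousLinearEquiv : L2 k →L[ℂ] L2 k).comp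
    ((mulOp measurable_inv_symbolL norm_inv_symbolL_le).comp
      ((Lp.fourierTransformₗᵢ (Conf k) ℂ).toContinuousLinearEquiv : L2 k →L[ℂ] L2 k))

theorem fourier_invL (f : L2 k) :
    (𝓕 (invL k f) : L2 k) = mulOp measurable_inv_symbolL norm_inv_symbolL_le (𝓕 f : L2 k) :=
  (Lp.fourierTransformₗᵢ (Conf k) ℂ).apply_symm_apply _

theorem fourier_injective {f g : L2 k} (h : (𝓕 f : L2 k) = 𝓕 g) : f = g :=
  (Lp.fourierTransformₗᵢ (Conf k) ℂ).injective h

/-- The symbol is at least one, so its reciprocal is a bounded multiplier. Statements about the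
unbounded `L⁽ᵏ⁾` thereby become statements about the bounded operator `invL k`. -/
theorem lMaps_iff (f g : L2 k) : LMaps f g ↔ f = invL k g := by
  have h1 := coeFn_mulOp (measurable_inv_symbolL (k := k)) norm_inv_symbolL_le (𝓕 g : L2 k)
  have hne : ∀ ξ : Conf k, ((symbolL k ξ : ℝ) : ℂ) ≠ 0 := fun ξ =>
    Complex.ofReal_ne_zero.2 (symbolL_pos ξ).ne'
  constructor
  · intro h
    refine fourier_injective ?_
    rw [fourier_invL]
    refine Lp.ext ?_
    filter_upwards [h, h1] with ξ h2 h3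
    rw [h3, h2, ← symbolL, Complex.ofReal_inv, inv_mul_cancel_left₀ (hne ξ)]
  · rintro rfl
    rw [← fourier_invL] at h1
    filter_upwards [h1] with ξ h3
    rw [h3, ← symbolL, Complex.ofReal_inv, mul_inv_cancel_left₀ (hne ξ)]

theorem inner_invL (f g : L2 k) : inner ℂ (invL k f) g = inner ℂ f (invL k g) := by
  rw [← Lp.inner_fourier_eq, ← Lp.inner_fourier_eq f, fourier_invL, fourier_invL]
  exact inner_mulOp_left _ _ (fun _ => Complex.conj_ofReal _) _ _

theorem adjoint_invL : (invL k).adjoint = invL k :=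
  ((ContinuousLinearMap.eq_adjoint_iff _ _).2 inner_invL).symm

theorem invL_injective : Function.Injective (invL k) := by
  intro f g h
  have h1 := (lMaps_iff _ f).2 rfl
  have h2 := (lMaps_iff _ g).2 rfl
  rw [h] at h1
  refine fourier_injective (Lp.ext ?_)
  filter_upwards [h1, h2] with ξ h3 h4
  rw [h3, h4]

/-- The orthogonal complement of the range is the kernel of the adjoint, which is trivial since
`invL k` is self-adjoint and injective. -/
theorem dense_range_invL : Dense (Set.range (invL k)) := by
  have h1 : ((invL k).range).topologicalClosure = ⊤ := by
    rw [Submodule.topologicalClosure_eq_top_iff, ContinuousLinearMap.orthogonal_range, adjoint_invL]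
    exact LinearMap.ker_eq_bot.2 invL_injective
  exact Submodule.dense_iff_topologicalClosure_eq_top.2 h1

/-- `(L⁽ᵏ⁾)⁻¹` on Schwartz functions. -/
def invLS (φ : 𝓢(Conf k, ℂ)) : 𝓢(Conf k, ℂ) := 𝓕⁻ (mulS (fun ξ => (symbolL k ξ)⁻¹) (𝓕 φ))

theorem toL2_fourier (φ : 𝓢(Conf k, ℂ)) : toL2 (𝓕 φ) = 𝓕 (toL2 φ) :=
  (SchwartzMap.toLp_fourier_eq φ).symm

theorem fourier_invLS (φ : 𝓢(Conf k, ℂ)) :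
    𝓕 (invLS φ) = mulS (fun ξ => (symbolL k ξ)⁻¹) (𝓕 φ) := FourierTransform.fourier_fourierInv_eq _

theorem toL2_invLS (φ : 𝓢(Conf k, ℂ)) : toL2 (invLS φ) = invL k (toL2 φ) := by
  refine fourier_injective ?_
  rw [← toL2_fourier, fourier_invLS, fourier_invL, ← toL2_fourier]
  refine Lp.ext ?_
  filter_upwards [coeFn_toL2 (mulS (fun ξ => (symbolL k ξ)⁻¹) (𝓕 φ)), coeFn_toL2 (𝓕 φ),
    coeFn_mulOp (measurable_inv_symbolL (k := k)) norm_inv_symbolL_le (toL2 (𝓕 φ))] with ξ h1 h2 h3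
  rw [h1, h3, h2, mulS_apply hasTemperateGrowth_inv_symbolL]

theorem lintegral_enorm_toL2 (φ : 𝓢(Conf k, ℂ)) : ∫⁻ x, ‖φ x‖ₑ ^ 2 = ‖toL2 φ‖ₑ ^ 2 := by
  rw [enorm_sq_eq_lintegral]
  refine lintegral_congr_ae ?_
  filter_upwards [coeFn_toL2 φ] with x hx
  rw [hx]

theorem enorm_fourier (φ : 𝓢(Conf k, ℂ)) : ‖toL2 (𝓕 φ)‖ₑ = ‖toL2 φ‖ₑ := by
  rw [toL2_fourier, ← ofReal_norm, Lp.norm_fourier_eq, ofReal_norm]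

/-- By Plancherel it suffices that `1 + (2πξᵢ)²` is at most the square of the symbol, whose
remaining factors are all at least one. -/
theorem lintegral_invLS_le (φ : 𝓢(Conf k, ℂ)) (i : Fin k) :
    ∫⁻ x, (‖invLS φ x‖ₑ ^ 2 + ‖(∂_{unitVec i} (invLS φ) : 𝓢(Conf k, ℂ)) x‖ₑ ^ 2) ≤
      ‖toL2 φ‖ₑ ^ 2 := by
  have hm : Measurable fun x => ‖invLS φ x‖ₑ ^ 2 :=
    (invLS φ).continuous.enorm.measurable.pow_const 2
  rw [lintegral_add_left hm, lintegral_enorm_toL2, lintegral_enorm_toL2, ← enorm_fourier,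
    ← enorm_fourier (∂_{unitVec i} (invLS φ)), ← enorm_fourier φ, ← lintegral_enorm_toL2,
    ← lintegral_enorm_toL2, ← lintegral_enorm_toL2 (𝓕 φ),
    ← lintegral_add_left ((𝓕 (invLS φ)).continuous.enorm.measurable.pow_const 2)]
  refine lintegral_mono fun ξ => ?_
  have hg : Function.HasTemperateGrowth fun ξ : Conf k => inner ℝ ξ (unitVec i) :=
    Function.hasTemperateGrowth_inner_left _
  have hin : inner ℝ ξ (unitVec i) = ξ i := by
    rw [real_inner_comm]
    simp [unitVec, PiLp.inner_apply, PiLp.single_apply]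
  rw [SchwartzMap.fourier_lineDerivOp_eq, smul_apply, SchwartzMap.smulLeftCLM_apply_apply hg, hin,
    fourier_invLS, mulS_apply hasTemperateGrowth_inv_symbolL]
  simp only [← ofReal_norm]
  rw [← ENNReal.ofReal_pow (norm_nonneg _), ← ENNReal.ofReal_pow (norm_nonneg _),
    ← ENNReal.ofReal_pow (norm_nonneg _), ← ENNReal.ofReal_add (by positivity) (by positivity)]
  refine ENNReal.ofReal_le_ofReal ?_
  have h1 : 1 + (2 * Real.pi * ξ i) ^ 2 ≤ symbolL k ξ ^ 2 := by
    rw [symbolL, ← Finset.prod_pow]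
    have h2 : ∀ j : Fin k, √(1 + (2 * Real.pi * ξ j) ^ 2) ^ 2 = 1 + (2 * Real.pi * ξ j) ^ 2 :=
      fun j => Real.sq_sqrt (by positivity)
    simp only [h2]
    have h6 := Finset.prod_le_prod_of_subset_of_one_le
      (f := fun j => 1 + (2 * Real.pi * ξ j) ^ 2) (Finset.subset_univ {i})
      (fun j _ => by positivity) (fun j _ _ => by nlinarith [sq_nonneg (2 * Real.pi * ξ j)])
    rwa [Finset.prod_singleton] at h6
  have hpos := symbolL_pos ξ
  have h3 : ‖(((symbolL k ξ)⁻¹ : ℝ) : ℂ) * (𝓕 φ) ξ‖ = (symbolL k ξ)⁻¹ * ‖(𝓕 φ) ξ‖ := by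
    rw [norm_mul, Complex.norm_real, Real.norm_eq_abs, abs_of_pos (inv_pos.2 hpos)]
  have h4 : ‖(2 * Real.pi * Complex.I : ℂ) • (ξ i • ((((symbolL k ξ)⁻¹ : ℝ) : ℂ) * (𝓕 φ) ξ))‖ =
      2 * Real.pi * |ξ i| * ((symbolL k ξ)⁻¹ * ‖(𝓕 φ) ξ‖) := by
    rw [norm_smul, norm_smul, h3]
    simp [abs_of_pos Real.pi_pos]
    ring
  rw [h4, h3]
  have h5 : ((symbolL k ξ)⁻¹ * ‖(𝓕 φ) ξ‖) ^ 2 +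
      (2 * Real.pi * |ξ i| * ((symbolL k ξ)⁻¹ * ‖(𝓕 φ) ξ‖)) ^ 2 =
      (1 + (2 * Real.pi * ξ i) ^ 2) * ((symbolL k ξ ^ 2)⁻¹ * ‖(𝓕 φ) ξ‖ ^ 2) := by
    have : |ξ i| ^ 2 = ξ i ^ 2 := sq_abs _
    rw [mul_pow (2 * Real.pi * |ξ i|), mul_pow (2 * Real.pi) |ξ i|, this, mul_pow (symbolL k ξ)⁻¹, inv_pow]
    ring
  rw [h5]
  calc _ ≤ symbolL k ξ ^ 2 * ((symbolL k ξ ^ 2)⁻¹ * ‖(𝓕 φ) ξ‖ ^ 2) := by gcongr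
    _ = _ := by rw [mul_inv_cancel_left₀ (by positivity)]

end Multiplier

/-! ### Consequences of the energy bound -/

section Energy

variable {N k : ℕ}

open LineDeriv ENNReal NNReal

/-- Inverting `L⁽ᵏ⁾` gives `u = M B M` with `M` self-adjoint. Since `⟨M g, B M g⟩ = ⟨g, u g⟩ ≥ 0`
and `M` has dense range, `B` is nonnegative by continuity. -/
theorem EnergyAtMost.exists_isPosTrace {u : L2 k →L[ℂ] L2 k} {c : ℝ} (hu : u.IsPositive)
    (h : EnergyAtMost u c) :
    ∃ B, IsPosTrace B c ∧ u = (invL k).comp (B.comp (invL k)) := by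
  obtain ⟨B, hB, hmap, hc⟩ := h
  have h1 : ∀ g, u g = invL k (B (invL k g)) := fun g =>
    (lMaps_iff _ _).1 (hmap _ _ ((lMaps_iff _ g).2 rfl))
  refine ⟨B, ⟨?_, hB, hc⟩, ContinuousLinearMap.ext h1⟩
  rw [ContinuousLinearMap.isPositive_iff_complex]
  have h2 : ∀ x, inner ℂ (B x) x = ((inner ℂ (B x) x).re : ℂ) ∧ 0 ≤ (inner ℂ (B x) x).re := by
    have hc1 : Continuous fun x => inner ℂ (B x) x := by fun_prop
    have hcl : IsClosed {x | inner ℂ (B x) x = ((inner ℂ (B x) x).re : ℂ) ∧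
        0 ≤ (inner ℂ (B x) x).re} :=
      (isClosed_eq hc1 (Complex.continuous_ofReal.comp (Complex.continuous_re.comp hc1))).inter
        (isClosed_le continuous_const (Complex.continuous_re.comp hc1))
    refine fun x => closure_minimal ?_ hcl (dense_range_invL x)
    rintro _ ⟨g, rfl⟩
    have h3 := (ContinuousLinearMap.isPositive_iff_complex u).1 hu g
    rw [h1, inner_invL] at h3
    exact ⟨h3.1.symm, h3.2⟩
  exact fun x => ⟨(h2 x).1.symm, (h2 x).2⟩

theorem IsPosTrace.energyAtMost {B : L2 k →L[ℂ] L2 k} {c : ℝ} (hB : IsPosTrace B c) :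
    EnergyAtMost ((invL k).comp (B.comp (invL k))) c := by
  refine ⟨B, hB.isTraceClass, fun f g hfg => ?_, hB.trace_le⟩
  rw [lMaps_iff] at hfg ⊢
  rw [hfg]
  rfl

/-- The trace inequality and Plancherel give this for Schwartz `h`, and density gives the rest. The
operator norm of `A M` is thus bounded through line integrals of `|a|²`; the supremum `K` plays no
role in the constant. -/
theorem enorm_mulOp_invL_le {a : Conf k → ℂ} (ha : Measurable a) {K : ℝ} (hK : ∀ x, ‖a x‖ ≤ K)
    (i : Fin k) {D : ℝ≥0} (hD : ∀ x, ∫⁻ t : ℝ, ‖a (-(t • unitVec i) + x)‖ₑ ^ 2 ≤ D) (h : L2 k) :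
    ‖mulOp ha hK (invL k h)‖ₑ ^ 2 ≤ D * ‖h‖ₑ ^ 2 := by
  have key : ∀ h : L2 k, ‖mulOp ha hK (invL k h)‖₊ ^ 2 ≤ D * ‖h‖₊ ^ 2 := by
    intro h
    have hcl : IsClosed {h : L2 k | ‖mulOp ha hK (invL k h)‖₊ ^ 2 ≤ D * ‖h‖₊ ^ 2} :=
      isClosed_le (by fun_prop) (by fun_prop)
    refine closure_minimal ?_ hcl (dense_schwartz h)
    rintro _ ⟨φ, rfl⟩
    change ‖mulOp ha hK (invL k (toL2 φ))‖₊ ^ 2 ≤ D * ‖toL2 φ‖₊ ^ 2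
    have h1 : ‖mulOp ha hK (invL k (toL2 φ))‖ₑ ^ 2 ≤ D * ‖toL2 φ‖ₑ ^ 2 := by
      have hv : ‖unitVec i‖ = 1 := (EuclideanSpace.basisFun (Fin k) ℝ).orthonormal.1 i
      have h2 := (lintegral_mul_enorm_sq_le (invLS φ) hv (ha.enorm.pow_const 2) hD).trans
        (mul_le_mul_right (lintegral_invLS_le φ i) _)
      refine le_trans (le_of_eq ?_) h2
      rw [← toL2_invLS, enorm_sq_eq_lintegral]
      refine lintegral_congr_ae ?_
      filter_upwards [coeFn_mulOp ha hK (toL2 (invLS φ)), coeFn_toL2 (invLS φ)] with x h3 h4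
      rw [h3, h4, enorm_mul, mul_pow]
    simp only [enorm_eq_nnnorm] at h1
    exact_mod_cast h1
  simp only [enorm_eq_nnnorm]
  exact_mod_cast key h

theorem halfDensity_mulOp (h : k ≤ N) {a : Conf k → ℝ} {K K' : ℝ}
    (ha : Measurable fun x => (a x : ℂ)) (hK : ∀ x, ‖(a x : ℂ)‖ ≤ K) {a' : Conf N → ℝ}
    (ha' : Measurable fun x => (a' x : ℂ)) (hK' : ∀ x, ‖(a' x : ℂ)‖ ≤ K')
    (he : ∀ x (z : Conf (N - k)), a' (join x z) = a x) (ψ : L2 N) (f : L2 k) :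
    halfDensity (splitL h (mulOp ha' hK' ψ)) f = halfDensity (splitL h ψ) (mulOp ha hK f) := by
  refine Lp.ext ?_
  have hswap : ∀ {P : Conf k × Conf (N - k) → Prop},
      (∀ᵐ p ∂((volume : Measure (Conf k)).prod (volume : Measure (Conf (N - k)))), P p) →
      ∀ᵐ z : Conf (N - k), ∀ᵐ x : Conf k, P (x, z) := fun hP =>
    Measure.ae_ae_of_ae_prod
      (Measure.measurePreserving_swap.quasiMeasurePreserving.ae hP)
  have hs : ∀ᵐ p ∂((volume : Measure (Conf k)).prod (volume : Measure (Conf (N - k)))),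
      splitL h (mulOp ha' hK' ψ) p = (a p.1 : ℂ) * splitL h ψ p := by
    filter_upwards [coeFn_splitL h (mulOp ha' hK' ψ), coeFn_splitL h ψ,
      (measurePreserving_joinEquiv h).quasiMeasurePreserving.ae (coeFn_mulOp ha' hK' ψ)]
      with p h1 h2 h3
    rw [joinEquiv_apply] at h3
    rw [h1, h3, h2, he]
  filter_upwards [coeFn_halfDensity (splitL h (mulOp ha' hK' ψ)) f,
    coeFn_halfDensity (splitL h ψ) (mulOp ha hK f), hswap hs] with z h1 h2 h3
  rw [h1, h2]
  refine integral_congr_ae ?_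
  filter_upwards [h3, coeFn_mulOp ha hK f] with x h4 h5
  rw [h4, h5, map_mul, Complex.conj_ofReal]
  ring

/-- Carrying a multiplier through the dilation rescales its argument, which is why the line
integrals in `lintegral_weight_le` involve `a` at `s⁻¹ x`. -/
theorem mulOp_lensPull (ω τ : ℝ) {a : Conf k → ℝ} {K : ℝ}
    (ha : Measurable fun x => (a x : ℂ)) (hK : ∀ x, ‖(a x : ℂ)‖ ≤ K)
    (ha' : Measurable fun x => (a ((lensScale ω τ)⁻¹ • x) : ℂ))
    (hK' : ∀ x, ‖(a ((lensScale ω τ)⁻¹ • x) : ℂ)‖ ≤ K) (f : L2 k) :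
    mulOp ha hK (lensPull ω τ f) = lensPull ω τ (mulOp ha' hK' f) := by
  refine Lp.ext ?_
  have hs := lensScale_pos ω τ
  filter_upwards [coeFn_mulOp ha hK (lensPull ω τ f), coeFn_lensL hs (-(ω ^ 2 * τ)) f,
    coeFn_lensL hs (-(ω ^ 2 * τ)) (mulOp ha' hK' f),
    (quasiMeasurePreserving_smul hs).ae (coeFn_mulOp ha' hK' f)] with x h1 h2 h3 h4
  rw [h1, lensPull, h2, h3, lensFun, lensFun, h4, inv_smul_smul₀ hs.ne']
  ring

theorem norm_eq_of_gram {H K₁ K₂ : Type*} [NormedAddCommGroup H] [InnerProductSpace ℂ H]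
    [CompleteSpace H] [NormedAddCommGroup K₁] [InnerProductSpace ℂ K₁] [CompleteSpace K₁]
    [NormedAddCommGroup K₂] [InnerProductSpace ℂ K₂] [CompleteSpace K₂] {X : H →L[ℂ] K₁}
    {Y : H →L[ℂ] K₂} (h : X.adjoint.comp X = Y.adjoint.comp Y) (x : H) : ‖X x‖ = ‖Y x‖ := by
  rw [norm_eq_sqrt_re_inner (𝕜 := ℂ), norm_eq_sqrt_re_inner (𝕜 := ℂ),
    ← ContinuousLinearMap.adjoint_inner_right, ← ContinuousLinearMap.adjoint_inner_right,
    ← ContinuousLinearMap.comp_apply, h, ContinuousLinearMap.comp_apply]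

/-- If `X* X = M B M`, then `Tr |X A|² ≤ ‖A M‖² Tr B`. -/
theorem tsum_enorm_sq_le_of_gram {H K : Type*} [NormedAddCommGroup H] [InnerProductSpace ℂ H]
    [CompleteSpace H] [NormedAddCommGroup K] [InnerProductSpace ℂ K] [CompleteSpace K]
    {ι : Type*} (b : HilbertBasis ι ℂ H) {X : H →L[ℂ] K} {B M A : H →L[ℂ] H} {c : ℝ}
    (hB : IsPosTrace B c) (hM : M.adjoint = M) (hA : A.adjoint = A)
    (hX : X.adjoint.comp X = M.comp (B.comp M)) {D : ℝ≥0∞}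
    (hD : ∀ x, ‖A (M x)‖ₑ ^ 2 ≤ D * ‖x‖ₑ ^ 2) :
    ∑' i, ‖X (A (b i))‖ₑ ^ 2 ≤ D * ENNReal.ofReal c := by
  obtain ⟨S, hS, hSa⟩ := exists_gram hB.isPositive
  have h1 : X.adjoint.comp X = (S.comp M).adjoint.comp (S.comp M) := by
    rw [hX, ContinuousLinearMap.adjoint_comp, hM, ← hS]
    rfl
  have h2 : ∀ x, ‖X x‖ₑ = ‖S (M x)‖ₑ := fun x => by
    rw [← ofReal_norm, ← ofReal_norm, norm_eq_of_gram h1]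
    rfl
  calc ∑' i, ‖X (A (b i))‖ₑ ^ 2 = ∑' i, ‖((S.comp M).comp A) (b i)‖ₑ ^ 2 := by
        simp only [h2]
        rfl
    _ = ∑' i, ‖A (M (S (b i)))‖ₑ ^ 2 := by
        -- Passing to the adjoint turns `S M A` into `A M S`, so that the bounded operator `A M`
        -- stands on the left, acting on the vectors `S bᵢ`.
        rw [tsum_enorm_sq_adjoint b b, ContinuousLinearMap.adjoint_comp,
          ContinuousLinearMap.adjoint_comp, hM, hA, hSa]
        rfl
    _ ≤ ∑' i, D * ‖S (b i)‖ₑ ^ 2 := ENNReal.tsum_le_tsum fun i => hD _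
    _ = D * ENNReal.ofReal (opTrace B).re := by
        subst hS
        rw [ENNReal.tsum_mul_left, tsum_enorm_sq_eq_trace b hB.isTraceClass]
    _ ≤ _ := mul_le_mul_right (ENNReal.ofReal_le_ofReal hB.trace_le) _

theorem adjoint_mulOp {a : Conf k → ℝ} {K : ℝ}
    (ha : Measurable fun x => (a x : ℂ)) (hK : ∀ x, ‖(a x : ℂ)‖ ≤ K) :
    (mulOp (μ := volume) ha hK).adjoint = mulOp ha hK :=
  ((ContinuousLinearMap.eq_adjoint_iff _ _).2
    (inner_mulOp_left _ _ fun _ => Complex.conj_ofReal _)).symm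

/-- The weighted mass is `‖a' ψ‖²`, the squared Hilbert–Schmidt norm of the half density composed
with multiplication by `a`. The Gram identity `u = M B M` bounds it by `‖A M‖² Tr B`. -/
theorem lintegral_weight_le (h : k ≤ N) {ω τ c : ℝ} {U : ℝ → (L2 N →L[ℂ] L2 N)} {ψ₀ : L2 N}
    (hE : EnergyAtMost (lensMarginal ω U ψ₀ k τ) c) {a : Conf k → ℝ} (ha : Measurable a) {K : ℝ}
    (hK : ∀ x, ‖(a x : ℂ)‖ ≤ K) (i : Fin k) {D : ℝ≥0}
    (hD : ∀ x, ∫⁻ t : ℝ, ‖a ((lensScale ω τ)⁻¹ • (-(t • unitVec i) + x))‖ₑ ^ 2 ≤ D)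
    {a' : Conf N → ℝ} (ha' : Measurable a') (he : ∀ x (z : Conf (N - k)), a' (join x z) = a x) :
    ∫⁻ x, ‖a' x‖ₑ ^ 2 * ‖U (lensTimeInv ω τ) ψ₀ x‖ₑ ^ 2 ≤ D * ENNReal.ofReal c := by
  have hpos : (lensMarginal ω U ψ₀ k τ).IsPositive := by
    rw [lensMarginal_eq_gram h]
    exact ContinuousLinearMap.isPositive_adjoint_comp_self _
  obtain ⟨B, hB, hu⟩ := hE.exists_isPosTrace hpos
  rw [lensMarginal_eq_gram h] at hu
  obtain ⟨ψ, hψ⟩ : ∃ ψ, ψ = U (lensTimeInv ω τ) ψ₀ := ⟨_, rfl⟩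
  rw [← hψ] at hu ⊢
  have m1 : Measurable fun x => (a x : ℂ) := Complex.measurable_ofReal.comp ha
  have m2 : Measurable fun x => (a' x : ℂ) := Complex.measurable_ofReal.comp ha'
  have hK2 : ∀ x, ‖(a' x : ℂ)‖ ≤ K := fun x => by
    obtain ⟨p, rfl⟩ := (joinEquiv h).surjective x
    rw [joinEquiv_apply, he]
    exact hK _
  have m3 : Measurable fun x => (a ((lensScale ω τ)⁻¹ • x) : ℂ) :=
    m1.comp (measurable_const_smul _)
  have hK3 : ∀ x, ‖(a ((lensScale ω τ)⁻¹ • x) : ℂ)‖ ≤ K := fun x => hK _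
  have hD' : ∀ x, ‖mulOp m3 hK3 (invL k x)‖ₑ ^ 2 ≤ D * ‖x‖ₑ ^ 2 :=
    enorm_mulOp_invL_le m3 hK3 i fun x => by
      refine le_trans (le_of_eq ?_) (hD x)
      refine lintegral_congr fun t => ?_
      rw [← ofReal_norm, Complex.norm_real, ofReal_norm]
  have key := tsum_enorm_sq_le_of_gram (traceBasis (L2 k)) hB adjoint_invL
    (adjoint_mulOp m3 hK3) hu hD'
  refine le_trans (le_of_eq ?_) key
  have h1 := tsum_enorm_halfDensity_sq (traceBasis (L2 k)) (splitL h (mulOp m2 hK2 ψ))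
  simp only [halfDensity_mulOp h m1 hK m2 hK2 he] at h1
  have h2 := tsum_enorm_comp_lensPull (traceBasis (L2 k)) ω τ
    ((halfDensity (splitL h ψ)).comp (mulOp m1 hK))
  simp only [ContinuousLinearMap.comp_apply, mulOp_lensPull ω τ m1 hK m3 hK3] at h2
  have h3 : ‖splitL h (mulOp m2 hK2 ψ)‖ₑ = ‖mulOp m2 hK2 ψ‖ₑ := by
    rw [← ofReal_norm, LinearIsometry.norm_map, ofReal_norm]
  calc ∫⁻ x, ‖a' x‖ₑ ^ 2 * ‖ψ x‖ₑ ^ 2 = ‖mulOp m2 hK2 ψ‖ₑ ^ 2 := by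
        rw [enorm_sq_eq_lintegral]
        refine lintegral_congr_ae ?_
        filter_upwards [coeFn_mulOp m2 hK2 ψ] with x hx
        rw [hx, enorm_mul, mul_pow, ← ofReal_norm (a' x : ℂ), Complex.norm_real, ofReal_norm]
    _ = _ := by
        rw [← h3, ← h1, ← h2]
        rfl

end Energy

/-! ### The pair interaction in the energy space -/

section PairEnergy

variable {V : 𝓢(ℝ, ℝ)} {ω β : ℝ} {N : ℕ}

open ENNReal NNReal

/-- The `L¹` norm of the interaction. -/
def massV (V : 𝓢(ℝ, ℝ)) : ℝ := ∫ x, |V x|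

theorem massV_nonneg : 0 ≤ massV V := integral_nonneg fun _ => abs_nonneg _

/-- The scaling `N^β V(N^β ·)` preserves the `L¹` norm; this is the source of all bounds uniform in
`N`. Only the extra dilation `κ` changes the integral. -/
theorem lintegral_scaledV (hN : 1 ≤ N) {κ : ℝ} (hκ : 0 < κ) (c : ℝ) :
    ∫⁻ t : ℝ, ‖scaledV V β N (κ * (c - t))‖ₑ = ENNReal.ofReal (κ⁻¹ * massV V) := by
  have hpos : 0 < (N : ℝ) ^ β := Real.rpow_pos_of_pos (by exact_mod_cast hN) _
  have hVi : Integrable fun x => |V x| := V.integrable.abs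
  have h0 : (N : ℝ) ^ β * κ ≠ 0 := (mul_pos hpos hκ).ne'
  have h1 : Integrable fun t : ℝ => (N : ℝ) ^ β * |V (((N : ℝ) ^ β * κ) * (c - t))| :=
    ((hVi.comp_mul_left' h0).comp_sub_left c).const_mul _
  have h2 : ∫ t : ℝ, (N : ℝ) ^ β * |V (((N : ℝ) ^ β * κ) * (c - t))| = κ⁻¹ * massV V := by
    rw [integral_const_mul,
      integral_sub_left_eq_self (fun t => |V (((N : ℝ) ^ β * κ) * t)|) volume c,
      Measure.integral_comp_mul_left (fun t => |V t|), smul_eq_mul, massV,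
      abs_of_pos (inv_pos.2 (mul_pos hpos hκ))]
    field_simp
  rw [← h2, ofReal_integral_eq_lintegral_ofReal h1 (Eventually.of_forall fun t => by positivity)]
  refine lintegral_congr fun t => ?_
  rw [← ofReal_norm, scaledV, norm_mul, Real.norm_of_nonneg hpos.le, Real.norm_eq_abs, mul_assoc]

/-- The weight is `√|V_N(y₀ - y₁)|`, integrated along the first coordinate. The lens dilation
corresponds to `κ = s⁻¹`, hence the factor `lensScale ω τ`. -/
theorem lintegral_scaledV_first_le (h : 2 ≤ N) {τ c : ℝ} {U : ℝ → (L2 N →L[ℂ] L2 N)} {ψ₀ : L2 N}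
    (hE : EnergyAtMost (lensMarginal ω U ψ₀ 2 τ) c) :
    ∫⁻ x : Conf N, ‖scaledV V β N (x (joinIndex h (Sum.inl 0)) - x (joinIndex h (Sum.inl 1)))‖ₑ *
      ‖U (lensTimeInv ω τ) ψ₀ x‖ₑ ^ 2 ≤
        ENNReal.ofReal (lensScale ω τ * massV V) * ENNReal.ofReal c := by
  have hs := lensScale_pos ω τ
  have hsq : ∀ r : ℝ, ‖√|scaledV V β N r|‖ₑ ^ 2 = ‖scaledV V β N r‖ₑ := by
    intro r
    rw [← ofReal_norm, ← ofReal_norm, ← ENNReal.ofReal_pow (norm_nonneg _),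
      Real.norm_of_nonneg (Real.sqrt_nonneg _), Real.sq_sqrt (abs_nonneg _), Real.norm_eq_abs]
  have hm : Measurable fun r => √|scaledV V β N r| :=
    (Real.continuous_sqrt.measurable).comp measurable_scaledV.abs
  have key := lintegral_weight_le h hE (a := fun y => √|scaledV V β N (y 0 - y 1)|)
    (hm.comp (by fun_prop)) (K := √((N : ℝ) ^ β * boundV V)) (fun y => by
      rw [Complex.norm_real, Real.norm_of_nonneg (Real.sqrt_nonneg _)]
      exact Real.sqrt_le_sqrt (abs_scaledV_le _)) 0
    (D := (lensScale ω τ * massV V).toNNReal) (fun y => by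
      simp only [hsq]
      have h1 := lintegral_scaledV (V := V) (β := β) (one_le_two.trans h) (inv_pos.2 hs) (y 0 - y 1)
      rw [inv_inv] at h1
      refine le_of_eq (Eq.trans (lintegral_congr fun t => ?_) h1)
      congr 2
      simp [unitVec]
      ring)
    (a' := fun x => √|scaledV V β N (x (joinIndex h (Sum.inl 0)) - x (joinIndex h (Sum.inl 1)))|)
    (hm.comp (by fun_prop)) fun x z => by rw [join_inl h, join_inl h]
  simp only [hsq] at key
  exact key

theorem exists_perm_apply_eq {ι : Type*} [DecidableEq ι] {i j a b : ι} (hij : i ≠ j) (hab : a ≠ b) :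
    ∃ σ : Equiv.Perm ι, σ i = a ∧ σ j = b := by
  refine ⟨(Equiv.swap i a).trans (Equiv.swap (Equiv.swap i a j) b), ?_, ?_⟩
  · rw [Equiv.trans_apply, Equiv.swap_apply_left]
    refine Equiv.swap_apply_of_ne_of_ne (fun h => hij ?_) hab
    exact (Equiv.swap i a).injective ((Equiv.swap_apply_left i a).trans h)
  · rw [Equiv.trans_apply, Equiv.swap_apply_left]

/-- The interaction energy of any pair of particles in a symmetric state. -/
theorem lintegral_scaledV_pair_le (h : 2 ≤ N) {τ c : ℝ} {U : ℝ → (L2 N →L[ℂ] L2 N)} {ψ₀ : L2 N}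
    (hE : EnergyAtMost (lensMarginal ω U ψ₀ 2 τ) c)
    (hsymm : IsSymmetricState (U (lensTimeInv ω τ) ψ₀)) {i j : Fin N} (hij : i ≠ j) :
    ∫⁻ x : Conf N, ‖scaledV V β N (x i - x j)‖ₑ * ‖U (lensTimeInv ω τ) ψ₀ x‖ₑ ^ 2 ≤
        ENNReal.ofReal (lensScale ω τ * massV V) * ENNReal.ofReal c := by
  refine le_trans (le_of_eq ?_) (lintegral_scaledV_first_le (V := V) (β := β) h hE)
  obtain ⟨σ, hσi, hσj⟩ := exists_perm_apply_eq hij (a := joinIndex h (Sum.inl 0))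
    (b := joinIndex h (Sum.inl 1)) (by simp)
  rw [← (measurePreserving_permute σ).lintegral_comp_emb (measurableEmbedding_permute σ)
    (fun x : Conf N => ‖scaledV V β N (x i - x j)‖ₑ * ‖U (lensTimeInv ω τ) ψ₀ x‖ₑ ^ 2)]
  refine lintegral_congr_ae ?_
  filter_upwards [hsymm σ] with x hx
  rw [hx]
  simp only [permute, hσi, hσj]

end PairEnergy

/-! ### Bounds of the interaction form that are uniform in the number of particles -/

section InteractionBound

variable {V : 𝓢(ℝ, ℝ)} {ω β : ℝ} {N k : ℕ}

open LineDeriv ENNReal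

/-- A bound of `∑ᵢ (‖f‖² + ‖∂ᵢ f‖²)`. -/
def traceNorm (f : 𝓢(Conf k, ℂ)) : ℝ :=
  ∑ i : Fin k, (‖toL2 f‖ ^ 2 + ‖toL2 (∂_{unitVec i} f)‖ ^ 2)

theorem traceNorm_nonneg (f : 𝓢(Conf k, ℂ)) : 0 ≤ traceNorm f :=
  Finset.sum_nonneg fun i _ => by positivity

/-- The trace inequality along the `i`-th coordinate, applied to the test function itself; the bound
is uniform in the position `c` of the other particle. -/
theorem lintegral_scaledV_mul_le (hN : 1 ≤ N) (f : 𝓢(Conf k, ℂ)) (i : Fin k) (c : ℝ) :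
    ∫⁻ x : Conf k, ‖scaledV V β N (x i - c)‖ₑ * ‖f x‖ₑ ^ 2 ≤
      ENNReal.ofReal (massV V * traceNorm f) := by
  have hv : ‖unitVec i‖ = 1 := (EuclideanSpace.basisFun (Fin k) ℝ).orthonormal.1 i
  have hm : Measurable fun x : Conf k => ‖scaledV V β N (x i - c)‖ₑ :=
    (measurable_scaledV.comp (by fun_prop)).enorm
  refine (lintegral_mul_enorm_sq_le f hv hm (B := ENNReal.ofReal (massV V)) fun x => ?_).trans ?_
  · have h1 := lintegral_scaledV (V := V) (β := β) hN one_pos (x i - c)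
    rw [inv_one, one_mul] at h1
    refine le_of_eq (Eq.trans (lintegral_congr fun t => ?_) h1)
    congr 2
    simp [unitVec]
    ring
  · rw [ENNReal.ofReal_mul massV_nonneg]
    refine mul_le_mul_right ?_ _
    rw [lintegral_add_left (f.continuous.enorm.measurable.pow_const 2), lintegral_enorm_toL2,
      lintegral_enorm_toL2, ← ofReal_norm, ← ofReal_norm, ← ENNReal.ofReal_pow (norm_nonneg _),
      ← ENNReal.ofReal_pow (norm_nonneg _), ← ENNReal.ofReal_add (by positivity) (by positivity)]
    exact ENNReal.ofReal_le_ofReal (Finset.single_le_sum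
      (f := fun i => ‖toL2 f‖ ^ 2 + ‖toL2 (∂_{unitVec i} f)‖ ^ 2)
      (fun i _ => by positivity) (Finset.mem_univ i))

/-- Split `|V_N|` into two square roots and apply Cauchy–Schwarz in `x` for fixed `z`. The factor
with `f` is bounded uniformly in `z` by the trace inequality, and the factor with `ψ` integrates to
the pair energy. -/
theorem norm_partialInner_pairOp_le (h : k ≤ N) (hN : 1 ≤ N) (f : 𝓢(Conf k, ℂ)) (i : Fin k)
    (j : Fin (N - k)) {ψ : L2 N} {D : ℝ} (hD0 : 0 ≤ D)
    (hD : ∫⁻ x : Conf N, ‖scaledV V β N (x (joinIndex h (Sum.inl i)) -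
      x (joinIndex h (Sum.inr j)))‖ₑ * ‖ψ x‖ₑ ^ 2 ≤ ENNReal.ofReal D) :
    ‖partialInner h (toL2 f) (pairOp V β N (joinIndex h (Sum.inl i)) (joinIndex h (Sum.inr j)) ψ)‖ ≤
      √(massV V * traceNorm f * D) := by
  have hsq : ∀ r : ℝ, ‖√|scaledV V β N r|‖ₑ * ‖√|scaledV V β N r|‖ₑ = ‖scaledV V β N r‖ₑ := by
    intro r
    rw [← ofReal_norm, ← ofReal_norm, ← ENNReal.ofReal_mul (norm_nonneg _),
      Real.norm_of_nonneg (Real.sqrt_nonneg _), Real.mul_self_sqrt (abs_nonneg _),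
      Real.norm_eq_abs]
  have hm : Measurable fun r => √|scaledV V β N r| :=
    (Real.continuous_sqrt.measurable).comp measurable_scaledV.abs
  -- A strongly measurable representative has measurable slices for every `z`, so the pointwise
  -- estimate needs no exceptional set.
  obtain ⟨ψ', hψ'm, hψ'⟩ := (Lp.memLp ψ).1
  have hjm : Measurable fun p : Conf k × Conf (N - k) => (join p.1 p.2 : Conf N) := by
    have := (joinEquiv h).measurable
    rwa [funext (joinEquiv_apply h)] at this
  have hc := coeFn_partialInner h (toL2 f) _ (coeFn_toL2 f)
    ((coeFn_pairOp (V := V) (β := β) (joinIndex h (Sum.inl i)) (joinIndex h (Sum.inr j)) ψ).trans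
      (hψ'.mono fun x hx => by
        change _ = ((scaledV V β N (x (joinIndex h (Sum.inl i)) -
          x (joinIndex h (Sum.inr j))) : ℝ) : ℂ) * ψ' x
        simp only [hx]))
  have hpt : ∀ z : Conf (N - k), ‖∫ x, conj (f x) * (((scaledV V β N
      ((join x z : Conf N) (joinIndex h (Sum.inl i)) -
        (join x z : Conf N) (joinIndex h (Sum.inr j))) : ℝ) : ℂ) * ψ' (join x z))‖ₑ ^ 2 ≤
      ENNReal.ofReal (massV V * traceNorm f) *
        ∫⁻ x, ‖scaledV V β N (x i - z j)‖ₑ * ‖ψ' (join x z)‖ₑ ^ 2 := by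
    intro z
    have hj : Measurable fun x : Conf k => (join x z : Conf N) :=
      hjm.comp (measurable_id.prodMk measurable_const)
    have hb : Measurable fun x : Conf k => ‖√|scaledV V β N (x i - z j)|‖ₑ :=
      (hm.comp (by fun_prop)).enorm
    calc _ ≤ (∫⁻ x, (‖√|scaledV V β N (x i - z j)|‖ₑ * ‖f x‖ₑ) *
          (‖√|scaledV V β N (x i - z j)|‖ₑ * ‖ψ' (join x z)‖ₑ)) ^ 2 := by
          gcongr
          refine (enorm_integral_le_lintegral_enorm _).trans (le_of_eq ?_)
          refine lintegral_congr fun x => ?_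
          rw [join_inl h, join_inr h, enorm_mul, enorm_mul, RCLike.enorm_conj,
            ← ofReal_norm ((scaledV V β N (x i - z j) : ℝ) : ℂ), Complex.norm_real, ofReal_norm,
            ← hsq]
          ring
      _ ≤ _ := by
          refine (lintegral_mul_sq_le (hb.mul f.continuous.enorm.measurable).aemeasurable
            (hb.mul (hψ'm.measurable.comp hj).enorm).aemeasurable).trans ?_
          refine mul_le_mul' (le_trans (le_of_eq (lintegral_congr fun x => ?_))
            (lintegral_scaledV_mul_le (V := V) (β := β) hN f i (z j)))
            (le_of_eq (lintegral_congr fun x => ?_))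
          · rw [Pi.mul_apply, mul_pow, sq ‖√_‖ₑ, hsq]
          · rw [Pi.mul_apply, mul_pow, sq ‖√_‖ₑ, hsq]
            rfl
  have hwm : Measurable fun x : Conf N => ‖scaledV V β N (x (joinIndex h (Sum.inl i)) -
      x (joinIndex h (Sum.inr j)))‖ₑ * ‖ψ' x‖ₑ ^ 2 :=
    ((measurable_scaledV.comp (by fun_prop)).enorm).mul (hψ'm.measurable.enorm.pow_const 2)
  have h1 : ‖partialInner h (toL2 f)
      (pairOp V β N (joinIndex h (Sum.inl i)) (joinIndex h (Sum.inr j)) ψ)‖ₑ ^ 2 ≤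
      ENNReal.ofReal (massV V * traceNorm f) * ENNReal.ofReal D := by
    rw [enorm_sq_eq_lintegral]
    calc _ ≤ ∫⁻ z : Conf (N - k), ENNReal.ofReal (massV V * traceNorm f) *
          ∫⁻ x, ‖scaledV V β N (x i - z j)‖ₑ * ‖ψ' (join x z)‖ₑ ^ 2 := by
          refine lintegral_mono_ae (hc.mono fun z hz => ?_)
          rw [hz]
          exact hpt z
      _ = ENNReal.ofReal (massV V * traceNorm f) *
          ∫⁻ x : Conf N, ‖scaledV V β N (x (joinIndex h (Sum.inl i)) -
            x (joinIndex h (Sum.inr j)))‖ₑ * ‖ψ' x‖ₑ ^ 2 := by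
          rw [lintegral_const_mul' _ _ ENNReal.ofReal_ne_top, ← lintegral_join h,
            lintegral_prod_symm (fun p : Conf k × Conf (N - k) => ‖scaledV V β N
              ((join p.1 p.2 : Conf N) (joinIndex h (Sum.inl i)) -
                (join p.1 p.2 : Conf N) (joinIndex h (Sum.inr j)))‖ₑ *
                  ‖ψ' (join p.1 p.2)‖ₑ ^ 2) (hwm.comp hjm).aemeasurable]
          simp only [join_inl, join_inr]
      _ ≤ _ := by
          refine mul_le_mul_right (le_trans (le_of_eq ?_) hD) _
          refine lintegral_congr_ae ?_
          filter_upwards [hψ'] with x hx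
          rw [hx]
  have hF := mul_nonneg (massV_nonneg (V := V)) (traceNorm_nonneg f)
  refine Real.le_sqrt_of_sq_le ?_
  rw [← ENNReal.ofReal_mul hF, ← ofReal_norm, ← ENNReal.ofReal_pow (norm_nonneg _)] at h1
  exact (ENNReal.ofReal_le_ofReal_iff (mul_nonneg hF hD0)).1 h1

/-- An interaction between two outside particles is multiplication by a real function of `z`: it
commutes with every `R_f`, and its two contributions cancel. -/
theorem interForm_inr_inr (h : k ≤ N) (f g : L2 k) (i j : Fin (N - k)) (ψ : L2 N) :
    interForm h f g (pairOp V β N (joinIndex h (Sum.inr i)) (joinIndex h (Sum.inr j))) ψ = 0 := by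
  have key : ∀ f : L2 k, partialInner h f
      (pairOp V β N (joinIndex h (Sum.inr i)) (joinIndex h (Sum.inr j)) ψ) =ᵐ[volume]
      fun z => ((scaledV V β N (z i - z j) : ℝ) : ℂ) * partialInner h f ψ z := by
    intro f
    filter_upwards [coeFn_partialInner h f _ (ae_eq_refl _)
      (coeFn_pairOp (V := V) (β := β) (joinIndex h (Sum.inr i)) (joinIndex h (Sum.inr j)) ψ),
      coeFn_partialInner h f ψ (ae_eq_refl _) (ae_eq_refl _)] with z h1 h2
    rw [h1, h2, ← integral_const_mul]
    refine integral_congr_ae (Eventually.of_forall fun x => ?_)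
    simp only [join_inr h]
    ring
  rw [interForm, sub_eq_zero, L2.inner_def, L2.inner_def]
  refine integral_congr_ae ?_
  filter_upwards [key f, key g] with z h1 h2
  rw [h1, h2, RCLike.inner_apply, RCLike.inner_apply, map_mul, Complex.conj_ofReal]
  ring

theorem interForm_interOp (h : k ≤ N) (f g : L2 k) (ψ : L2 N) :
    interForm h f g (interOp V β N) ψ =
      1 / (N : ℂ) * ∑ i, ∑ j ∈ Finset.Ioi i, interForm h f g (pairOp V β N i j) ψ := by
  have hc : conj (1 / (N : ℂ)) = 1 / (N : ℂ) := by simp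
  simp only [interForm, interOp, smul_apply, sum_apply, map_smul, map_sum, inner_smul_left,
    inner_smul_right, inner_sum, sum_inner, Finset.sum_sub_distrib, hc, mul_sub]

theorem norm_pairOp_le (i j : Fin N) : ‖pairOp V β N i j‖ ≤ (N : ℝ) ^ β * boundV V :=
  ContinuousLinearMap.opNorm_le_bound _ (mul_nonneg (by positivity) boundV_nonneg)
    (norm_mulOp_apply_le _ _)

/-- The bound of the interaction form between a particle in the marginal and one outside. -/
def mixBound (V : 𝓢(ℝ, ℝ)) (f g : 𝓢(Conf k, ℂ)) (D : ℝ) : ℝ :=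
  √(massV V * traceNorm f * D) * ‖toL2 g‖ + ‖toL2 f‖ * √(massV V * traceNorm g * D)

/-- Pairs inside the marginal take the sup norm bound, mixed pairs the energy bound, and outside
pairs vanish. Since inside indices precede outside ones, `i < j` excludes the case of `i` outside
and `j` inside. -/
theorem norm_interForm_pairOp_le (h : k ≤ N) (hN : 1 ≤ N) (f g : 𝓢(Conf k, ℂ)) {ψ : L2 N}
    (hψ : ‖ψ‖ = 1) {D : ℝ} (hD0 : 0 ≤ D) (hD : ∀ i j : Fin N, i ≠ j →
      ∫⁻ x : Conf N, ‖scaledV V β N (x i - x j)‖ₑ * ‖ψ x‖ₑ ^ 2 ≤ ENNReal.ofReal D)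
    {i j : Fin N} (hij : i < j) :
    ‖interForm h (toL2 f) (toL2 g) (pairOp V β N i j) ψ‖ ≤
      if (i : ℕ) < k then mixBound V f g D +
        if (j : ℕ) < k then 2 * ‖toL2 f‖ * ‖toL2 g‖ * ((N : ℝ) ^ β * boundV V) else 0 else 0 := by
  have hmix : 0 ≤ mixBound V f g D := by unfold mixBound; positivity
  obtain ⟨i, rfl⟩ := (joinIndex h).surjective i
  obtain ⟨j, rfl⟩ := (joinIndex h).surjective j
  rcases i with i | i <;> rcases j with j | j
  · have h1 : (joinIndex h (Sum.inl i) : ℕ) < k := by simp [joinIndex]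
    have h2 : (joinIndex h (Sum.inl j) : ℕ) < k := by simp [joinIndex]
    rw [if_pos h1, if_pos h2]
    refine (norm_interForm_le_norm h _ _ _ ψ).trans ?_
    rw [hψ, one_pow, mul_one]
    refine le_add_of_nonneg_of_le hmix ?_
    exact mul_le_mul_of_nonneg_left (norm_pairOp_le _ _) (by positivity)
  · have h1 : (joinIndex h (Sum.inl i) : ℕ) < k := by simp [joinIndex]
    have h2 : ¬(joinIndex h (Sum.inr j) : ℕ) < k := by simp [joinIndex]
    rw [if_pos h1, if_neg h2, add_zero]
    have h3 := norm_partialInner_le h (toL2 f) ψ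
    have h4 := norm_partialInner_le h (toL2 g) ψ
    rw [hψ, mul_one] at h3 h4
    have h5 := norm_partialInner_pairOp_le h hN f i j hD0 (hD _ _ hij.ne)
    have h6 := norm_partialInner_pairOp_le h hN g i j hD0 (hD _ _ hij.ne)
    refine (norm_sub_le _ _).trans (add_le_add ?_ ?_)
    · exact (norm_inner_le_norm _ _).trans (mul_le_mul h5 h4 (norm_nonneg _) (Real.sqrt_nonneg _))
    · exact (norm_inner_le_norm _ _).trans (mul_le_mul h3 h6 (norm_nonneg _) (norm_nonneg _))
  · exfalso
    have := Fin.lt_def.1 hij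
    simp [joinIndex] at this
    omega
  · have h1 : ¬(joinIndex h (Sum.inr i) : ℕ) < k := by simp [joinIndex]
    rw [if_neg h1, interForm_inr_inr, norm_zero]

/-- The bound of the commutator form. -/
def commBound (V : 𝓢(ℝ, ℝ)) (ω : ℝ) (f g : 𝓢(Conf k, ℂ)) (D : ℝ) : ℝ :=
  oscBound ω f g + (k * mixBound V f g D + k * k * (2 * ‖toL2 f‖ * ‖toL2 g‖ * boundV V))

/-- At most `k N` mixed pairs contribute `O(1)` each and at most `k²` inside pairs contribute
`O(N^β)` each. The mean-field factor `1/N` together with `N^β ≤ N` makes the total independent of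
`N`. -/
theorem norm_commForm_le_commBound (h : k ≤ N) (hN : 1 ≤ N) (hβ : β ≤ 1) (f g : 𝓢(Conf k, ℂ))
    {ψ : L2 N} (hψ : ‖ψ‖ = 1) {D : ℝ} (hD0 : 0 ≤ D) (hD : ∀ i j : Fin N, i ≠ j →
      ∫⁻ x : Conf N, ‖scaledV V β N (x i - x j)‖ₑ * ‖ψ x‖ₑ ^ 2 ≤ ENNReal.ofReal D) :
    ‖commForm V ω β h f g ψ‖ ≤ commBound V ω f g D := by
  have hmix : 0 ≤ mixBound V f g D := by unfold mixBound; positivity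
  have hN' : (1 : ℝ) ≤ N := by exact_mod_cast hN
  have hN0 : (0 : ℝ) < N := by linarith
  obtain ⟨P, hP⟩ : ∃ P, P = 2 * ‖toL2 f‖ * ‖toL2 g‖ * ((N : ℝ) ^ β * boundV V) := ⟨_, rfl⟩
  have hP0 : 0 ≤ P := by
    have := boundV_nonneg (V := V)
    rw [hP]
    positivity
  have hcard : ∀ c : ℝ, ∑ i : Fin N, (if (i : ℕ) < k then c else 0) = k * c := by
    intro c
    rw [← Equiv.sum_comp (joinIndex h), Fintype.sum_sum_type]
    simp [joinIndex]
  have hsum : ‖∑ i, ∑ j ∈ Finset.Ioi i, interForm h (toL2 f) (toL2 g) (pairOp V β N i j) ψ‖ ≤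
      k * (N * mixBound V f g D + k * P) := by
    calc _ ≤ ∑ i : Fin N, ∑ j ∈ Finset.Ioi i, (if (i : ℕ) < k then mixBound V f g D +
          if (j : ℕ) < k then P else 0 else 0) := by
          refine (norm_sum_le _ _).trans (Finset.sum_le_sum fun i _ =>
            (norm_sum_le _ _).trans (Finset.sum_le_sum fun j hj => ?_))
          rw [hP]
          exact norm_interForm_pairOp_le h hN f g hψ hD0 hD (Finset.mem_Ioi.1 hj)
      _ ≤ ∑ i : Fin N, ∑ j : Fin N, (if (i : ℕ) < k then mixBound V f g D +
          if (j : ℕ) < k then P else 0 else 0) := by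
          refine Finset.sum_le_sum fun i _ => Finset.sum_le_sum_of_subset_of_nonneg
            (Finset.subset_univ _) fun j _ _ => ?_
          split_ifs <;> positivity
      _ = ∑ i : Fin N, (if (i : ℕ) < k then N * mixBound V f g D + k * P else 0) := by
          refine Finset.sum_congr rfl fun i _ => ?_
          split_ifs with hi
          · rw [Finset.sum_add_distrib, hcard]
            simp
          · simp
      _ = _ := hcard _
  refine (norm_commForm_le h f g ψ).trans ?_
  rw [hψ, one_pow, mul_one, commBound]
  refine add_le_add_right ?_ _
  rw [interForm_interOp, norm_mul, norm_div, norm_one, Complex.norm_natCast]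
  have hpow : (N : ℝ) ^ β ≤ N := by
    simpa using Real.rpow_le_rpow_of_exponent_le hN' hβ
  have hP1 : P ≤ N * (2 * ‖toL2 f‖ * ‖toL2 g‖ * boundV V) := by
    have := mul_le_mul_of_nonneg_left hpow
      (show 0 ≤ 2 * ‖toL2 f‖ * ‖toL2 g‖ * boundV V by
        have := boundV_nonneg (V := V)
        positivity)
    rw [hP]
    linarith
  calc 1 / (N : ℝ) * _ ≤ 1 / (N : ℝ) * (k * (N * mixBound V f g D + k * P)) := by gcongr
    _ ≤ 1 / (N : ℝ) * (k * (N * mixBound V f g D +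
          k * (N * (2 * ‖toL2 f‖ * ‖toL2 g‖ * boundV V)))) := by gcongr
    _ = _ := by
        field_simp

end InteractionBound

/-! ### Strong continuity of the lens transform -/

section LensContinuity

variable {k : ℕ}

open ENNReal

/-- The exponent is chosen so that the bound is square integrable on `ℝᵏ`, because `2(k + 1) > k`.
-/
theorem exists_decay (φ : 𝓢(Conf k, ℂ)) :
    ∃ C : ℝ, 0 ≤ C ∧ ∀ x, ‖φ x‖ ≤ C * ((1 + ‖x‖) ^ (k + 1))⁻¹ := by
  refine ⟨2 ^ (k + 1) * (Finset.Iic (k + 1, 0)).sup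
    (fun m => SchwartzMap.seminorm ℝ m.1 m.2) φ, by positivity, fun x => ?_⟩
  have h := SchwartzMap.one_add_le_sup_seminorm_apply (𝕜 := ℝ) (m := (k + 1, 0)) le_rfl le_rfl φ x
  rw [norm_iteratedFDeriv_zero] at h
  rw [← div_eq_mul_inv, le_div_iff₀ (by positivity), mul_comm]
  exact h

theorem lintegral_decay_ne_top (c : ℝ) :
    ∫⁻ x : Conf k, ENNReal.ofReal (c * ((1 + ‖x‖) ^ (k + 1))⁻¹) ^ 2 ≠ ∞ := by
  have h1 := finite_integral_one_add_norm (E := Conf k) (μ := volume) (r := 2 * (k + 1))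
    (by rw [finrank_euclideanSpace_fin]; linarith [(Nat.cast_nonneg k : (0 : ℝ) ≤ k)])
  have h2 : ∀ x : Conf k, ENNReal.ofReal (c * ((1 + ‖x‖) ^ (k + 1))⁻¹) ^ 2 =
      ENNReal.ofReal c ^ 2 * ENNReal.ofReal ((1 + ‖x‖) ^ (-(2 * (k + 1) : ℝ))) := by
    intro x
    have h3 : (0 : ℝ) < 1 + ‖x‖ := by positivity
    have h5 : (1 + ‖x‖) ^ ((k + 1) * 2) = (1 + ‖x‖) ^ (2 * (k + 1) : ℝ) := by
      rw [← Real.rpow_natCast]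
      congr 1
      push_cast
      ring
    rw [ENNReal.ofReal_mul' (by positivity), mul_pow, ← ENNReal.ofReal_pow (inv_nonneg.2 (by positivity)) 2,
      Real.rpow_neg h3.le, inv_pow, ← pow_mul, h5]
  simp only [h2]
  rw [lintegral_const_mul' _ _ (by finiteness)]
  exact ENNReal.mul_ne_top (by finiteness) h1.ne

theorem continuous_lensScale (ω : ℝ) : Continuous (lensScale ω) := by
  unfold lensScale
  fun_prop

theorem tendsto_lensFun (ω : ℝ) (φ : 𝓢(Conf k, ℂ)) (τ₀ : ℝ) (x : Conf k) :
    Tendsto (fun τ => lensFun (lensScale ω τ) (-(ω ^ 2 * τ)) φ x) (𝓝 τ₀)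
      (𝓝 (lensFun (lensScale ω τ₀) (-(ω ^ 2 * τ₀)) φ x)) := by
  have h1 := continuous_lensScale ω
  have h2 : Continuous fun τ => (lensScale ω τ) ^ ((k : ℝ) / 2) :=
    h1.rpow_const fun τ => Or.inl (lensScale_pos ω τ).ne'
  have h3 : Continuous fun τ => lensFun (lensScale ω τ) (-(ω ^ 2 * τ)) φ x := by
    unfold lensFun
    have := φ.continuous
    fun_prop
  exact h3.tendsto τ₀

/-- Dominated convergence in `L²`. As the scale is at least one, `‖s x‖ ≥ ‖x‖`, so for `τ` near `τ₀`
a single decay bound of `φ` dominates all the dilated functions. -/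
theorem tendsto_lensPull_toL2 (ω : ℝ) (φ : 𝓢(Conf k, ℂ)) (τ₀ : ℝ) :
    Tendsto (fun τ => lensPull ω τ (toL2 φ)) (𝓝 τ₀) (𝓝 (lensPull ω τ₀ (toL2 φ))) := by
  obtain ⟨F, hF⟩ : ∃ F : ℝ → Conf k → ℂ,
      F = fun τ => lensFun (lensScale ω τ) (-(ω ^ 2 * τ)) φ := ⟨_, rfl⟩
  have hcoe : ∀ τ, lensPull ω τ (toL2 φ) =ᵐ[volume] F τ := fun τ => by
    rw [hF]
    exact (coeFn_lensL (lensScale_pos ω τ) _ (toL2 φ)).trans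
      (lensFun_congr_ae (lensScale_pos ω τ) _ (coeFn_toL2 φ))
  have hFc : ∀ τ, Continuous (F τ) := fun τ => by
    rw [hF]
    have := φ.continuous
    unfold lensFun
    fun_prop
  obtain ⟨C, hC0, hC⟩ := exists_decay φ
  have hbound : ∀ τ x, ‖F τ x‖ ≤
      lensScale ω τ ^ ((k : ℝ) / 2) * (C * ((1 + ‖x‖) ^ (k + 1))⁻¹) := by
    intro τ x
    rw [hF]
    simp only
    rw [norm_lensFun (lensScale_pos ω τ)]
    have h1 : ‖x‖ ≤ ‖lensScale ω τ • x‖ := by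
      rw [norm_smul, Real.norm_of_nonneg (lensScale_pos ω τ).le]
      exact le_mul_of_one_le_left (norm_nonneg _) (one_le_lensScale ω τ)
    have := lensScale_pos ω τ
    refine mul_le_mul_of_nonneg_left ((hC _).trans ?_) (by positivity)
    gcongr
  obtain ⟨K, hK⟩ : ∃ K, K = lensScale ω τ₀ ^ ((k : ℝ) / 2) + 1 := ⟨_, rfl⟩
  have hev : ∀ᶠ τ in 𝓝 τ₀, lensScale ω τ ^ ((k : ℝ) / 2) ≤ K := by
    have h2 : Continuous fun τ => (lensScale ω τ) ^ ((k : ℝ) / 2) :=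
      (continuous_lensScale ω).rpow_const fun τ => Or.inl (lensScale_pos ω τ).ne'
    refine (h2.tendsto τ₀).eventually_le_const ?_
    rw [hK]
    linarith
  have h0 : lensScale ω τ₀ ^ ((k : ℝ) / 2) ≤ K := by rw [hK]; linarith
  have key : Tendsto (fun τ => ∫⁻ x, ‖F τ x - F τ₀ x‖ₑ ^ 2) (𝓝 τ₀) (𝓝 (∫⁻ _ : Conf k, 0)) := by
    refine tendsto_lintegral_filter_of_dominated_convergence
      (fun x => ENNReal.ofReal ((K * C + K * C) * ((1 + ‖x‖) ^ (k + 1))⁻¹) ^ 2)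
      (Eventually.of_forall fun τ =>
        ((hFc τ).sub (hFc τ₀)).enorm.measurable.pow_const 2) ?_ (lintegral_decay_ne_top _)
      (Eventually.of_forall fun x => ?_)
    · filter_upwards [hev] with τ hτ
      refine Eventually.of_forall fun x => ?_
      rw [← ofReal_norm]
      gcongr
      have hd : 0 ≤ C * ((1 + ‖x‖) ^ (k + 1))⁻¹ := by positivity
      refine (norm_sub_le _ _).trans ((add_le_add ((hbound τ x).trans
        (mul_le_mul_of_nonneg_right hτ hd)) ((hbound τ₀ x).trans
        (mul_le_mul_of_nonneg_right h0 hd))).trans_eq ?_)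
      ring
    · have h1 : Tendsto (fun τ => F τ x - F τ₀ x) (𝓝 τ₀) (𝓝 0) := by
        have h2 := (tendsto_lensFun ω φ τ₀ x).sub_const (F τ₀ x)
        rw [hF] at h2 ⊢
        simpa using h2
      have h3 := ((ENNReal.continuous_pow 2).tendsto _).comp h1.enorm
      simpa [Function.comp_def] using h3
  rw [lintegral_zero] at key
  have h4 : ∀ τ, ∫⁻ x, ‖F τ x - F τ₀ x‖ₑ ^ 2 =
      ‖lensPull ω τ (toL2 φ) - lensPull ω τ₀ (toL2 φ)‖ₑ ^ 2 := by
    intro τ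
    rw [enorm_sq_eq_lintegral]
    refine lintegral_congr_ae ?_
    filter_upwards [hcoe τ, hcoe τ₀,
      Lp.coeFn_sub (lensPull ω τ (toL2 φ)) (lensPull ω τ₀ (toL2 φ))] with x h5 h6 h7
    rw [h7, Pi.sub_apply, h5, h6]
  simp only [h4] at key
  rw [tendsto_iff_norm_sub_tendsto_zero]
  have h8 := (ENNReal.tendsto_toReal ENNReal.zero_ne_top).comp key
  have h9 : Tendsto (fun τ => ‖lensPull ω τ (toL2 φ) - lensPull ω τ₀ (toL2 φ)‖ ^ 2) (𝓝 τ₀)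
      (𝓝 0) := by simpa [Function.comp_def] using h8
  have h10 := (Real.continuous_sqrt.tendsto _).comp h9
  simpa [Function.comp_def, Real.sqrt_sq] using h10

theorem tendsto_of_dense_isometry {E F ι : Type*} [NormedAddCommGroup E] [NormedSpace ℂ E]
    [NormedAddCommGroup F] [NormedSpace ℂ F] {l : Filter ι} {T : ι → E →ₗᵢ[ℂ] F}
    {T' : E →ₗᵢ[ℂ] F} {s : Set E} (hs : Dense s)
    (h : ∀ x ∈ s, Tendsto (fun i => T i x) l (𝓝 (T' x))) (x : E) :
    Tendsto (fun i => T i x) l (𝓝 (T' x)) := by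
  rw [Metric.tendsto_nhds]
  intro ε hε
  obtain ⟨y, hy, hxy⟩ := hs.exists_dist_lt x (show 0 < ε / 3 by positivity)
  filter_upwards [Metric.tendsto_nhds.1 (h y hy) (ε / 3) (by positivity)] with i hi
  have h1 : dist (T i x) (T i y) < ε / 3 := by rwa [(T i).dist_map]
  have h2 : dist (T' y) (T' x) < ε / 3 := by rwa [T'.dist_map, dist_comm]
  linarith [dist_triangle4 (T i x) (T i y) (T' y) (T' x)]

theorem tendsto_lensPull (ω : ℝ) (f : L2 k) (τ₀ : ℝ) :
    Tendsto (fun τ => lensPull ω τ f) (𝓝 τ₀) (𝓝 (lensPull ω τ₀ f)) :=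
  tendsto_of_dense_isometry dense_schwartz (by
    rintro _ ⟨φ, rfl⟩
    exact tendsto_lensPull_toL2 ω φ τ₀) f

theorem continuous_lensTimeInv (ω : ℝ) : Continuous (lensTimeInv ω) := by
  unfold lensTimeInv
  split_ifs
  · exact continuous_id
  · exact (Real.continuous_arctan.comp (continuous_const.mul continuous_id)).div_const _

end LensContinuity

/-! ### Equicontinuity -/

section Equicontinuity

variable {H : Type*} [NormedAddCommGroup H] [InnerProductSpace ℂ H]

/-- The matrix elements `⟨g, Γ_N(τ) f⟩` are equicontinuous in `τ` at `τ₀`. -/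
def EquiAt {X ν : Type*} (l : Filter X) (x₀ : X) (Γ : ν → X → (H →L[ℂ] H)) (f g : H) : Prop :=
  ∀ ε > 0, ∀ᶠ x in l, ∀ n, ‖inner ℂ g ((Γ n x - Γ n x₀) f)‖ ≤ ε

variable {X ν : Type*} {l : Filter X} {x₀ : X} {Γ : ν → X → (H →L[ℂ] H)}

theorem norm_inner_apply_sub_le {A : H →L[ℂ] H} (hA : ∀ f, ‖A f‖ ≤ ‖f‖) (f g f' g' : H) :
    ‖inner ℂ g (A f) - inner ℂ g' (A f')‖ ≤ ‖g - g'‖ * ‖f‖ + ‖g'‖ * ‖f - f'‖ := by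
  have e : inner ℂ g (A f) - inner ℂ g' (A f') =
      inner ℂ (g - g') (A f) + inner ℂ g' (A (f - f')) := by
    rw [map_sub, inner_sub_left, inner_sub_right]
    ring
  rw [e]
  refine (norm_add_le _ _).trans (add_le_add ?_ ?_)
  · exact (norm_inner_le_norm _ _).trans (mul_le_mul_of_nonneg_left (hA _) (norm_nonneg _))
  · exact (norm_inner_le_norm _ _).trans (mul_le_mul_of_nonneg_left (hA _) (norm_nonneg _))

/-- All operators are contractions, so replacing `f` and `g` by nearby vectors of the dense set
changes matrix elements by an amount uniform in `n`, once at each of the two times. -/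
theorem equiAt_of_dense {s : Set H} (hs : Dense s) (hΓ : ∀ n x f, ‖Γ n x f‖ ≤ ‖f‖)
    (h : ∀ f ∈ s, ∀ g ∈ s, EquiAt l x₀ Γ f g) (f g : H) : EquiAt l x₀ Γ f g := by
  intro ε hε
  have hcont : Tendsto (fun p : H × H => ‖g - p.2‖ * ‖f‖ + ‖p.2‖ * ‖f - p.1‖) (𝓝 (f, g)) (𝓝 0) := by
    have h1 : Continuous fun p : H × H => ‖g - p.2‖ * ‖f‖ + ‖p.2‖ * ‖f - p.1‖ := by fun_prop
    simpa using h1.tendsto (f, g)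
  have hev := hcont.eventually_lt_const (show 0 < ε / 3 by positivity)
  obtain ⟨⟨f', g'⟩, ⟨hf', hg'⟩, hlt⟩ := ((hs.prod hs).inter_nhds_nonempty hev)
  simp only [Set.mem_ofPred_eq] at hlt
  filter_upwards [h f' hf' g' hg' (ε / 3) (by positivity)] with x hx n
  have h1 := norm_inner_apply_sub_le (hΓ n x) f g f' g'
  have h2 := norm_inner_apply_sub_le (hΓ n x₀) f g f' g'
  have h3 := hx n
  rw [sub_apply, inner_sub_right] at h3 ⊢
  have e : inner ℂ g (Γ n x f) - inner ℂ g (Γ n x₀ f) =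
      (inner ℂ g (Γ n x f) - inner ℂ g' (Γ n x f')) -
      (inner ℂ g (Γ n x₀ f) - inner ℂ g' (Γ n x₀ f')) +
      (inner ℂ g' (Γ n x f') - inner ℂ g' (Γ n x₀ f')) := by ring
  rw [e]
  refine (norm_add_le _ _).trans ?_
  have := norm_sub_le (inner ℂ g (Γ n x f) - inner ℂ g' (Γ n x f'))
    (inner ℂ g (Γ n x₀ f) - inner ℂ g' (Γ n x₀ f'))
  linarith

/-- By strong continuity and contractivity, `E x f` and `E x g` may be replaced by their values at
`x₀` at a cost uniform in `n`; for these fixed vectors equicontinuity is assumed. -/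
theorem equiAt_conj [CompleteSpace H] {E : X → (H →ₗᵢ[ℂ] H)} (hΓ : ∀ n x f, ‖Γ n x f‖ ≤ ‖f‖)
    (hE : ∀ f, Tendsto (fun x => E x f) l (𝓝 (E x₀ f))) (h : ∀ f g, EquiAt l x₀ Γ f g) (f g : H) :
    EquiAt l x₀ (fun n x => (E x).toContinuousLinearMap.adjoint.comp
      ((Γ n x).comp (E x).toContinuousLinearMap)) f g := by
  intro ε hε
  have hlim : Tendsto (fun x => ‖E x g - E x₀ g‖ * ‖E x f‖ + ‖E x₀ g‖ * ‖E x f - E x₀ f‖) l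
      (𝓝 0) := by
    have h1 := (((hE g).sub_const (E x₀ g)).norm.mul (hE f).norm).add
      (((hE f).sub_const (E x₀ f)).norm.const_mul ‖E x₀ g‖)
    simpa using h1
  filter_upwards [hlim.eventually_le_const (show 0 < ε / 2 by positivity),
    h (E x₀ f) (E x₀ g) (ε / 2) (by positivity)] with x h1 h2 n
  have h3 := norm_inner_apply_sub_le (hΓ n x) (E x f) (E x g) (E x₀ f) (E x₀ g)
  have h4 := h2 n
  rw [sub_apply, inner_sub_right] at h4 ⊢
  simp only [ContinuousLinearMap.comp_apply, ContinuousLinearMap.adjoint_inner_right,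
    LinearIsometry.coe_toContinuousLinearMap]
  have e : inner ℂ (E x g) (Γ n x (E x f)) - inner ℂ (E x₀ g) (Γ n x₀ (E x₀ f)) =
      (inner ℂ (E x g) (Γ n x (E x f)) - inner ℂ (E x₀ g) (Γ n x (E x₀ f))) +
      (inner ℂ (E x₀ g) (Γ n x (E x₀ f)) - inner ℂ (E x₀ g) (Γ n x₀ (E x₀ f))) := by ring
  rw [e]
  refine (norm_add_le _ _).trans ?_
  linarith

/-- The energy condition holds only for large `N`. The finitely many remaining indices need no
uniform estimate, just continuity of each. -/
theorem equiAt_nat {Γ : ℕ → X → (H →L[ℂ] H)} {f g : H} (n₀ : ℕ)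
    (h1 : ∀ ε > 0, ∀ᶠ x in l, ∀ n ≥ n₀, ‖inner ℂ g ((Γ n x - Γ n x₀) f)‖ ≤ ε)
    (h2 : ∀ n, Tendsto (fun x => inner ℂ g (Γ n x f)) l (𝓝 (inner ℂ g (Γ n x₀ f)))) :
    EquiAt l x₀ Γ f g := by
  intro ε hε
  have h3 : ∀ n, ∀ᶠ x in l, ‖inner ℂ g ((Γ n x - Γ n x₀) f)‖ ≤ ε := by
    intro n
    have h4 := (h2 n).sub_const (inner ℂ g (Γ n x₀ f))
    rw [sub_self] at h4
    have h5 := h4.norm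
    rw [norm_zero] at h5
    filter_upwards [h5.eventually_le_const hε] with x hx
    rwa [sub_apply, inner_sub_right]
  filter_upwards [h1 ε hε, (Finset.eventually_all (Finset.range n₀)).2 fun n _ => h3 n] with x h4 h5 n
  rcases lt_or_ge n n₀ with h | h
  · exact h5 n (Finset.mem_range.2 h)
  · exact h4 n h

/-- The supremum over the family is the modulus `ρ` that `isCompact_paths` takes as input. -/
theorem tendsto_iSup_of_equiAt {X : Type*} {l : Filter X} {x₀ : X} {Γ : ℕ → X → (H →L[ℂ] H)}
    {f g : H} (h : EquiAt l x₀ Γ f g) :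
    Tendsto (fun x => ⨆ n, ‖inner ℂ g ((Γ n x - Γ n x₀) f)‖) l (𝓝 0) := by
  rw [Metric.tendsto_nhds]
  intro ε hε
  filter_upwards [h (ε / 2) (by positivity)] with x hx
  rw [Real.dist_eq, sub_zero, abs_of_nonneg (Real.iSup_nonneg fun n => norm_nonneg _)]
  exact (ciSup_le hx).trans_lt (by linarith)

end Equicontinuity

/-! ### Equicontinuity of the marginal densities -/

section Marginals

variable {V : 𝓢(ℝ, ℝ)} {ω β : ℝ}

/-- Every physical time between the two endpoints corresponds, by the intermediate value theorem, to
some `τ'` in the interval, where the energy condition applies. The scale at `τ'` is at most the one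
at the endpoint `a`, so one constant serves throughout. -/
theorem norm_inner_marginalOp_lens_le {N k : ℕ} {U : ℝ → (L2 N →L[ℂ] L2 N)}
    (hU : IsEvolution V ω β N U) (hV : ∀ x, V (-x) = V x) (hβ : β ≤ 1) (h : k ≤ N) (h2 : 2 ≤ N)
    {ψ₀ : L2 N} (hψ : ‖ψ₀‖ = 1) (hs : IsSymmetricState ψ₀) {a c : ℝ} (hc : 0 ≤ c)
    (hE : ∀ τ ∈ Set.Icc (-a) a, EnergyAtMost (lensMarginal ω U ψ₀ 2 τ) c) (f g : 𝓢(Conf k, ℂ))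
    {τ τ₀ : ℝ} (hτ : τ ∈ Set.Icc (-a) a) (hτ₀ : τ₀ ∈ Set.Icc (-a) a) :
    ‖inner ℂ (toL2 g) ((marginalOp h (U (lensTimeInv ω τ) ψ₀) -
      marginalOp h (U (lensTimeInv ω τ₀) ψ₀)) (toL2 f))‖ ≤
      commBound V ω f g (lensScale ω a * massV V * c) *
        |lensTimeInv ω τ - lensTimeInv ω τ₀| := by
  rw [sub_apply, inner_sub_right]
  refine norm_inner_marginalOp_sub_le hU h f g ψ₀ fun r hr => ?_
  obtain ⟨τ', hτ', rfl⟩ :=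
    intermediate_value_uIcc (continuous_lensTimeInv ω).continuousOn hr
  have hτ'a : τ' ∈ Set.Icc (-a) a := Set.OrdConnected.uIcc_subset inferInstance hτ₀ hτ hτ'
  have hm := massV_nonneg (V := V)
  have hsa := lensScale_pos ω a
  refine norm_commForm_le_commBound h (one_le_two.trans h2) hβ f g ((hU.isometry _ _).trans hψ)
    (by positivity) fun i j hij => ?_
  refine (lintegral_scaledV_pair_le h2 (hE τ' hτ'a) (hU.isSymmetricState hV hs _) hij).trans ?_
  rw [← ENNReal.ofReal_mul (mul_nonneg (lensScale_pos ω τ').le hm)]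
  refine ENNReal.ofReal_le_ofReal ?_
  have hle : lensScale ω τ' ≤ lensScale ω a := by
    refine Real.sqrt_le_sqrt ?_
    have : τ' ^ 2 ≤ a ^ 2 := sq_le_sq' hτ'a.1 hτ'a.2
    gcongr
  gcongr

open Classical in
/-- The marginal density operator at the time that corresponds to `τ`. -/
def timeMarginal (ω : ℝ) {N : ℕ} (U : ℝ → (L2 N →L[ℂ] L2 N)) (ψ₀ : L2 N) (k : ℕ) (τ : ℝ) :
    L2 k →L[ℂ] L2 k :=
  if h : k ≤ N then marginalOp h (U (lensTimeInv ω τ) ψ₀) else 0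

theorem adjoint_comp_zero_comp {H : Type*} [NormedAddCommGroup H] [InnerProductSpace ℂ H]
    [CompleteSpace H] (E : H →L[ℂ] H) : E.adjoint.comp ((0 : H →L[ℂ] H).comp E) = 0 := by
  rw [ContinuousLinearMap.zero_comp, ContinuousLinearMap.comp_zero]

theorem lensMarginal_eq_timeMarginal {N : ℕ} (U : ℝ → (L2 N →L[ℂ] L2 N)) (ψ₀ : L2 N) (k : ℕ)
    (τ : ℝ) : lensMarginal ω U ψ₀ k τ = (lensPull ω τ).toContinuousLinearMap.adjoint.comp
      ((timeMarginal ω U ψ₀ k τ).comp (lensPull ω τ).toContinuousLinearMap) := by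
  by_cases h : k ≤ N
  · have h0 : timeMarginal ω U ψ₀ k τ = marginalOp h (U (lensTimeInv ω τ) ψ₀) := dif_pos h
    rw [h0]
    exact lensMarginal_eq h ω τ U ψ₀
  · have h0 : timeMarginal ω U ψ₀ k τ = 0 := dif_neg h
    have h1 : lensMarginal ω U ψ₀ k τ = 0 := if_neg h
    rw [h0, h1]
    exact (adjoint_comp_zero_comp (lensPull ω τ).toContinuousLinearMap).symm

theorem norm_timeMarginal_le {N k : ℕ} {U : ℝ → (L2 N →L[ℂ] L2 N)} {ψ₀ : L2 N} {τ : ℝ}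
    (hn : k ≤ N → ‖U (lensTimeInv ω τ) ψ₀‖ = 1) (f : L2 k) :
    ‖timeMarginal ω U ψ₀ k τ f‖ ≤ ‖f‖ := by
  by_cases h : k ≤ N
  · rw [timeMarginal, dif_pos h]
    have h1 := isPosTrace_densityOp (splitL h (U (lensTimeInv ω τ) ψ₀))
    rw [LinearIsometry.norm_map, hn h, one_pow] at h1
    have h2 := h1.norm_inner_le (marginalOp h (U (lensTimeInv ω τ) ψ₀) f) f
    rw [mul_one, marginalOp, inner_self_eq_norm_sq_to_K, ← RCLike.ofReal_pow, RCLike.norm_ofReal,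
      abs_of_nonneg (by positivity), sq] at h2
    rcases (norm_nonneg (densityOp (splitL h (U (lensTimeInv ω τ) ψ₀)) f)).eq_or_lt with h3 | h3
    · rw [marginalOp, ← h3]
      exact norm_nonneg _
    · exact le_of_mul_le_mul_left h2 h3
  · rw [timeMarginal, dif_neg h]
    simp

theorem continuous_inner_timeMarginal {N k : ℕ} {U : ℝ → (L2 N →L[ℂ] L2 N)}
    (hU : k ≤ N → IsEvolution V ω β N U) (ψ₀ : L2 N) (f g : L2 k) :
    Continuous fun τ => inner ℂ g (timeMarginal ω U ψ₀ k τ f) := by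
  by_cases h : k ≤ N
  · simp only [timeMarginal, dif_pos h, inner_marginalOp]
    have h1 := ((hU h).continuous ψ₀).comp (continuous_lensTimeInv ω)
    exact ((partialInner h f).continuous.comp h1).inner ((partialInner h g).continuous.comp h1)
  · simp only [timeMarginal, dif_neg h, zero_apply, inner_zero_right]
    exact continuous_const

/-- The Lipschitz bound in physical time gives equicontinuity of the unconjugated marginals between
Schwartz functions. Density extends it to `L²`, and conjugation by the strongly continuous lens
transform finishes. -/
theorem equiAt_lensMarginal (hV : ∀ x, V (-x) = V x) (hβ : β ≤ 1) {a T : ℝ}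
    (hT : Set.uIcc 0 T ⊆ Set.Icc (-a) a) {U : ∀ N : ℕ, ℝ → (L2 N →L[ℂ] L2 N)}
    (hU : ∀ N, 1 ≤ N → IsEvolution V ω β N (U N)) {ψ₀ : ∀ N : ℕ, L2 N}
    (hnorm : ∀ N, 1 ≤ N → ‖ψ₀ N‖ = 1) (hsymm : ∀ N, 1 ≤ N → IsSymmetricState (ψ₀ N)) {c : ℝ}
    (hc : 0 ≤ c) {N₀ : ℕ} (henergy : ∀ N ≥ N₀, ∀ τ ∈ Set.Icc (-a) a,
      EnergyAtMost (lensMarginal ω (U N) (ψ₀ N) 2 τ) c) {k : ℕ} (hk : 1 ≤ k)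
    (τ₀ : Set.uIcc 0 T) (f g : L2 k) :
    EquiAt (𝓝 τ₀) τ₀ (fun N (τ : Set.uIcc 0 T) => lensMarginal ω (U N) (ψ₀ N) k τ) f g := by
  have hcontr : ∀ (N : ℕ) (τ : Set.uIcc 0 T) (f : L2 k),
      ‖timeMarginal ω (U N) (ψ₀ N) k τ f‖ ≤ ‖f‖ := fun N τ f =>
    norm_timeMarginal_le (fun h =>
      ((hU N (hk.trans h)).isometry _ _).trans (hnorm N (hk.trans h))) f
  have hE : ∀ f : L2 k, Tendsto (fun τ : Set.uIcc 0 T => lensPull ω (τ : ℝ) f) (𝓝 τ₀)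
      (𝓝 (lensPull ω (τ₀ : ℝ) f)) := fun f =>
    (tendsto_lensPull ω f τ₀).comp (continuous_subtype_val.tendsto τ₀)
  have key : ∀ f g : L2 k, EquiAt (𝓝 τ₀) τ₀
      (fun N (τ : Set.uIcc 0 T) => timeMarginal ω (U N) (ψ₀ N) k τ) f g := by
    refine equiAt_of_dense dense_schwartz hcontr ?_
    rintro _ ⟨f, rfl⟩ _ ⟨g, rfl⟩
    -- Beyond this index the energy bound holds, the two-particle marginal exists, and the
    -- `k`-particle marginal is not set to zero.
    refine equiAt_nat (max N₀ (max 2 k)) (fun ε hε => ?_) fun N => ?_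
    · obtain ⟨K, hK⟩ : ∃ K, K = commBound V ω f g (lensScale ω a * massV V * c) := ⟨_, rfl⟩
      have hlim : Tendsto (fun τ : Set.uIcc 0 T =>
          K * |lensTimeInv ω (τ : ℝ) - lensTimeInv ω (τ₀ : ℝ)|) (𝓝 τ₀) (𝓝 0) := by
        have h1 : Continuous fun τ : Set.uIcc 0 T =>
            K * |lensTimeInv ω (τ : ℝ) - lensTimeInv ω (τ₀ : ℝ)| :=
          continuous_const.mul ((((continuous_lensTimeInv ω).comp continuous_subtype_val).sub
            continuous_const).abs)
        simpa using h1.tendsto τ₀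
      filter_upwards [hlim.eventually_le_const hε] with τ hτ N hN
      have hN1 : N₀ ≤ N := le_of_max_le_left hN
      have hN2 : 2 ≤ N := le_of_max_le_left (le_of_max_le_right hN)
      have hN3 : k ≤ N := le_of_max_le_right (le_of_max_le_right hN)
      have hN4 : 1 ≤ N := hk.trans hN3
      refine le_trans ?_ hτ
      rw [timeMarginal, timeMarginal, dif_pos hN3, dif_pos hN3, hK]
      exact norm_inner_marginalOp_lens_le (hU N hN4) hV hβ hN3 hN2 (hnorm N hN4) (hsymm N hN4) hc
        (henergy N hN1) f g (hT τ.2) (hT τ₀.2)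
    · exact ((continuous_inner_timeMarginal (fun h => hU N (hk.trans h)) (ψ₀ N) _ _).comp
        continuous_subtype_val).tendsto τ₀
  have h := equiAt_conj (E := fun τ : Set.uIcc 0 T => lensPull ω (τ : ℝ)) hcontr hE key f g
  simp only [← lensMarginal_eq_timeMarginal] at h
  exact h

end Marginals

/-! ### Weak limits -/

section WeakLimit

variable {k : ℕ}

theorem permL_invariant_of_tendsto {ι : Type*} {l : Filter ι} [l.NeBot]
    {u : ι → L2 k →L[ℂ] L2 k} {u' : L2 k →L[ℂ] L2 k}
    (hlim : ∀ x y, Tendsto (fun i => inner ℂ x (u i y)) l (𝓝 (inner ℂ x (u' y))))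
    (hu : ∀ i, (∀ σ f, permL σ (u i f) = u i f) ∧ ∀ σ f, u i (permL σ f) = u i f) :
    IsSymmetricOp u' := by
  refine isSymmetricOp_of_permL (fun σ f => ext_inner_left ℂ fun g => ?_)
    fun σ f => ext_inner_left ℂ fun g => ?_
  · rw [← inner_conj_symm, inner_permL_left, inner_conj_symm]
    refine tendsto_nhds_unique (hlim (permL σ⁻¹ g) f) ((hlim g f).congr fun i => ?_)
    rw [inner_permL_left, inv_inv, (hu i).1]
  · refine tendsto_nhds_unique (hlim g (permL σ f)) ((hlim g f).congr fun i => ?_)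
    rw [(hu i).2]

/-- `L⁽ᵏ⁾` cannot be applied to a weak limit directly. Instead the bounded operators `Bᵢ` with `uᵢ =
M Bᵢ M` have a weak limit `B'` along the ultrafilter, of trace at most `c`, and moving `M` onto the
test vectors identifies `u' = M B' M`. -/
theorem energyAtMost_of_tendsto {ι : Type*} (l : Ultrafilter ι) {u : ι → L2 k →L[ℂ] L2 k}
    {u' : L2 k →L[ℂ] L2 k} {c : ℝ}
    (hlim : ∀ x y, Tendsto (fun i => inner ℂ x (u i y)) l (𝓝 (inner ℂ x (u' y))))
    (hpos : ∀ i, (u i).IsPositive) (hE : ∀ᶠ i in l, EnergyAtMost (u i) c) :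
    EnergyAtMost u' c := by
  have hex : ∀ i, ∃ B, EnergyAtMost (u i) c →
      IsPosTrace B c ∧ u i = (invL k).comp (B.comp (invL k)) := by
    intro i
    by_cases h : EnergyAtMost (u i) c
    · obtain ⟨B, hB⟩ := h.exists_isPosTrace (hpos i)
      exact ⟨B, fun _ => hB⟩
    · exact ⟨0, fun h' => absurd h' h⟩
  choose B hB using hex
  have hB1 : ∀ᶠ i in l, IsPosTrace (B i) c := hE.mono fun i hi => (hB i hi).1
  obtain ⟨B', hB'⟩ := exists_weak_limit l (hB1.mono fun i hi x y => hi.norm_inner_le x y)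
  have hpt : IsPosTrace B' c := isPosTrace_of_tendsto hB1 hB'
  have hu : u' = (invL k).comp (B'.comp (invL k)) := by
    refine ContinuousLinearMap.ext fun y => ext_inner_left ℂ fun x => ?_
    refine tendsto_nhds_unique (hlim x y) ?_
    rw [ContinuousLinearMap.comp_apply, ContinuousLinearMap.comp_apply, ← inner_invL]
    refine (hB' (invL k x) (invL k y)).congr' (hE.mono fun i hi => ?_)
    change _ = inner ℂ x (u i y)
    rw [(hB i hi).2, ContinuousLinearMap.comp_apply, ContinuousLinearMap.comp_apply, ← inner_invL]
  rw [hu]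
  exact hpt.energyAtMost

end WeakLimit

/-! ### Paths of marginal densities -/

section Paths

variable {k : ℕ} {J : ℕ → (L2 k →L[ℂ] L2 k)} {T : ℝ}

theorem norm_inner_sub_le_iSup {c : ℝ} {u : ℕ → ℝ → L2 k →L[ℂ] L2 k}
    (hu : ∀ N τ, IsPosTrace (u N τ) c) (f g : L2 k) (τ τ₀ : ℝ) (N : ℕ) :
    ‖inner ℂ f ((u N τ - u N τ₀) g)‖ ≤ ⨆ n, ‖inner ℂ f ((u n τ - u n τ₀) g)‖ := by
  refine le_ciSup (f := fun n => ‖inner ℂ f ((u n τ - u n τ₀) g)‖)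
    ⟨‖f‖ * ‖g‖ * c + ‖f‖ * ‖g‖ * c, ?_⟩ N
  rintro _ ⟨n, rfl⟩
  simp only [sub_apply, inner_sub_right]
  exact (norm_sub_le _ _).trans
    (add_le_add ((hu n τ).norm_inner_le f g) ((hu n τ₀).norm_inner_le f g))

/-- The continuous path `τ ↦ u_N(τ)`, for a family that is equicontinuous. -/
def pathOfEquiAt (hJ : IsDenseInCompactBall J) {c : ℝ} {u : ℕ → ℝ → L2 k →L[ℂ] L2 k}
    (hu : ∀ N τ, IsPosTrace (u N τ) c)
    (h : ∀ (τ₀ : Set.uIcc 0 T) (f g : L2 k),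
      EquiAt (𝓝 τ₀) τ₀ (fun N (τ : Set.uIcc 0 T) => u N τ) f g) (N : ℕ) : TraceClassPath J T where
  toFun τ := ⟨u N τ, (hu N τ).isTraceClass⟩
  continuous τ₀ := by
    refine tendsto_weakStarDist hJ (c := c) (Eventually.of_forall fun τ => hu N τ)
      (Eventually.of_forall fun _ => hu N τ₀) fun x y => ?_
    exact squeeze_zero_norm (fun τ => norm_inner_sub_le_iSup hu x y τ τ₀ N)
      (tendsto_iSup_of_equiAt (h τ₀ y x))

theorem exists_isCompact_pathOfEquiAt (hJ : IsDenseInCompactBall J) {c : ℝ}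
    {u : ℕ → ℝ → L2 k →L[ℂ] L2 k} (hu : ∀ N τ, IsPosTrace (u N τ) c)
    (h : ∀ (τ₀ : Set.uIcc 0 T) (f g : L2 k),
      EquiAt (𝓝 τ₀) τ₀ (fun N (τ : Set.uIcc 0 T) => u N τ) f g) :
    ∃ K : Set (TraceClassPath J T), IsCompact K ∧ ∀ N, pathOfEquiAt hJ hu h N ∈ K :=
  ⟨_, isCompact_paths hJ c
    (fun f g (τ τ₀ : Set.uIcc 0 T) => ⨆ n, ‖inner ℂ f ((u n τ - u n τ₀) g)‖)
    fun f g τ₀ => tendsto_iSup_of_equiAt (h τ₀ g f),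
    fun N => ⟨fun τ => hu N τ, fun f g τ τ₀ => norm_inner_sub_le_iSup hu f g τ τ₀ N⟩⟩

theorem tendsto_inner_of_tendsto_path (hJ : IsDenseInCompactBall J) {ι : Type*} {l : Filter ι}
    {c : ℝ} {γ : ι → TraceClassPath J T} {γ' : TraceClassPath J T}
    (hγ : ∀ i τ, IsPosTrace ((γ i).toFun τ).op c) (h : Tendsto γ l (𝓝 γ')) (τ : Set.uIcc 0 T)
    (x y : L2 k) :
    Tendsto (fun i => inner ℂ x (((γ i).toFun τ).op y)) l (𝓝 (inner ℂ x ((γ'.toFun τ).op y))) := by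
  refine tendsto_inner_of_weakStarDist (γ := fun i => (γ i).toFun τ) hJ
    (Eventually.of_forall fun i => hγ i τ) ?_ x y
  exact squeeze_zero (fun i => weakStarDist_nonneg _ _)
    (fun i => weakStarDist_le_pathDist hJ (γ i) γ' τ) ((tendsto_path_iff hJ).1 h)

end Paths

end

end LensBBGKY

/-! ### The compactness theorem. -/

theorem mainTheorem7
    -- the pair interaction: even, Schwartz, with nonpositive integral
    (V : 𝓢(ℝ, ℝ)) (hVeven : ∀ x, V (-x) = V x) (hVint : ∫ x, V x ≤ 0)
    (ω β : ℝ) (hβ : β ∈ Set.Ioo (0 : ℝ) 1)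
    -- the time interval
    (T₀ : ℝ) (hT₀ : 0 < T₀) (hωT₀ : |ω| * T₀ < Real.pi / 2)
    (T : ℝ) (hT : T ∈ Set.Icc (-lensTime ω T₀) (lensTime ω T₀))
    -- the dense sequences of compact operators in the metrics
    (J : ∀ k : ℕ+, ℕ → (L2 k →L[ℂ] L2 k)) (hJ : ∀ k, IsDenseInCompactBall (J k))
    -- the evolution of symmetric normalized initial data
    (U : ∀ N : ℕ, ℝ → (L2 N →L[ℂ] L2 N)) (hU : ∀ N, 1 ≤ N → IsEvolution V ω β N (U N))
    (ψ₀ : ∀ N : ℕ, L2 N) (hnorm : ∀ N, 1 ≤ N → ‖ψ₀ N‖ = 1)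
    (hsymm : ∀ N, 1 ≤ N → IsSymmetricState (ψ₀ N))
    -- the energy condition
    (C : ℝ)
    (henergy : ∀ k : ℕ+, ∃ N₀ : ℕ, ∀ N ≥ N₀,
      ∀ τ ∈ Set.Icc (-lensTime ω T₀) (lensTime ω T₀),
        EnergyAtMost (lensMarginal ω (U N) (ψ₀ N) k τ) (C ^ (k : ℕ))) :
    ∃ Γ : ℕ → HierarchySpace J T,
      (∀ (N : ℕ) (k : ℕ+) (τ : Set.uIcc 0 T),
        ((Γ N k).toFun τ).op = lensMarginal ω (U N) (ψ₀ N) k τ) ∧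
      IsCompact (closure (Set.range Γ)) ∧
      ∀ u : HierarchySpace J T, MapClusterPt u atTop Γ →
        ∀ (k : ℕ+) (τ : Set.uIcc 0 T),
          ((u k).toFun τ).op.IsPositive ∧
          IsSymmetricOp ((u k).toFun τ).op ∧
          (opTrace ((u k).toFun τ).op).re ≤ 1 ∧
          EnergyAtMost ((u k).toFun τ).op (C ^ (k : ℕ)) := by
  have hsub : Set.uIcc 0 T ⊆ Set.Icc (-lensTime ω T₀) (lensTime ω T₀) :=
    Set.OrdConnected.uIcc_subset Set.ordConnected_Icc
      (Set.mem_Icc.2 ⟨by linarith [hT.1, hT.2], by linarith [hT.1, hT.2]⟩) hT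
  have hone : ∀ (N : ℕ) (k : ℕ+) (τ : ℝ), (k : ℕ) ≤ N →
      ‖U N (lensTimeInv ω τ) (ψ₀ N)‖ = 1 := fun N k τ h =>
    ((hU N (k.pos.trans_le h)).isometry _ _).trans (hnorm N (k.pos.trans_le h))
  have hpos : ∀ (k : ℕ+) (N : ℕ) (τ : ℝ), IsPosTrace (lensMarginal ω (U N) (ψ₀ N) k τ) 1 :=
    fun k N τ => isPosTrace_lensMarginal ω τ (U N) (ψ₀ N) (hone N k τ)
  -- The interaction is a pair interaction, so the two-particle energy bound yields equicontinuity
  -- for every `k`.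
  obtain ⟨N₂, hN₂⟩ := henergy 2
  have hequi : ∀ (k : ℕ+) (τ₀ : Set.uIcc 0 T) (f g : L2 k), EquiAt (𝓝 τ₀) τ₀
      (fun N (τ : Set.uIcc 0 T) => lensMarginal ω (U N) (ψ₀ N) k τ) f g := fun k τ₀ f g =>
    equiAt_lensMarginal hVeven hβ.2.le hsub hU hnorm hsymm (sq_nonneg C) hN₂ k.pos τ₀ f g
  refine ⟨fun N k => pathOfEquiAt (hJ k) (hpos k) (hequi k) N, fun _ _ _ => rfl, ?_, ?_⟩
  -- Tychonoff: the whole sequence lies in the product of the compact sets found for each `k`.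
  · choose K hK hΓ using fun k : ℕ+ => exists_isCompact_pathOfEquiAt (hJ k) (hpos k) (hequi k)
    have : ∀ k : ℕ+, R1Space (TraceClassPath (J k) T) := fun k => r1Space_path (hJ k)
    refine (isCompact_univ_pi hK).closure_of_subset ?_
    rintro _ ⟨N, rfl⟩ k -
    exact hΓ k N
  · intro u hu k τ
    -- Passing to an ultrafilter turns the cluster point into a limit, and the same ultrafilter
    -- gives weak limits of the operators `B_N` in the energy bound.
    obtain ⟨l, hl, hlu⟩ := mapClusterPt_iff_ultrafilter.1 hu
    have hlim : ∀ x y, Tendsto (fun N => inner ℂ x (lensMarginal ω (U N) (ψ₀ N) k τ y)) l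
        (𝓝 (inner ℂ x (((u k).toFun τ).op y))) :=
      tendsto_inner_of_tendsto_path (hJ k) (fun N τ => hpos k N τ)
        (((continuous_apply k).tendsto u).comp hlu) τ
    have hpt : IsPosTrace ((u k).toFun τ).op 1 :=
      isPosTrace_of_tendsto (Eventually.of_forall fun N => hpos k N τ) hlim
    refine ⟨hpt.isPositive, permL_invariant_of_tendsto hlim fun N => ?_, hpt.trace_le, ?_⟩
    · exact lensMarginal_permL ω τ (U N) (ψ₀ N) fun h =>
        (hU N (k.pos.trans_le h)).isSymmetricState hVeven (hsymm N (k.pos.trans_le h)) _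
    · obtain ⟨N₀, hN₀⟩ := henergy k
      refine energyAtMost_of_tendsto l hlim (fun N => (hpos k N τ).isPositive) ?_
      exact ((eventually_ge_atTop N₀).filter_mono hl).mono fun N hN => hN₀ N hN τ (hsub τ.2)
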